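/- **Setting.** Let $\hat\Omega\subset\mathbb R^2$ be a bounded polygonal domain and, for an integer $m\ge 1$, let $\mathbf F\in[W^{m+1}_\infty(\hat\Omega)]^2$ be a bi-Lipschitz map of $\hat\Omega$ onto its image with $\det\nabla\mathbf F\ge j_0>0$ a.e. A mesh $\hat{\mathcal T}_h$ of $\hat\Omega$ is a finite partition into simple polygons $\hat E$ of diameter $h_{\hat E}$, with $h=\max h_{\hat E}$. It is shape regular with parameter $\alpha>0$: each $\hat E$ is a finite union of (one or more) open sets, each star-shaped with respect to a ball of radius greater than $\alpha h_{\hat E}$, and each edge of $\hat E$ is longer than $\alpha h_{\hat E}$. **Virtual element spaces.** For a polygon $E$ with possibly curved edges $e$, of lengths $l_e$ and with arc length parametrisations $\gamma_e:[0,l_e]\to e$, and for $k\ge1$, let $$W_k(E)=\{v\in H^1(E)\cap C^0(\overline E):\ \Delta v\in\mathbb P_k(E),\ v|_e\circ\gamma_e\in\mathbb P_k([0,l_e])\ \text{for every edge } e\}.$$ Let $m_\alpha(x)=((x-x_E)/h_E)^\alpha$ be the scaled monomials of $E$ ($x_E$ the centroid, $h_E$ the diameter), regarded as functions on $\mathbb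 R^2$. The degrees of freedom of order $k$ are the values at the vertices, the edge moments $\frac1{l_e}\int_0^{l_e}(v\circ\gamma_e)\,q$ against scaled monomials $q$ of degree at most $k-2$, and the internal moments $\mathrm{dof}_\alpha(v)=\frac1{|E|}\int_E v\,m_\alpha$, $|\alpha|\le k-2$. Let $\Pi^*_k:W_k(E)\to\mathbb P_k(E)$ be an auxiliary projection: a linear operator which depends only on the degrees of freedom, reproduces the polynomials of degree at most $k$ that lie in $W_k(E)$, and is $L^2$-stable, $\|\Pi^*_kv\|_{0,E}\le c_*\|v\|_{0,E}$. Set $$V_k(E)=\Big\{v\in W_k(E):\ \int_E(\Pi^*_kv-v)\,m_\alpha\,dx=0\ \text{ for } k-1\le|\alpha|\le k\Big\}.$$ The global space $\hat V^l_h$ consists of the $v\in H^1(\hat\Omega)$ with $v|_{\hat E}\in V_l(\hat E)$ for all $\hat E\in\hat{\mathcal T}_h$. **Mapping.** Let $k\ge1$, $1\le l\le m$, and let $\mathbf F_h\in[\hat V^l_h]^2$ satisfy, on each $\hat E\in\hat{\mathcal T}_h$ and for all $s\in\{0,\dots,l\}$, $$\|\mathbf F-\mathbf F_h\|_{0,\hat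 E}+h_{\hat E}|\mathbf F-\mathbf F_h|_{1,\hat E}\le c_F\,h_{\hat E}^{s+1}|\mathbf F|_{s+1,\hat E}.$$ Put $E_h=\mathbf F_h(\hat E)$ (a polygon whose edges are the images under $\mathbf F_h$ of the edges of $\hat E$) and $E_h^\pi=(\Pi^0_l\mathbf F_h)(\hat E)$, where $\Pi^0_l$ is the componentwise $L^2(\hat E)$ projection onto polynomials of degree at most $l$. Let $\Pi^0_k$ denote the $L^2(E_h)$ projection onto $\mathbb P_k$, polynomials being extended to all of $\mathbb R^2$. For $v_h\in V_k(E_h)$ let $\Pi^0_{h,k}v_h\in\mathbb P_k$ be determined by $$\int_{E_h^\pi}\Pi^0_{h,k}v_h\,m_\alpha\,dx=\begin{cases}|E_h^\pi|\,\mathrm{dof}_\alpha(v_h), & |\alpha|\le k-2,\\[2pt] \displaystyle\int_{E_h^\pi}\Pi^*_kv_h\,m_\alpha\,dx, & k-1\le|\alpha|\le k,\end{cases}$$ with $m_\alpha$ the scaled monomials and $\Pi^*_k$ the auxiliary projection of $E_h$. **Theorem.** There is $h_0>0$, depending on $\hat\Omega$, $\mathbf F$, $m$, $k$, $l$, $\alpha$,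 $j_0$, $c_F$, $c_*$ but not on the mesh or on $\mathbf F_h$, such that if $h\le h_0$, then for every $\hat E\in\hat{\mathcal T}_h$ and every $v_h\in V_k(E_h)$ the conditions above determine $\Pi^0_{h,k}v_h$ uniquely, and for all $s\in\{0,1,\dots,l\}$ $$\|\Pi^0_kv_h-\Pi^0_{h,k}v_h\|_{0,E_h}\le C\,h_{\hat E}^s\,\|v_h\|_{0,E_h},\qquad \|\Pi^0_{h,k}v_h\|_{0,E_h}\le C\,\|v_h\|_{0,E_h}.$$ Here $C$ depends only on $\alpha$, $k$, $l$, $s$, $j_0$, $c_F$, $c_*$ and on an upper bound for $\|\mathbf F\|_{W^{s+1}_\infty(\hat E)}$. -/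

import Mathlib

open MeasureTheory Set
open scoped NNReal ENNReal

noncomputable section

namespace IsoVEM

/-- The Euclidean plane. -/
abbrev Plane : Type := EuclideanSpace ℝ (Fin 2)

/-! ### Weak derivatives and Sobolev norms -/

/-- The (classical) partial derivative in the `i`-th coordinate direction. -/
def partialD (i : Fin 2) (φ : Plane → ℝ) : Plane → ℝ :=
  fun x => fderiv ℝ φ x (EuclideanSpace.single i 1)

/-- The classical partial derivative `∂₁^{β.1} ∂₂^{β.2} φ`; multi-indices are pairs. -/
def multiD (β : ℕ × ℕ) (φ : Plane → ℝ) : Plane → ℝ :=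
  (partialD 0)^[β.1] ((partialD 1)^[β.2] φ)

/-- Smooth functions with compact support contained in `ω`. -/
def IsTest (ω : Set Plane) (φ : Plane → ℝ) : Prop :=
  ContDiff ℝ (⊤ : ℕ∞) φ ∧ HasCompactSupport φ ∧ tsupport φ ⊆ ω

/-- `w` is the weak derivative of `u` on `ω` with multi-index `β`. -/
def HasWeakDeriv (ω : Set Plane) (β : ℕ × ℕ) (u w : Plane → ℝ) : Prop :=
  LocallyIntegrableOn u ω ∧ LocallyIntegrableOn w ω ∧
    ∀ φ, IsTest ω φ →
      ∫ x in ω, u x * multiD β φ x = (-1) ^ (β.1 + β.2) * ∫ x in ω, w x * φ x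

open Classical in
/-- The weak derivative of `u` on `ω` with multi-index `β` (zero if there is none). -/
def weakDeriv (ω : Set Plane) (β : ℕ × ℕ) (u : Plane → ℝ) : Plane → ℝ :=
  if h : ∃ w, HasWeakDeriv ω β u w then h.choose else 0

/-- The `L²(ω)` norm. -/
def l2Norm (ω : Set Plane) (u : Plane → ℝ) : ℝ≥0∞ := eLpNorm u 2 (volume.restrict ω)

/-- Membership in the Sobolev space of functions with weak derivatives up to order `r`
in `L^p(ω)`. -/
def MemSobolev (r : ℕ) (p : ℝ≥0∞) (ω : Set Plane) (u : Plane → ℝ) : Prop :=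
  MemLp u p (volume.restrict ω) ∧
    ∀ β : ℕ × ℕ, β.1 + β.2 ≤ r →
      ∃ w, HasWeakDeriv ω β u w ∧ MemLp w p (volume.restrict ω)

/-- The `L²(ω)` norm of a vector field. -/
def vecL2Norm (ω : Set Plane) (G : Plane → Plane) : ℝ≥0∞ :=
  (∑ i : Fin 2, l2Norm ω (fun x => G x i) ^ 2) ^ (1 / 2 : ℝ)

/-- The seminorm `|G|_{r,ω}` of a vector field: the `L²(ω)` norm of all the weak derivatives of
order exactly `r`. -/
def vecSeminorm (r : ℕ) (ω : Set Plane) (G : Plane → Plane) : ℝ≥0∞ :=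
  (∑ i : Fin 2, ∑ β ∈ Finset.HasAntidiagonal.antidiagonal r,
    l2Norm ω (weakDeriv ω β (fun x => G x i)) ^ 2) ^ (1 / 2 : ℝ)

/-- The norm `‖G‖_{r,∞,ω}` of a vector field: the maximum of the `L^∞(ω)` norms of the weak
derivatives of order at most `r` of its components. -/
def vecNormTop (r : ℕ) (ω : Set Plane) (G : Plane → Plane) : ℝ≥0∞ :=
  Finset.univ.sup fun i : Fin 2 => (Finset.range (r + 1)).sup fun q =>
    (Finset.HasAntidiagonal.antidiagonal q).sup fun β =>
      eLpNorm (weakDeriv ω β (fun x => G x i)) ∞ (volume.restrict ω)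

/-- The determinant of the (weak) Jacobian matrix of a vector field on `ω`. -/
def jacobianDet (ω : Set Plane) (G : Plane → Plane) (x : Plane) : ℝ :=
  (Matrix.of fun i j : Fin 2 =>
    weakDeriv ω (if j = 0 then (1, 0) else (0, 1)) (fun y => G y i) x).det

/-! ### Polynomials and the `L²` projection -/

/-- Bivariate polynomials. -/
abbrev Poly : Type := MvPolynomial (Fin 2) ℝ

/-- The polynomial function on the whole plane defined by `p`. -/
def peval (p : Poly) (x : Plane) : ℝ := MvPolynomial.eval (fun i => x i) p

/-- `p` is the `L²(ω)`-orthogonal projection of `v` onto the polynomials of degree at most `k`. -/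
def IsL2Proj (k : ℕ) (ω : Set Plane) (v : Plane → ℝ) (p : Poly) : Prop :=
  p.totalDegree ≤ k ∧
    ∀ q : Poly, q.totalDegree ≤ k → ∫ x in ω, (v x - peval p x) * peval q x = 0

open Classical in
/-- The `L²(ω)` projection `Π⁰_k v`. -/
def l2Proj (k : ℕ) (ω : Set Plane) (v : Plane → ℝ) : Poly :=
  if h : ∃ p, IsL2Proj k ω v p then h.choose else 0

/-- The componentwise `L²(ω)` projection of a vector field onto polynomials of degree at most `l`,
as a map of the whole plane. -/
def vecL2Proj (l : ℕ) (ω : Set Plane) (G : Plane → Plane) (x : Plane) : Plane :=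
  WithLp.toLp 2 fun i => peval (l2Proj l ω (fun y => G y i)) x

/-! ### Curved polygons and virtual element spaces -/

/-- A polygon with possibly curved edges: its domain and parametrisations over `[0,1]` of its
edges. -/
structure CurvedPolygon where
  domain : Set Plane
  numEdges : ℕ
  edge : Fin numEdges → ℝ → Plane

namespace CurvedPolygon

variable (E : CurvedPolygon)

/-- The diameter `h_E`. -/
def diam : ℝ := Metric.diam E.domain

/-- The length `l_e` of an edge. -/
def edgeLength (i : Fin E.numEdges) : ℝ := (eVariationOn (E.edge i) (Icc 0 1)).toReal

/-- The arc length parametrisation `γ_e : [0, l_e] → e` of an edge. -/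
def arcParam (i : Fin E.numEdges) : ℝ → Plane :=
  naturalParameterization (E.edge i) (Icc 0 1) 0

/-- The centroid of `E`. -/
def centroid : Plane := ⨍ x in E.domain, x

/-- The scaled monomial `m_α(x) = ((x - x_E) / h_E)^α` of `E`, as a function on the plane. -/
def monomial (α : ℕ × ℕ) (x : Plane) : ℝ :=
  ((x 0 - E.centroid 0) / E.diam) ^ α.1 * ((x 1 - E.centroid 1) / E.diam) ^ α.2

/-- The internal moment of `v` with respect to the scaled monomial `m_α`. -/
def internalDof (α : ℕ × ℕ) (v : Plane → ℝ) : ℝ :=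
  (volume.real E.domain)⁻¹ * ∫ x in E.domain, v x * E.monomial α x

/-- The moment of `v` along the `i`-th edge with respect to the `j`-th scaled monomial on
`[0, l_e]`. -/
def edgeDof (i : Fin E.numEdges) (j : ℕ) (v : Plane → ℝ) : ℝ :=
  (E.edgeLength i)⁻¹ * ∫ t in (0 : ℝ)..E.edgeLength i,
    v (E.arcParam i t) * ((t - E.edgeLength i / 2) / E.edgeLength i) ^ j

/-- `v` and `w` have the same degrees of freedom of order `k`: vertex values, edge moments of order
at most `k - 2` and internal moments of order at most `k - 2`. -/
def SameDofs (k : ℕ) (v w : Plane → ℝ) : Prop :=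
  (∀ i, v (E.edge i 0) = w (E.edge i 0)) ∧
  (∀ i j, j + 2 ≤ k → E.edgeDof i j v = E.edgeDof i j w) ∧
  (∀ α : ℕ × ℕ, α.1 + α.2 + 2 ≤ k → E.internalDof α v = E.internalDof α w)

/-- The enlarged local space `W_k(E)`: functions in `H¹(E) ∩ C⁰(closure E)` whose (distributional)
Laplacian is a polynomial of degree at most `k` and which on each edge are polynomials of degree at
most `k` in the arc length. -/
def MemW (k : ℕ) (v : Plane → ℝ) : Prop :=
  MemSobolev 1 2 E.domain v ∧ ContinuousOn v (closure E.domain) ∧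
  (∃ p : Poly, p.totalDegree ≤ k ∧ ∀ φ, IsTest E.domain φ →
    ∫ x in E.domain, v x * (multiD (2, 0) φ x + multiD (0, 2) φ x) =
      ∫ x in E.domain, peval p x * φ x) ∧
  (∀ i, ∃ q : Polynomial ℝ, q.natDegree ≤ k ∧
    ∀ t ∈ Icc 0 (E.edgeLength i), v (E.arcParam i t) = q.eval t)

/-- `P` is an auxiliary projection `Π^*_k : W_k(E) → ℙ_k(E)`: it is linear, computable from the
degrees of freedom, reproduces the polynomials in `W_k(E)` and is `L²`-stable with
constant `c`. -/
structure IsAuxProj (k : ℕ) (c : ℝ≥0) (P : (Plane → ℝ) → Poly) : Prop where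
  degree_le : ∀ v, E.MemW k v → (P v).totalDegree ≤ k
  map_add : ∀ v w, E.MemW k v → E.MemW k w → P (fun x => v x + w x) = P v + P w
  map_smul : ∀ (a : ℝ) v, E.MemW k v → P (fun x => a * v x) = a • P v
  computable : ∀ v w, E.MemW k v → E.MemW k w → E.SameDofs k v w → P v = P w
  reproduces : ∀ p : Poly, p.totalDegree ≤ k → E.MemW k (peval p) → P (peval p) = p
  stable : ∀ v, E.MemW k v → l2Norm E.domain (peval (P v)) ≤ c * l2Norm E.domain v

/-- The enhanced local virtual element space `V_k(E)` determined by the auxiliary projection `P`: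
the moments of `v` of order `k - 1` and `k` agree with those of `P v`. -/
def MemV (k : ℕ) (P : (Plane → ℝ) → Poly) (v : Plane → ℝ) : Prop :=
  E.MemW k v ∧ ∀ α : ℕ × ℕ, α.1 + α.2 ≤ k → k < α.1 + α.2 + 2 →
    ∫ x in E.domain, (peval (P v) x - v x) * E.monomial α x = 0

/-- The image of a (curved) polygon under a map of the plane. -/
def map (G : Plane → Plane) : CurvedPolygon where
  domain := G '' E.domain
  numEdges := E.numEdges
  edge := fun i t => G (E.edge i t)

/-- `p` is the approximate projection `Π⁰_{h,k} v` of `v ∈ V_k(E)`, computed on the projected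
element `Epi`: its moments on `Epi` of order at most `k - 2` are given by the internal degrees of
freedom of `v`, and those of order `k - 1` and `k` are the moments on `Epi` of `P v`, where `P` is
the auxiliary projection. All scaled monomials are those of `E`. -/
def IsApproxProj (k : ℕ) (Epi : Set Plane) (P : (Plane → ℝ) → Poly) (v : Plane → ℝ)
    (p : Poly) : Prop :=
  p.totalDegree ≤ k ∧
  (∀ α : ℕ × ℕ, α.1 + α.2 + 2 ≤ k →
    ∫ x in Epi, peval p x * E.monomial α x = volume.real Epi * E.internalDof α v) ∧
  (∀ α : ℕ × ℕ, α.1 + α.2 ≤ k → k < α.1 + α.2 + 2 →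
    ∫ x in Epi, peval p x * E.monomial α x = ∫ x in Epi, peval (P v) x * E.monomial α x)

end CurvedPolygon

/-! ### Polygonal meshes -/

/-- The interior of a simple polygon: a bounded open connected set whose frontier is a simple
closed polygonal curve (consecutive edges may be collinear). -/
structure PolygonalElement where
  numEdges : ℕ
  poly : Polygon Plane numEdges
  simple : ∀ i j, ∀ s ∈ Ico (0 : ℝ) 1, ∀ t ∈ Ico (0 : ℝ) 1,
    poly.edgePath ℝ i s = poly.edgePath ℝ j t → i = j ∧ s = t
  carrier : Set Plane
  isOpen : IsOpen carrier
  isConnected : IsConnected carrier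
  isBounded : Bornology.IsBounded carrier
  frontier_eq : frontier carrier = poly.boundary ℝ

namespace PolygonalElement

/-- A straight polygon seen as a curved polygon. -/
def toCurved (E : PolygonalElement) : CurvedPolygon where
  domain := E.carrier
  numEdges := E.numEdges
  edge := fun i t => E.poly.edgePath ℝ i t

/-- The diameter of an element. -/
def diam (E : PolygonalElement) : ℝ := Metric.diam E.carrier

/-- Shape regularity with parameter `a`: `E` is a finite union (possibly with one member) of open
sets, each star-shaped with respect to a ball of radius greater than `a h_E`, and every edge is
longer than `a h_E`. -/
def ShapeRegular (a : ℝ) (E : PolygonalElement) : Prop :=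
  (∃ (n : ℕ) (K : Fin n → Set Plane), E.carrier = ⋃ i, K i ∧ ∀ i, IsOpen (K i) ∧
    ∃ (c : Plane) (ρ : ℝ), a * E.diam < ρ ∧ Metric.ball c ρ ⊆ K i ∧
      ∀ y ∈ Metric.ball c ρ, StarConvex ℝ y (K i)) ∧
  ∀ i, a * E.diam < E.toCurved.edgeLength i

end PolygonalElement

/-- A bounded domain whose boundary consists of finitely many segments. -/
def IsPolygonalDomain (Ω : Set Plane) : Prop :=
  IsOpen Ω ∧ IsConnected Ω ∧ Bornology.IsBounded Ω ∧
    ∃ (n : ℕ) (a b : Fin n → Plane), frontier Ω = ⋃ i, segment ℝ (a i) (b i)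

/-- The family `T` of polygons partitions the domain `Ω`. -/
def IsMesh (Ω : Set Plane) {N : ℕ} (T : Fin N → PolygonalElement) : Prop :=
  (∀ e, (T e).carrier ⊆ Ω) ∧ (Pairwise fun e f => Disjoint (T e).carrier (T f).carrier) ∧
    closure Ω = ⋃ e, closure (T e).carrier

/-- The mesh size `h`, the maximal diameter of the elements. -/
def meshSize {N : ℕ} (T : Fin N → PolygonalElement) : ℝ := ⨆ e, (T e).diam

/-- The global virtual element space of degree `l` on a polygonal mesh of `Ω`, with auxiliary
projections `Q e` on the elements. -/
def MemGlobalV (l : ℕ) (Ω : Set Plane) {N : ℕ} (T : Fin N → PolygonalElement)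
    (Q : Fin N → (Plane → ℝ) → Poly) (v : Plane → ℝ) : Prop :=
  MemSobolev 1 2 Ω v ∧ ∀ e, (T e).toCurved.MemV l (Q e) v

/-! ### The reference-to-physical transformation and its virtual element approximation -/

/-- The assumptions on the reference-to-physical transformation `F : Ω → F(Ω)`: it is bi-Lipschitz,
of class `W^{m+1}_∞`, and its Jacobian determinant is bounded below by `j₀`. -/
def IsRefMap (m : ℕ) (j₀ : ℝ) (Ω : Set Plane) (F : Plane → Plane) : Prop :=
  (∃ L : ℝ, ∀ x ∈ Ω, ∀ y ∈ Ω, dist (F x) (F y) ≤ L * dist x y ∧ dist x y ≤ L * dist (F x) (F y)) ∧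
  (∀ i, MemSobolev (m + 1) ∞ Ω (fun x => F x i)) ∧
  ∀ᵐ x ∂volume.restrict Ω, j₀ ≤ jacobianDet Ω F x

/-- `Fh` approximates `F` with optimal order up to `l`, with constant `c`, on the element `E`. -/
def IsAccurateOn (l : ℕ) (c : ℝ≥0) (E : PolygonalElement) (F Fh : Plane → Plane) : Prop :=
  ∀ s ≤ l, vecL2Norm E.carrier (F - Fh) +
      ENNReal.ofReal E.diam * vecSeminorm 1 E.carrier (F - Fh) ≤
    c * ENNReal.ofReal (E.diam ^ (s + 1)) * vecSeminorm (s + 1) E.carrier F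

/-- The physical element `E_h = F_h(Ê)`. -/
def physElement (Fh : Plane → Plane) (E : PolygonalElement) : CurvedPolygon :=
  E.toCurved.map Fh

/-- The projected element `E_h^π = (Π⁰_l F_h)(Ê)`. -/
def projElement (l : ℕ) (Fh : Plane → Plane) (E : PolygonalElement) : Set Plane :=
  vecL2Proj l E.carrier Fh '' E.carrier

end IsoVEM

end

namespace IsoVEM

/-! ### Polynomials in scaled monomials -/

/-- The multi-indices of order at most `k`. -/
def multiIdx (k : ℕ) : Finset (ℕ × ℕ) :=
  (Finset.range (k + 1) ×ˢ Finset.range (k + 1)).filter fun β => β.1 + β.2 ≤ k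

@[simp] theorem mem_multiIdx {k : ℕ} {β : ℕ × ℕ} : β ∈ multiIdx k ↔ β.1 + β.2 ≤ k := by
  simp only [multiIdx, Finset.mem_filter, Finset.mem_product, Finset.mem_range]
  omega

/-- The monomial `((x - y) / d)^β`. -/
noncomputable def scaledMono (y : Plane) (d : ℝ) (β : ℕ × ℕ) (x : Plane) : ℝ :=
  ((x 0 - y 0) / d) ^ β.1 * ((x 1 - y 1) / d) ^ β.2

/-- The linear combination of scaled monomials with given coefficients. -/
noncomputable def monoSum (k : ℕ) (y : Plane) (d : ℝ) (c : ℕ × ℕ → ℝ) (x : Plane) : ℝ :=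
  ∑ β ∈ multiIdx k, c β * scaledMono y d β x

theorem contDiff_coord (i : Fin 2) {n : WithTop ℕ∞} : ContDiff ℝ n (fun x : Plane => x i) :=
  (EuclideanSpace.proj (𝕜 := ℝ) i).contDiff

theorem contDiff_scaledMono (y : Plane) (d : ℝ) (β : ℕ × ℕ) {n : WithTop ℕ∞} :
    ContDiff ℝ n (scaledMono y d β) := by
  unfold scaledMono
  exact ((((contDiff_coord 0).sub contDiff_const).div_const d).pow _).mul
    ((((contDiff_coord 1).sub contDiff_const).div_const d).pow _)

theorem continuous_scaledMono (y : Plane) (d : ℝ) (β : ℕ × ℕ) : Continuous (scaledMono y d β) :=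
  (contDiff_scaledMono y d β (n := 0)).continuous

theorem contDiff_monoSum (k : ℕ) (y : Plane) (d : ℝ) (c : ℕ × ℕ → ℝ) {n : WithTop ℕ∞} :
    ContDiff ℝ n (monoSum k y d c) := by
  unfold monoSum
  exact ContDiff.sum fun β _ => contDiff_const.mul (contDiff_scaledMono y d β)

theorem continuous_monoSum (k : ℕ) (y : Plane) (d : ℝ) (c : ℕ × ℕ → ℝ) :
    Continuous (monoSum k y d c) :=
  (contDiff_monoSum k y d c (n := 0)).continuous

theorem abs_coord_le (x : Plane) (i : Fin 2) : |x i| ≤ ‖x‖ := by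
  simpa using PiLp.norm_apply_le x i

theorem abs_coord_sub_le (x y : Plane) (i : Fin 2) : |x i - y i| ≤ dist x y := by
  rw [dist_eq_norm]
  simpa using abs_coord_le (x - y) i

theorem abs_scaledMono_le {y x : Plane} {d r : ℝ} (hd : 0 < d) (hr : 1 ≤ r)
    (hx : dist x y ≤ r * d) {β : ℕ × ℕ} {k : ℕ} (hβ : β.1 + β.2 ≤ k) :
    |scaledMono y d β x| ≤ r ^ k := by
  have h : ∀ i : Fin 2, |(x i - y i) / d| ≤ r := fun i => by
    rw [abs_div, abs_of_pos hd, div_le_iff₀ hd]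
    exact (abs_coord_sub_le x y i).trans hx
  unfold scaledMono
  rw [abs_mul, abs_pow, abs_pow]
  calc _ ≤ r ^ β.1 * r ^ β.2 := by
        gcongr
        · exact h 0
        · exact h 1
    _ = r ^ (β.1 + β.2) := (pow_add _ _ _).symm
    _ ≤ r ^ k := pow_le_pow_right₀ hr hβ

theorem totalDegree_aeval_le_of_le_one (p : Poly) (f : Fin 2 → Poly)
    (hf : ∀ i, (f i).totalDegree ≤ 1) :
    (MvPolynomial.aeval f p).totalDegree ≤ p.totalDegree := by
  rw [MvPolynomial.aeval_eq_eval₂Hom, MvPolynomial.coe_eval₂Hom, MvPolynomial.eval₂_eq']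
  refine MvPolynomial.totalDegree_finsetSum_le fun m hm => ?_
  refine (MvPolynomial.totalDegree_mul _ _).trans ?_
  have h1 : (algebraMap ℝ Poly (p.coeff m)).totalDegree = 0 := MvPolynomial.totalDegree_C _
  rw [h1, zero_add]
  refine (MvPolynomial.totalDegree_finsetProd _ _).trans ?_
  calc _ ≤ ∑ i : Fin 2, m i := Finset.sum_le_sum fun i _ =>
        (MvPolynomial.totalDegree_pow _ _).trans
          ((Nat.mul_le_mul_left _ (hf i)).trans_eq (mul_one _))
    _ ≤ _ := by
      have := MvPolynomial.le_totalDegree hm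
      rwa [Finsupp.sum_fintype _ _ (by simp)] at this

theorem totalDegree_affine_le (a b : ℝ) (i : Fin 2) :
    (MvPolynomial.C a * MvPolynomial.X i + MvPolynomial.C b : Poly).totalDegree ≤ 1 := by
  refine (MvPolynomial.totalDegree_add _ _).trans (max_le ?_ ?_)
  · refine (MvPolynomial.totalDegree_mul _ _).trans ?_
    simp
  · simp

theorem peval_aeval (p : Poly) (f : Fin 2 → Poly) (x : Plane) :
    peval (MvPolynomial.aeval f p) x = MvPolynomial.eval (fun i => peval (f i) x) p := by
  have := MvPolynomial.comp_aeval_apply (f := f) (MvPolynomial.aeval (fun i => x i) :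
    Poly →ₐ[ℝ] ℝ) p
  simpa [peval, MvPolynomial.aeval_eq_eval] using this

theorem exists_peval_eq_monoSum {k : ℕ} {p : Poly} (hp : p.totalDegree ≤ k) (y : Plane) {d : ℝ}
    (hd : d ≠ 0) : ∃ c : ℕ × ℕ → ℝ, ∀ x, peval p x = monoSum k y d c x := by
  let f : Fin 2 → Poly := fun i => MvPolynomial.C d * MvPolynomial.X i + MvPolynomial.C (y i)
  let q : Poly := MvPolynomial.aeval f p
  have hq : q.totalDegree ≤ k :=
    (totalDegree_aeval_le_of_le_one p f fun i => totalDegree_affine_le _ _ _).trans hp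
  have hpq : ∀ x : Plane, peval p x = MvPolynomial.eval (fun i => (x i - y i) / d) q := by
    intro x
    have := peval_aeval p f (WithLp.toLp 2 fun i => (x i - y i) / d)
    simp only [peval, f, map_add, map_mul, MvPolynomial.eval_C, MvPolynomial.eval_X] at this
    rw [this, peval]
    congr 2
    funext i
    field_simp
    ring
  let e : ℕ × ℕ → (Fin 2 →₀ ℕ) := fun β => Finsupp.equivFunOnFinite.symm ![β.1, β.2]
  refine ⟨fun β => q.coeff (e β), fun x => ?_⟩
  rw [hpq, MvPolynomial.eval_eq', monoSum]
  refine Finset.sum_of_injOn (fun m => (m 0, m 1)) ?_ ?_ ?_ ?_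
  · intro m _ m' _ h
    simp only [Prod.mk.injEq] at h
    ext i
    fin_cases i
    · exact h.1
    · exact h.2
  · intro m hm
    have := MvPolynomial.le_totalDegree hm
    rw [Finsupp.sum_fintype _ _ (by simp), Fin.sum_univ_two] at this
    simpa using this.trans hq
  · intro β _ hβ
    by_cases h0 : q.coeff (e β) = 0
    · simp [h0]
    · exact (hβ ⟨e β, by simpa using h0, by simp [e]⟩).elim
  · intro m _
    have : e (m 0, m 1) = m := by
      ext i
      fin_cases i <;> simp [e]
    simp only [this, Fin.prod_univ_two, scaledMono]

theorem exists_poly_eq_monoSum (k : ℕ) (y : Plane) (d : ℝ) (c : ℕ × ℕ → ℝ) :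
    ∃ p : Poly, p.totalDegree ≤ k ∧ ∀ x, peval p x = monoSum k y d c x := by
  let f : Fin 2 → Poly := fun i =>
    MvPolynomial.C d⁻¹ * MvPolynomial.X i + MvPolynomial.C (-(y i) * d⁻¹)
  refine ⟨∑ β ∈ multiIdx k, MvPolynomial.C (c β) * (f 0 ^ β.1 * f 1 ^ β.2), ?_, fun x => ?_⟩
  · refine MvPolynomial.totalDegree_finsetSum_le fun β hβ => ?_
    refine (MvPolynomial.totalDegree_mul _ _).trans ?_
    rw [MvPolynomial.totalDegree_C, zero_add]
    refine (MvPolynomial.totalDegree_mul _ _).trans ((Nat.add_le_add ?_ ?_).trans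
      (mem_multiIdx.1 hβ)) <;>
    exact (MvPolynomial.totalDegree_pow _ _).trans
          ((Nat.mul_le_mul_left _ (totalDegree_affine_le _ _ _)).trans_eq (mul_one _))
  · simp only [peval, map_sum, map_mul, map_pow, MvPolynomial.eval_C, monoSum, scaledMono, f,
      map_add, MvPolynomial.eval_X]
    refine Finset.sum_congr rfl fun β _ => ?_
    congr 3 <;> ring

theorem peval_contDiff (p : Poly) {n : WithTop ℕ∞} : ContDiff ℝ n (peval p) := by
  obtain ⟨c, hc⟩ := exists_peval_eq_monoSum (le_refl p.totalDegree) 0 one_ne_zero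
  rw [funext hc]
  exact contDiff_monoSum _ _ _ _

theorem peval_continuous (p : Poly) : Continuous (peval p) :=
  (peval_contDiff p (n := 0)).continuous

theorem peval_injective {p q : Poly} (h : ∀ x, peval p x = peval q x) : p = q :=
  MvPolynomial.funext fun x => by simpa [peval] using h (WithLp.toLp 2 x)

@[simp] theorem peval_sub (p q : Poly) (x : Plane) : peval (p - q) x = peval p x - peval q x := by
  simp [peval]

@[simp] theorem peval_add (p q : Poly) (x : Plane) : peval (p + q) x = peval p x + peval q x := by
  simp [peval]

theorem totalDegree_sub_le {p q : Poly} {k : ℕ} (hp : p.totalDegree ≤ k)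
    (hq : q.totalDegree ≤ k) : (p - q).totalDegree ≤ k :=
  (MvPolynomial.totalDegree_sub _ _).trans (max_le hp hq)

theorem exists_polynomial_eq_peval_line {p : Poly} {k : ℕ} (hp : p.totalDegree ≤ k)
    (P v : Plane) :
    ∃ q : Polynomial ℝ, q.natDegree ≤ k ∧ ∀ t : ℝ, q.eval t = peval p (P + t • v) := by
  let f : Fin 2 → Polynomial ℝ := fun i => Polynomial.C (P i) + Polynomial.X * Polynomial.C (v i)
  refine ⟨MvPolynomial.aeval f p, ?_, fun t => ?_⟩
  · have := MvPolynomial.aeval_natDegree_le (n := 1) p hp f fun i => by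
      refine (Polynomial.natDegree_add_le _ _).trans (max_le (by simp) ?_)
      refine Polynomial.natDegree_mul_le.trans ?_
      simp
    simpa using this
  · have := MvPolynomial.comp_aeval_apply (f := f) (Polynomial.aeval t) p
    simp only [Polynomial.coe_aeval_eq_eval] at this
    rw [this, peval, ← MvPolynomial.aeval_eq_eval]
    congr 2
    funext i
    simp only [f, Polynomial.eval_add, Polynomial.eval_C, Polynomial.eval_mul, Polynomial.eval_X,
      PiLp.add_apply, PiLp.smul_apply, smul_eq_mul]

theorem monoSum_injective_of_ball {k : ℕ} {c : ℕ × ℕ → ℝ}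
    (h : ∀ x ∈ Metric.ball (0 : Plane) 1, monoSum k 0 1 c x = 0) :
    ∀ β ∈ multiIdx k, c β = 0 := by
  let e : ℕ × ℕ → (Fin 2 →₀ ℕ) := fun β => Finsupp.equivFunOnFinite.symm ![β.1, β.2]
  have he : Function.Injective e := by
    intro β γ hβγ
    have h' := Finsupp.equivFunOnFinite.symm.injective hβγ
    have h0 := congrFun h' 0
    have h1 := congrFun h' 1
    ext
    · simpa using h0
    · simpa using h1
  let q : Poly := ∑ β ∈ multiIdx k, MvPolynomial.monomial (e β) (c β)
  have hq : q = 0 := by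
    refine MvPolynomial.funext_set (fun _ => Ioo (-(1 / 2) : ℝ) (1 / 2))
      (fun _ => Ioo_infinite (by norm_num)) fun x hx => ?_
    have hx' : (WithLp.toLp 2 x : Plane) ∈ Metric.ball (0 : Plane) 1 := by
      rw [mem_ball_zero_iff, EuclideanSpace.norm_eq, Real.sqrt_lt' one_pos]
      simp only [Fin.sum_univ_two, Real.norm_eq_abs, sq_abs]
      have h0 := hx 0 (mem_univ _)
      have h1 := hx 1 (mem_univ _)
      nlinarith [h0.1, h0.2, h1.1, h1.2]
    have := h _ hx'
    simp only [monoSum, scaledMono] at this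
    simp only [q, map_sum, map_zero, ← this]
    refine Finset.sum_congr rfl fun β _ => ?_
    rw [MvPolynomial.eval_monomial, Finsupp.prod_fintype _ _ (by simp)]
    simp [e]
  intro β hβ
  have := congrArg (MvPolynomial.coeff (e β)) hq
  simp only [q, MvPolynomial.coeff_sum, MvPolynomial.coeff_monomial, MvPolynomial.coeff_zero]
    at this
  rw [Finset.sum_eq_single β] at this
  · simpa using this
  · intro γ _ hγ
    rw [if_neg fun hh => hγ (he hh)]
  · exact fun hh => (hh hβ).elim

theorem integrableOn_ball {f : Plane → ℝ} (hf : Continuous f) (y : Plane) (r : ℝ) :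
    IntegrableOn f (Metric.ball y r) :=
  (hf.continuousOn.integrableOn_compact (isCompact_closedBall y r)).mono_set
    Metric.ball_subset_closedBall

theorem exists_unit_coef_bound (k : ℕ) : ∃ κ > 0, ∀ c : ℕ × ℕ → ℝ,
    κ * ∑ β ∈ multiIdx k, c β ^ 2 ≤ ∫ x in Metric.ball (0 : Plane) 1, monoSum k 0 1 c x ^ 2 := by
  let G : ℕ × ℕ → ℕ × ℕ → ℝ := fun β γ =>
    ∫ x in Metric.ball (0 : Plane) 1, scaledMono 0 1 β x * scaledMono 0 1 γ x
  have hG : ∀ c : ℕ × ℕ → ℝ, ∫ x in Metric.ball (0 : Plane) 1, monoSum k 0 1 c x ^ 2 =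
      ∑ β ∈ multiIdx k, ∑ γ ∈ multiIdx k, c β * c γ * G β γ := by
    intro c
    simp only [G, ← integral_const_mul]
    have hint : ∀ β γ : ℕ × ℕ, IntegrableOn
        (fun x => c β * c γ * (scaledMono 0 1 β x * scaledMono 0 1 γ x))
        (Metric.ball (0 : Plane) 1) := fun β γ =>
      integrableOn_ball (continuous_const.mul
        ((continuous_scaledMono _ _ _).mul (continuous_scaledMono _ _ _))) _ _
    rw [← Finset.sum_congr rfl fun β _ => integral_finsetSum _ fun γ _ => hint β γ,
      ← integral_finsetSum _ fun β _ => integrable_finsetSum _ fun γ _ => hint β γ]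
    refine integral_congr_ae (ae_of_all _ fun x => ?_)
    simp only [monoSum]
    rw [sq, Finset.sum_mul_sum]
    exact Finset.sum_congr rfl fun β _ => Finset.sum_congr rfl fun γ _ => by ring
  let V := EuclideanSpace ℝ (multiIdx k)
  let ext : V → ℕ × ℕ → ℝ := fun v β => if h : β ∈ multiIdx k then v ⟨β, h⟩ else 0
  have hext : ∀ β, Continuous fun v : V => ext v β := by
    intro β
    by_cases h : β ∈ multiIdx k
    · simp only [ext, h, dite_true]
      exact (EuclideanSpace.proj (𝕜 := ℝ) (⟨β, h⟩ : multiIdx k)).continuous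
    · simp only [ext, h, dite_false]
      exact continuous_const
  let g : V → ℝ := fun v => ∫ x in Metric.ball (0 : Plane) 1, monoSum k 0 1 (ext v) x ^ 2
  have hgc : Continuous g := by
    simp only [g, hG]
    exact continuous_finsetSum _ fun β _ => continuous_finsetSum _ fun γ _ =>
      ((hext β).mul (hext γ)).mul continuous_const
  have hpos : ∀ v ∈ Metric.sphere (0 : V) 1, 0 < g v := by
    intro v hv
    have hn : 0 ≤ g v := integral_nonneg fun x => sq_nonneg _
    refine lt_of_le_of_ne hn fun h0 => ?_
    have hcont := continuous_monoSum k 0 1 (ext v)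
    have h1 : (fun x => monoSum k 0 1 (ext v) x ^ 2)
        =ᵐ[volume.restrict (Metric.ball (0 : Plane) 1)] 0 :=
      (integral_eq_zero_iff_of_nonneg (fun x => sq_nonneg _)
        (integrableOn_ball (hcont.pow 2) _ _)).1 h0.symm
    have h2 := Measure.eqOn_open_of_ae_eq h1 Metric.isOpen_ball (hcont.pow 2).continuousOn
      continuousOn_const
    have h3 := monoSum_injective_of_ball (k := k) (c := ext v) fun x hx => by
      simpa using h2 hx
    have : v = 0 := by
      ext ⟨β, hβ⟩
      simpa [ext, mem_multiIdx.1 hβ] using h3 β hβ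
    simp [this] at hv
  obtain ⟨κ, hκ, hκg⟩ : ∃ κ > 0, ∀ v ∈ Metric.sphere (0 : V) 1, κ ≤ g v := by
    by_cases hne : (Metric.sphere (0 : V) 1).Nonempty
    · obtain ⟨v, hv, hmin⟩ := (isCompact_sphere (0 : V) 1).exists_isMinOn hne hgc.continuousOn
      exact ⟨g v, hpos v hv, fun w hw => hmin hw⟩
    · exact ⟨1, one_pos, fun v hv => (hne ⟨v, hv⟩).elim⟩
  refine ⟨κ, hκ, fun c => ?_⟩
  let v : V := WithLp.toLp 2 fun β => c β
  have hv : ∑ β ∈ multiIdx k, c β ^ 2 = ‖v‖ ^ 2 := by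
    rw [EuclideanSpace.norm_sq_eq, ← Finset.sum_coe_sort]
    simp [v]
  by_cases h0 : v = 0
  · rw [hv, h0]
    simp only [norm_zero, ne_eq, OfNat.ofNat_ne_zero, not_false_eq_true, zero_pow, mul_zero]
    exact integral_nonneg fun x => sq_nonneg _
  have hn : 0 < ‖v‖ := norm_pos_iff.2 h0
  have hs := hκg (‖v‖⁻¹ • v) (by simp [norm_smul, hn.ne'])
  have : g (‖v‖⁻¹ • v) = (‖v‖⁻¹) ^ 2 * ∫ x in Metric.ball (0 : Plane) 1, monoSum k 0 1 c x ^ 2 := by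
    simp only [g]
    rw [← integral_const_mul]
    refine integral_congr_ae (ae_of_all _ fun x => ?_)
    simp only [monoSum]
    rw [← mul_pow, Finset.mul_sum]
    congr 1
    refine Finset.sum_congr rfl fun β hβ => ?_
    have hβv : ext (‖v‖⁻¹ • v) β = ‖v‖⁻¹ * c β := by
      simp only [ext, dif_pos hβ]
      rfl
    rw [hβv]
    ring
  rw [this, inv_pow, ← div_eq_inv_mul, le_div_iff₀ (by positivity)] at hs
  rwa [hv]

open scoped Pointwise in
theorem setIntegral_ball_scale (f : Plane → ℝ) (y : Plane) {d : ℝ} (hd : 0 < d) :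
    ∫ x in Metric.ball y d, f (d⁻¹ • (x - y)) =
      d ^ 2 * ∫ x in Metric.ball (0 : Plane) 1, f x := by
  have h1 := Measure.setIntegral_comp_smul_of_pos (volume : Measure Plane) f
    (Metric.ball (0 : Plane) d) (inv_pos.2 hd)
  have h2 : d⁻¹ • Metric.ball (0 : Plane) d = Metric.ball 0 1 := by
    rw [smul_ball (inv_pos.2 hd).ne']
    simp [abs_of_pos hd, hd.ne']
  rw [h2, finrank_euclideanSpace, Fintype.card_fin, inv_pow, inv_inv, smul_eq_mul] at h1
  rw [← h1, ← integral_indicator measurableSet_ball, ← integral_indicator measurableSet_ball]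
  rw [← integral_sub_right_eq_self (μ := volume)
    ((Metric.ball (0 : Plane) d).indicator fun x => f (d⁻¹ • x)) y]
  refine integral_congr_ae (ae_of_all _ fun x => ?_)
  simp [indicator, dist_eq_norm]

theorem scaledMono_eq_unit (y : Plane) (d : ℝ) (β : ℕ × ℕ) (x : Plane) :
    scaledMono y d β x = scaledMono 0 1 β (d⁻¹ • (x - y)) := by
  simp only [scaledMono, PiLp.smul_apply, PiLp.sub_apply, smul_eq_mul, PiLp.zero_apply, sub_zero,
    div_eq_inv_mul, inv_one, one_mul]

theorem exists_coef_bound (k : ℕ) : ∃ κ > 0, ∀ (y : Plane) (d : ℝ), 0 < d → ∀ c : ℕ × ℕ → ℝ,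
    κ * d ^ 2 * ∑ β ∈ multiIdx k, c β ^ 2 ≤ ∫ x in Metric.ball y d, monoSum k y d c x ^ 2 := by
  obtain ⟨κ, hκ, h⟩ := exists_unit_coef_bound k
  refine ⟨κ, hκ, fun y d hd c => ?_⟩
  have : ∀ x, monoSum k y d c x ^ 2 = (fun z => monoSum k 0 1 c z ^ 2) (d⁻¹ • (x - y)) := by
    intro x
    simp only [monoSum, scaledMono_eq_unit y d]
  have h2 := setIntegral_ball_scale (fun z => monoSum k 0 1 c z ^ 2) y hd
  simp only [this]
  rw [h2]
  nlinarith [mul_le_mul_of_nonneg_left (h c) (sq_nonneg d)]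

theorem exists_peval_sup_bound (k : ℕ) (r : ℝ) (hr : 1 ≤ r) : ∃ C > 0, ∀ p : Poly,
    p.totalDegree ≤ k → ∀ (y : Plane) (d : ℝ), 0 < d → ∀ x, dist x y ≤ r * d →
      |peval p x| * d ≤ C * Real.sqrt (∫ z in Metric.ball y d, peval p z ^ 2) := by
  obtain ⟨κ, hκ, h⟩ := exists_coef_bound k
  have hcard : 0 < ((multiIdx k).card : ℝ) := by
    have : (0, 0) ∈ multiIdx k := by simp
    exact_mod_cast Finset.card_pos.2 ⟨_, this⟩
  refine ⟨Real.sqrt ((multiIdx k).card / κ) * r ^ k, by positivity, fun p hp y d hd x hx => ?_⟩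
  obtain ⟨c, hc⟩ := exists_peval_eq_monoSum hp y hd.ne'
  have h1 : |peval p x| ≤ r ^ k * ∑ β ∈ multiIdx k, |c β| := by
    rw [hc, monoSum, Finset.mul_sum]
    refine (Finset.abs_sum_le_sum_abs _ _).trans (Finset.sum_le_sum fun β hβ => ?_)
    rw [abs_mul, mul_comm]
    gcongr
    exact abs_scaledMono_le hd hr hx (mem_multiIdx.1 hβ)
  have h2 : (∑ β ∈ multiIdx k, |c β|) ^ 2 ≤ (multiIdx k).card * ∑ β ∈ multiIdx k, c β ^ 2 := by
    simpa using sq_sum_le_card_mul_sum_sq (s := multiIdx k) (f := fun β => |c β|)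
  have h3 := h y d hd c
  simp only [← hc] at h3
  set I := ∫ z in Metric.ball y d, peval p z ^ 2
  have h4 : (∑ β ∈ multiIdx k, |c β|) * d ≤ Real.sqrt ((multiIdx k).card / κ) * Real.sqrt I := by
    rw [← Real.sqrt_mul (by positivity)]
    refine Real.le_sqrt_of_sq_le ?_
    rw [mul_pow, div_mul_eq_mul_div, le_div_iff₀ hκ]
    calc _ ≤ ((multiIdx k).card * ∑ β ∈ multiIdx k, c β ^ 2) * d ^ 2 * κ := by gcongr
      _ = (multiIdx k).card * (κ * d ^ 2 * ∑ β ∈ multiIdx k, c β ^ 2) := by ring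
      _ ≤ _ := by gcongr
  calc _ ≤ (r ^ k * ∑ β ∈ multiIdx k, |c β|) * d := by gcongr
    _ = r ^ k * ((∑ β ∈ multiIdx k, |c β|) * d) := by ring
    _ ≤ r ^ k * (Real.sqrt ((multiIdx k).card / κ) * Real.sqrt I) := by gcongr
    _ = _ := by ring

open Filter Metric ContinuousLinearMap
open scoped Convolution Topology

/-! ### Partial derivatives of smooth functions -/

theorem contDiff_partialD {f : Plane → ℝ} (hf : ContDiff ℝ (⊤ : ℕ∞) f) (i : Fin 2) :
    ContDiff ℝ (⊤ : ℕ∞) (partialD i f) :=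
  (hf.fderiv_right (m := (⊤ : ℕ∞)) (by simp)).clm_apply contDiff_const

theorem contDiff_iterate_partialD {f : Plane → ℝ} (hf : ContDiff ℝ (⊤ : ℕ∞) f) (i : Fin 2)
    (n : ℕ) : ContDiff ℝ (⊤ : ℕ∞) ((partialD i)^[n] f) := by
  induction n with
  | zero => exact hf
  | succ n ih =>
    rw [Function.iterate_succ_apply']
    exact contDiff_partialD ih i

theorem contDiff_multiD {f : Plane → ℝ} (hf : ContDiff ℝ (⊤ : ℕ∞) f) (β : ℕ × ℕ) :
    ContDiff ℝ (⊤ : ℕ∞) (multiD β f) :=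
  contDiff_iterate_partialD (contDiff_iterate_partialD hf 1 _) 0 _

theorem differentiable_of_smooth {f : Plane → ℝ} (hf : ContDiff ℝ (⊤ : ℕ∞) f) :
    Differentiable ℝ f :=
  hf.differentiable (by simp)

theorem partialD_comm {f : Plane → ℝ} (hf : ContDiff ℝ (⊤ : ℕ∞) f) (i j : Fin 2) :
    partialD i (partialD j f) = partialD j (partialD i f) := by
  have hd : Differentiable ℝ (fderiv ℝ f) :=
    (hf.fderiv_right (m := (⊤ : ℕ∞)) (by simp)).differentiable (by simp)
  funext x
  have h : ∀ a b : Fin 2, partialD a (partialD b f) x =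
      fderiv ℝ (fderiv ℝ f) x (EuclideanSpace.single a 1) (EuclideanSpace.single b 1) := by
    intro a b
    have := ((hd x).hasFDerivAt.clm_apply (hasFDerivAt_const (EuclideanSpace.single b (1 : ℝ)) x))
    have e : partialD b f = fun y => fderiv ℝ f y (EuclideanSpace.single b 1) := rfl
    rw [partialD, e, this.fderiv]
    simp
  rw [h, h]
  have hs : IsSymmSndFDerivAt ℝ f x := (hf.of_le (m := 2)
    (WithTop.coe_le_coe.2 (le_top : (2 : ℕ∞) ≤ ⊤))).contDiffAt.isSymmSndFDerivAt (by simp)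
  exact hs _ _

theorem partialD_iterate_comm {f : Plane → ℝ} (hf : ContDiff ℝ (⊤ : ℕ∞) f) (i j : Fin 2) (n : ℕ) :
    partialD i ((partialD j)^[n] f) = (partialD j)^[n] (partialD i f) := by
  induction n with
  | zero => rfl
  | succ n ih =>
    rw [Function.iterate_succ_apply', Function.iterate_succ_apply', ← ih,
      partialD_comm (contDiff_iterate_partialD hf j n)]

theorem partialD_zero_multiD (f : Plane → ℝ) (β : ℕ × ℕ) :
    partialD 0 (multiD β f) = multiD (β.1 + 1, β.2) f := by
  simp only [multiD, Function.iterate_succ_apply']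

theorem partialD_one_multiD {f : Plane → ℝ} (hf : ContDiff ℝ (⊤ : ℕ∞) f) (β : ℕ × ℕ) :
    partialD 1 (multiD β f) = multiD (β.1, β.2 + 1) f := by
  simp only [multiD, Function.iterate_succ_apply']
  exact partialD_iterate_comm (contDiff_iterate_partialD hf 1 _) 1 0 _

theorem iterate_partialD_comm {f : Plane → ℝ} (hf : ContDiff ℝ (⊤ : ℕ∞) f) (i j : Fin 2)
    (m n : ℕ) : (partialD i)^[m] ((partialD j)^[n] f) = (partialD j)^[n] ((partialD i)^[m] f) := by
  induction m with
  | zero => rfl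
  | succ m ih =>
    rw [Function.iterate_succ_apply', Function.iterate_succ_apply', ih,
      partialD_iterate_comm (contDiff_iterate_partialD hf i m)]

theorem partialD_sub {f g : Plane → ℝ} (hf : Differentiable ℝ f) (hg : Differentiable ℝ g)
    (i : Fin 2) : partialD i (fun x => f x - g x) = fun x => partialD i f x - partialD i g x := by
  funext x
  simp only [partialD]
  rw [fderiv_fun_sub (hf x) (hg x)]
  rfl

theorem iterate_partialD_sub {f g : Plane → ℝ} (hf : ContDiff ℝ (⊤ : ℕ∞) f)
    (hg : ContDiff ℝ (⊤ : ℕ∞) g) (i : Fin 2) (n : ℕ) :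
    (partialD i)^[n] (fun x => f x - g x) =
      fun x => (partialD i)^[n] f x - (partialD i)^[n] g x := by
  induction n with
  | zero => rfl
  | succ n ih =>
    rw [Function.iterate_succ_apply', ih, Function.iterate_succ_apply',
      Function.iterate_succ_apply', partialD_sub
        (differentiable_of_smooth (contDiff_iterate_partialD hf i n))
        (differentiable_of_smooth (contDiff_iterate_partialD hg i n))]

theorem multiD_sub {f g : Plane → ℝ} (hf : ContDiff ℝ (⊤ : ℕ∞) f) (hg : ContDiff ℝ (⊤ : ℕ∞) g)
    (β : ℕ × ℕ) : multiD β (fun x => f x - g x) = fun x => multiD β f x - multiD β g x := by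
  rw [multiD, iterate_partialD_sub hf hg, iterate_partialD_sub (contDiff_iterate_partialD hf _ _)
    (contDiff_iterate_partialD hg _ _)]
  rfl

theorem hasCompactSupport_partialD {f : Plane → ℝ} (hf : HasCompactSupport f) (i : Fin 2) :
    HasCompactSupport (partialD i f) :=
  (hf.fderiv_apply ℝ _)

theorem tsupport_partialD_subset (f : Plane → ℝ) (i : Fin 2) :
    tsupport (partialD i f) ⊆ tsupport f :=
  tsupport_fderiv_apply_subset ℝ _

theorem IsTest.partialD {ω : Set Plane} {φ : Plane → ℝ} (h : IsTest ω φ) (i : Fin 2) :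
    IsTest ω (partialD i φ) :=
  ⟨contDiff_partialD h.1 i, hasCompactSupport_partialD h.2.1 i,
    (tsupport_partialD_subset φ i).trans h.2.2⟩

theorem IsTest.iterate_partialD {ω : Set Plane} {φ : Plane → ℝ} (h : IsTest ω φ) (i : Fin 2)
    (n : ℕ) : IsTest ω ((IsoVEM.partialD i)^[n] φ) := by
  induction n with
  | zero => exact h
  | succ n ih =>
    rw [Function.iterate_succ_apply']
    exact ih.partialD i

theorem IsTest.multiD {ω : Set Plane} {φ : Plane → ℝ} (h : IsTest ω φ) (β : ℕ × ℕ) :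
    IsTest ω (multiD β φ) :=
  (h.iterate_partialD 1 _).iterate_partialD 0 _

theorem IsTest.mono {ω ω' : Set Plane} {φ : Plane → ℝ} (h : IsTest ω φ) (hω : ω ⊆ ω') :
    IsTest ω' φ := ⟨h.1, h.2.1, h.2.2.trans hω⟩

theorem IsTest.continuous {ω : Set Plane} {φ : Plane → ℝ} (h : IsTest ω φ) : Continuous φ :=
  h.1.continuous

theorem IsTest.eq_zero_of_notMem {ω : Set Plane} {φ : Plane → ℝ} (h : IsTest ω φ) {x : Plane}
    (hx : x ∉ ω) : φ x = 0 :=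
  image_eq_zero_of_notMem_tsupport fun h' => hx (h.2.2 h')

theorem integral_smooth_mul_partialD {f φ : Plane → ℝ} (hf : ContDiff ℝ (⊤ : ℕ∞) f)
    (hφ : ContDiff ℝ (⊤ : ℕ∞) φ) (hc : HasCompactSupport φ) (i : Fin 2) :
    ∫ x, f x * partialD i φ x = -∫ x, partialD i f x * φ x := by
  refine integral_mul_fderiv_eq_neg_fderiv_mul_of_integrable ?_ ?_ ?_
    (fun x _ => differentiable_of_smooth hf x) fun x _ => differentiable_of_smooth hφ x
  · exact ((contDiff_partialD hf i).continuous.mul hφ.continuous).integrable_of_hasCompactSupport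
      hc.mul_left
  · exact (hf.continuous.mul (contDiff_partialD hφ i).continuous).integrable_of_hasCompactSupport
      (hasCompactSupport_partialD hc i).mul_left
  · exact (hf.continuous.mul hφ.continuous).integrable_of_hasCompactSupport hc.mul_left

theorem integral_smooth_mul_iterate_partialD {f φ : Plane → ℝ} (hf : ContDiff ℝ (⊤ : ℕ∞) f)
    (hφ : IsTest univ φ) (i : Fin 2) (n : ℕ) :
    ∫ x, f x * (partialD i)^[n] φ x = (-1) ^ n * ∫ x, (partialD i)^[n] f x * φ x := by
  induction n generalizing f with
  | zero => simp
  | succ n ih =>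
    rw [Function.iterate_succ_apply', integral_smooth_mul_partialD hf
      (hφ.iterate_partialD i n).1 (hφ.iterate_partialD i n).2.1, ih (contDiff_partialD hf i),
      Function.iterate_succ_apply, pow_succ]
    ring

theorem integral_smooth_mul_multiD {f φ : Plane → ℝ} (hf : ContDiff ℝ (⊤ : ℕ∞) f)
    (hφ : IsTest univ φ) (β : ℕ × ℕ) :
    ∫ x, f x * multiD β φ x = (-1) ^ (β.1 + β.2) * ∫ x, multiD β f x * φ x := by
  rw [multiD, integral_smooth_mul_iterate_partialD hf (hφ.iterate_partialD 1 _),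
    integral_smooth_mul_iterate_partialD (contDiff_iterate_partialD hf 0 _) hφ, multiD,
    iterate_partialD_comm hf, ← mul_assoc, ← pow_add]

theorem setIntegral_mul_isTest {ω : Set Plane} {φ : Plane → ℝ} (h : IsTest ω φ) (f : Plane → ℝ) :
    ∫ x in ω, f x * φ x = ∫ x, f x * φ x :=
  setIntegral_eq_integral_of_forall_compl_eq_zero fun x hx => by
    rw [h.eq_zero_of_notMem hx, mul_zero]

/-! ### Weak derivatives -/

theorem hasWeakDeriv_of_smooth (ω : Set Plane) {f : Plane → ℝ} (hf : ContDiff ℝ (⊤ : ℕ∞) f)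
    (β : ℕ × ℕ) : HasWeakDeriv ω β f (multiD β f) := by
  refine ⟨hf.continuous.locallyIntegrable.locallyIntegrableOn _,
    (contDiff_multiD hf β).continuous.locallyIntegrable.locallyIntegrableOn _, fun φ hφ => ?_⟩
  rw [setIntegral_mul_isTest (hφ.multiD β), setIntegral_mul_isTest hφ,
    integral_smooth_mul_multiD hf (hφ.mono (subset_univ _))]

theorem HasWeakDeriv.mono {ω ω' : Set Plane} {β : ℕ × ℕ} {u w : Plane → ℝ}
    (h : HasWeakDeriv ω β u w) (hω : ω' ⊆ ω) : HasWeakDeriv ω' β u w := by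
  refine ⟨h.1.mono_set hω, h.2.1.mono_set hω, fun φ hφ => ?_⟩
  have := h.2.2 φ (hφ.mono hω)
  rwa [setIntegral_mul_isTest (hφ.multiD β), setIntegral_mul_isTest hφ,
    ← setIntegral_mul_isTest ((hφ.mono hω).multiD β), ← setIntegral_mul_isTest (hφ.mono hω)]

theorem integrable_mul_isTest {ω : Set Plane} {φ : Plane → ℝ} (h : IsTest ω φ) {f : Plane → ℝ}
    (hf : LocallyIntegrableOn f ω) : Integrable fun x => f x * φ x := by
  have h1 : IntegrableOn f (tsupport φ) := hf.integrableOn_compact_subset h.2.2 h.2.1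
  have h2 : IntegrableOn (fun x => f x * φ x) (tsupport φ) :=
    h1.mul_continuousOn h.continuous.continuousOn h.2.1
  rw [← integrableOn_univ]
  refine h2.of_forall_sdiff_eq_zero MeasurableSet.univ fun x hx => ?_
  rw [image_eq_zero_of_notMem_tsupport hx.2, mul_zero]

theorem HasWeakDeriv.sub {ω : Set Plane} {β : ℕ × ℕ} {u w u' w' : Plane → ℝ}
    (h : HasWeakDeriv ω β u w) (h' : HasWeakDeriv ω β u' w') :
    HasWeakDeriv ω β (fun x => u x - u' x) (fun x => w x - w' x) := by
  refine ⟨h.1.sub h'.1, h.2.1.sub h'.2.1, fun φ hφ => ?_⟩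
  have h1 := h.2.2 φ hφ
  have h2 := h'.2.2 φ hφ
  rw [setIntegral_mul_isTest (hφ.multiD β), setIntegral_mul_isTest hφ] at h1 h2 ⊢
  simp only [sub_mul]
  rw [integral_sub (integrable_mul_isTest (hφ.multiD β) h.1)
      (integrable_mul_isTest (hφ.multiD β) h'.1), integral_sub (integrable_mul_isTest hφ h.2.1)
      (integrable_mul_isTest hφ h'.2.1), h1, h2]
  ring

theorem HasWeakDeriv.ae_eq {ω : Set Plane} (hω : IsOpen ω) {β : ℕ × ℕ} {u w w' : Plane → ℝ}
    (h : HasWeakDeriv ω β u w) (h' : HasWeakDeriv ω β u w') :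
    w =ᵐ[volume.restrict ω] w' := by
  have key := hω.ae_eq_zero_of_integral_contDiff_smul_eq_zero (μ := volume) (h.2.1.sub h'.2.1)
    fun φ h1 h2 h3 => by
      have hφ : IsTest ω φ := ⟨h1, h2, h3⟩
      have e1 := h.2.2 φ hφ
      rw [h'.2.2 φ hφ, setIntegral_mul_isTest hφ, setIntegral_mul_isTest hφ] at e1
      have e2 := mul_left_cancel₀ (pow_ne_zero _ (by norm_num)) e1
      simp only [smul_eq_mul, Pi.sub_apply, mul_comm (φ _), sub_mul]
      rw [integral_sub (integrable_mul_isTest hφ h.2.1) (integrable_mul_isTest hφ h'.2.1), e2,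
        sub_self]
  rw [EventuallyEq, ae_restrict_iff' hω.measurableSet]
  filter_upwards [key] with x hx hxω
  exact sub_eq_zero.1 (hx hxω)

theorem hasWeakDeriv_weakDeriv {ω : Set Plane} {β : ℕ × ℕ} {u w : Plane → ℝ}
    (h : HasWeakDeriv ω β u w) : HasWeakDeriv ω β u (weakDeriv ω β u) := by
  have : ∃ w, HasWeakDeriv ω β u w := ⟨w, h⟩
  rw [weakDeriv, dif_pos this]
  exact this.choose_spec

theorem weakDeriv_ae_eq {ω : Set Plane} (hω : IsOpen ω) {β : ℕ × ℕ} {u w : Plane → ℝ}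
    (h : HasWeakDeriv ω β u w) : weakDeriv ω β u =ᵐ[volume.restrict ω] w :=
  (hasWeakDeriv_weakDeriv h).ae_eq hω h

/-! ### Mollification -/

/-- A sequence of bump functions shrinking to the origin. -/
noncomputable def molBump (n : ℕ) : ContDiffBump (0 : Plane) where
  rIn := 1 / (n + 1) / 2
  rOut := 1 / (n + 1)
  rIn_pos := by positivity
  rIn_lt_rOut := half_lt_self (by positivity)

theorem tendsto_molBump_rOut : Tendsto (fun n => (molBump n).rOut) atTop (𝓝 0) :=
  tendsto_one_div_add_atTop_nhds_zero_nat

theorem eventually_rOut_lt {ε : ℝ} (hε : 0 < ε) : ∀ᶠ n in atTop, (molBump n).rOut < ε :=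
  tendsto_molBump_rOut.eventually_lt_const hε

/-- The mollification of a function. -/
noncomputable def mollify (n : ℕ) (f : Plane → ℝ) : Plane → ℝ :=
  (molBump n).normed volume ⋆[lsmul ℝ ℝ, volume] f

theorem contDiff_molBump (n : ℕ) : ContDiff ℝ (⊤ : ℕ∞) ((molBump n).normed volume) :=
  (molBump n).contDiff_normed

theorem contDiff_mollify (n : ℕ) {f : Plane → ℝ} (hf : LocallyIntegrable f) :
    ContDiff ℝ (⊤ : ℕ∞) (mollify n f) :=
  (molBump n).hasCompactSupport_normed.contDiff_convolution_left _ (contDiff_molBump n) hf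

theorem partialD_convolution {ρ : Plane → ℝ} (hρ : ContDiff ℝ (⊤ : ℕ∞) ρ)
    (hc : HasCompactSupport ρ) {f : Plane → ℝ} (hf : LocallyIntegrable f) (i : Fin 2) :
    partialD i (ρ ⋆[lsmul ℝ ℝ, volume] f) = partialD i ρ ⋆[lsmul ℝ ℝ, volume] f := by
  funext x
  have e : ∀ g : Plane → ℝ, g ⋆[lsmul ℝ ℝ, volume] f = f ⋆[(lsmul ℝ ℝ).flip, volume] g :=
    fun g => (convolution_flip (lsmul ℝ ℝ)).symm
  rw [e, e]
  have h := hc.hasFDerivAt_convolution_right (lsmul ℝ ℝ).flip hf (hρ.of_le (by simp)) x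
  rw [partialD, h.fderiv]
  exact convolution_precompR_apply (lsmul ℝ ℝ).flip hf (hc.fderiv ℝ)
    (hρ.continuous_fderiv (by simp)) x _

theorem iterate_partialD_convolution {ρ : Plane → ℝ} (hρ : IsTest univ ρ) {f : Plane → ℝ}
    (hf : LocallyIntegrable f) (i : Fin 2) (n : ℕ) :
    (partialD i)^[n] (ρ ⋆[lsmul ℝ ℝ, volume] f) = (partialD i)^[n] ρ ⋆[lsmul ℝ ℝ, volume] f := by
  induction n with
  | zero => rfl
  | succ n ih =>
    rw [Function.iterate_succ_apply', ih, Function.iterate_succ_apply',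
      partialD_convolution (hρ.iterate_partialD i n).1 (hρ.iterate_partialD i n).2.1 hf]

theorem multiD_convolution {ρ : Plane → ℝ} (hρ : IsTest univ ρ) {f : Plane → ℝ}
    (hf : LocallyIntegrable f) (β : ℕ × ℕ) :
    multiD β (ρ ⋆[lsmul ℝ ℝ, volume] f) = multiD β ρ ⋆[lsmul ℝ ℝ, volume] f := by
  rw [multiD, iterate_partialD_convolution hρ hf,
    iterate_partialD_convolution (hρ.iterate_partialD 1 _) hf, multiD]

theorem partialD_comp_sub_left {f : Plane → ℝ} (hf : Differentiable ℝ f) (x : Plane) (i : Fin 2) :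
    partialD i (fun y => f (x - y)) = fun y => -partialD i f (x - y) := by
  funext y
  have h : HasFDerivAt (fun y => f (x - y)) ((fderiv ℝ f (x - y)).comp
      (-ContinuousLinearMap.id ℝ Plane)) y :=
    (hf (x - y)).hasFDerivAt.comp y ((hasFDerivAt_id y).const_sub x)
  rw [partialD, h.fderiv]
  simp [partialD]

theorem partialD_const_mul {f : Plane → ℝ} (hf : Differentiable ℝ f) (a : ℝ) (i : Fin 2) :
    partialD i (fun y => a * f y) = fun y => a * partialD i f y := by
  funext y
  rw [partialD, fderiv_const_mul (hf y)]
  rfl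

theorem iterate_partialD_comp_sub_left {f : Plane → ℝ} (hf : ContDiff ℝ (⊤ : ℕ∞) f) (x : Plane)
    (i : Fin 2) (a : ℝ) (n : ℕ) : (partialD i)^[n] (fun y => a * f (x - y)) =
      fun y => (-1) ^ n * a * (partialD i)^[n] f (x - y) := by
  induction n with
  | zero => simp
  | succ n ih =>
    have h1 := contDiff_iterate_partialD hf i n
    have h2 : Differentiable ℝ fun y => (partialD i)^[n] f (x - y) :=
      (differentiable_of_smooth h1).comp (differentiable_id.const_sub x)
    rw [Function.iterate_succ_apply', ih, partialD_const_mul h2,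
      partialD_comp_sub_left (differentiable_of_smooth h1), Function.iterate_succ_apply']
    funext y
    rw [pow_succ]
    ring

theorem multiD_comp_sub_left {f : Plane → ℝ} (hf : ContDiff ℝ (⊤ : ℕ∞) f) (x : Plane)
    (β : ℕ × ℕ) : multiD β (fun y => f (x - y)) =
      fun y => (-1) ^ (β.1 + β.2) * multiD β f (x - y) := by
  have h1 := iterate_partialD_comp_sub_left hf x 1 1 β.2
  simp only [one_mul, mul_one] at h1
  rw [multiD, h1, iterate_partialD_comp_sub_left (contDiff_iterate_partialD hf 1 _), pow_add]
  rfl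

theorem convolution_indicator_eq (ρ : Plane → ℝ) {ω : Set Plane} (hω : MeasurableSet ω)
    (u : Plane → ℝ) (x : Plane) :
    (ρ ⋆[lsmul ℝ ℝ, volume] ω.indicator u) x = ∫ y in ω, u y * ρ (x - y) := by
  rw [convolution_eq_swap, ← integral_indicator hω]
  refine integral_congr_ae (ae_of_all _ fun y => ?_)
  by_cases hy : y ∈ ω <;> simp [hy, mul_comm]

theorem isTest_molBump_comp (n : ℕ) {ω : Set Plane} {x : Plane}
    (hx : closedBall x (molBump n).rOut ⊆ ω) :
    IsTest ω fun y => (molBump n).normed volume (x - y) := by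
  have hs : tsupport (fun y => (molBump n).normed volume (x - y)) ⊆
      closedBall x (molBump n).rOut := by
    refine closure_minimal (fun y hy => ?_) isClosed_closedBall
    have : x - y ∈ Function.support ((molBump n).normed volume) := hy
    rw [(molBump n).support_normed_eq, mem_ball_zero_iff] at this
    rw [mem_closedBall, dist_comm, dist_eq_norm]
    exact this.le
  exact ⟨(contDiff_molBump n).comp (contDiff_const.sub contDiff_id),
    (isCompact_closedBall x (molBump n).rOut).of_isClosed_subset (isClosed_tsupport _) hs,
    hs.trans hx⟩

theorem isTest_molBump (n : ℕ) : IsTest univ ((molBump n).normed volume) :=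
  ⟨contDiff_molBump n, (molBump n).hasCompactSupport_normed, subset_univ _⟩

theorem multiD_mollify_eq {n : ℕ} {ω : Set Plane} (hω : MeasurableSet ω) {u : Plane → ℝ}
    (hu : IntegrableOn u ω) (β : ℕ × ℕ) (x : Plane) :
    multiD β (mollify n (ω.indicator u)) x = (-1) ^ (β.1 + β.2) *
      ∫ y in ω, u y * multiD β (fun y => (molBump n).normed volume (x - y)) y := by
  rw [mollify, multiD_convolution (isTest_molBump n) (hu.integrable_indicator hω).locallyIntegrable,
    convolution_indicator_eq _ hω, multiD_comp_sub_left (contDiff_molBump n),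
    ← integral_const_mul]
  refine integral_congr_ae (ae_of_all _ fun y => ?_)
  have : ((-1 : ℝ) ^ (β.1 + β.2)) * (-1) ^ (β.1 + β.2) = 1 := by
    rw [← mul_pow]
    simp
  linear_combination (-(u y * multiD β ((molBump n).normed volume) (x - y))) * this

theorem multiD_mollify {n : ℕ} {ω : Set Plane} (hω : MeasurableSet ω) {u w : Plane → ℝ}
    (hu : IntegrableOn u ω) {β : ℕ × ℕ} (h : HasWeakDeriv ω β u w) {x : Plane}
    (hx : closedBall x (molBump n).rOut ⊆ ω) :
    multiD β (mollify n (ω.indicator u)) x = mollify n (ω.indicator w) x := by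
  rw [multiD_mollify_eq hω hu, h.2.2 _ (isTest_molBump_comp n hx), mollify,
    convolution_indicator_eq _ hω, ← mul_assoc, ← mul_pow]
  simp

theorem abs_mollify_le {n : ℕ} {f : Plane → ℝ} {B : ℝ} {x : Plane}
    (hf : ∀ᵐ y, y ∈ closedBall x (molBump n).rOut → |f y| ≤ B) :
    |mollify n f x| ≤ B := by
  rw [mollify, convolution_eq_swap, ← Real.norm_eq_abs]
  have hi : ∫ y, (molBump n).normed volume (x - y) * B = B := by
    rw [integral_mul_const, integral_sub_left_eq_self
      (fun y => (molBump n).normed volume y) volume x, (molBump n).integral_normed, one_mul]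
  rw [← hi]
  refine norm_integral_le_of_norm_le ?_ ?_
  · exact ((((contDiff_molBump n).continuous.integrable_of_hasCompactSupport
      (molBump n).hasCompactSupport_normed).comp_sub_left x)).mul_const B
  · filter_upwards [hf] with y hy
    rw [lsmul_apply, norm_smul, Real.norm_eq_abs, Real.norm_eq_abs,
      abs_of_nonneg ((molBump n).nonneg_normed _)]
    by_cases hyb : y ∈ closedBall x (molBump n).rOut
    · exact mul_le_mul_of_nonneg_left (hy hyb) ((molBump n).nonneg_normed _)
    · have : (molBump n).normed volume (x - y) = 0 := by
        refine Function.notMem_support.1 ?_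
        rw [(molBump n).support_normed_eq, mem_ball_zero_iff, not_lt, ← dist_eq_norm, dist_comm]
        rw [mem_closedBall, not_le] at hyb
        exact hyb.le
      simp [this]

theorem ae_tendsto_mollify {f : Plane → ℝ} (hf : LocallyIntegrable f) :
    ∀ᵐ x, Tendsto (fun n => mollify n f x) atTop (𝓝 (f x)) :=
  ContDiffBump.ae_convolution_tendsto_right_of_locallyIntegrable (K := 2) tendsto_molBump_rOut
    (Eventually.of_forall fun n => (by simp only [molBump]; linarith)) hf

theorem tendstoUniformlyOn_mollify {f : Plane → ℝ} (hf : LocallyIntegrable f) {K : Set Plane}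
    (hK : IsCompact K) (hc : ∀ x ∈ K, ContinuousAt f x) :
    TendstoUniformlyOn (fun n => mollify n f) f atTop K := by
  rw [Metric.tendstoUniformlyOn_iff]
  intro ε hε
  have h1 := hK.uniformContinuousAt_of_continuousAt f hc (dist_mem_uniformity (half_pos hε))
  obtain ⟨δ, hδ, hδ'⟩ := Metric.mem_uniformity_dist.1 h1
  filter_upwards [eventually_rOut_lt hδ] with n hn x hx
  rw [dist_comm]
  refine (ContDiffBump.dist_normed_convolution_le (ε := ε / 2) hf.aestronglyMeasurable
    fun y hy => ?_).trans_lt (half_lt_self hε)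
  have hxy : dist x y < δ := by
    rw [dist_comm]
    exact (mem_ball.1 hy).trans hn
  rw [dist_comm]
  exact (hδ' hxy hx).le

theorem lintegral_mollify_le (n : ℕ) {f : Plane → ℝ} (hf : Integrable f) :
    ∫⁻ x, ‖mollify n f x‖ₑ ≤ ∫⁻ x, ‖f x‖ₑ := by
  have hρ := (contDiff_molBump n).continuous.integrable_of_hasCompactSupport (μ := volume)
    (molBump n).hasCompactSupport_normed
  have h1 : ∫⁻ t, ‖(molBump n).normed volume t‖ₑ = 1 := by
    have h2 := ofReal_integral_norm_eq_lintegral_enorm hρ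
    rw [← h2]
    simp only [Real.norm_eq_abs, abs_of_nonneg ((molBump n).nonneg_normed _),
      (molBump n).integral_normed, ENNReal.ofReal_one]
  calc ∫⁻ x, ‖mollify n f x‖ₑ
      ≤ ∫⁻ x, ∫⁻ t, ‖(molBump n).normed volume t‖ₑ * ‖f (x - t)‖ₑ := by
        refine lintegral_mono fun x => ?_
        rw [mollify, convolution_def]
        refine (enorm_integral_le_lintegral_enorm _).trans (lintegral_mono fun t => ?_)
        rw [lsmul_apply, enorm_smul]
    _ = ∫⁻ t, ∫⁻ x, ‖(molBump n).normed volume t‖ₑ * ‖f (x - t)‖ₑ := by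
        refine lintegral_lintegral_swap ?_
        have h3 := AEStronglyMeasurable.convolution_integrand (lsmul ℝ ℝ : ℝ →L[ℝ] ℝ →L[ℝ] ℝ)
          hρ.aestronglyMeasurable hf.aestronglyMeasurable
        refine h3.enorm.congr (ae_of_all _ fun p => ?_)
        simp [enorm_mul, Function.uncurry]
    _ = ∫⁻ t, ‖(molBump n).normed volume t‖ₑ * ∫⁻ x, ‖f x‖ₑ := by
        refine lintegral_congr fun t => ?_
        rw [lintegral_const_mul' _ _ enorm_ne_top,
          lintegral_sub_right_eq_self (fun x => ‖f x‖ₑ) t]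
    _ = ∫⁻ x, ‖f x‖ₑ := by
        rw [lintegral_mul_const'' _ hρ.aestronglyMeasurable.enorm, h1, one_mul]

/-! ### Star-shaped pieces -/

/-- `K` is open and star-shaped with respect to the ball of radius `ρ` about `c`. -/
structure StarPiece (K : Set Plane) (c : Plane) (ρ : ℝ) : Prop where
  isOpen : IsOpen K
  ball_subset : ball c ρ ⊆ K
  star : ∀ y ∈ ball c ρ, StarConvex ℝ y K

theorem StarPiece.lineMap_mem {K : Set Plane} {c : Plane} {ρ : ℝ} (hK : StarPiece K c ρ)
    {x y : Plane} (hx : x ∈ closure K) (hy : y ∈ ball c ρ) {τ : ℝ} (hτ : 0 < τ) (hτ1 : τ ≤ 1) :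
    x + τ • (y - x) ∈ K := by
  set z := x + τ • (y - x) with hz
  have hcont : ContinuousAt (fun x' : Plane => x' + τ⁻¹ • (z - x')) x := by fun_prop
  have hval : x + τ⁻¹ • (z - x) = y := by
    rw [hz, add_sub_cancel_left, smul_smul, inv_mul_cancel₀ hτ.ne', one_smul, add_sub_cancel]
  have hev : ∀ᶠ x' in 𝓝 x, x' + τ⁻¹ • (z - x') ∈ ball c ρ :=
    hcont.eventually_mem (isOpen_ball.mem_nhds (by rwa [hval]))
  obtain ⟨x', hx', hx'K⟩ := mem_closure_iff_nhds.1 hx _ hev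
  have := hK.star _ hx' hx'K (a := τ) (b := 1 - τ) hτ.le (by linarith) (by ring)
  convert this using 1
  rw [smul_add, smul_smul, mul_inv_cancel₀ hτ.ne', one_smul, sub_smul, one_smul]
  abel

theorem exists_finset_cover_unit_ball {a : ℝ} (ha : 0 < a) :
    ∃ t : Finset Plane, ∀ x : Plane, ‖x‖ ≤ 1 → ∃ p ∈ t, dist x p < a := by
  obtain ⟨t, -, htf, hcov⟩ := (isCompact_closedBall (0 : Plane) 1).finite_cover_balls ha
  refine ⟨htf.toFinset, fun x hx => ?_⟩
  have := hcov (show x ∈ closedBall (0 : Plane) 1 by simpa using hx)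
  simpa using this

namespace PolygonalElement

theorem dist_le_diam (E : PolygonalElement) {x y : Plane} (hx : x ∈ E.carrier)
    (hy : y ∈ E.carrier) : dist x y ≤ E.diam :=
  dist_le_diam_of_mem E.isBounded hx hy

theorem diam_pos (E : PolygonalElement) : 0 < E.diam := by
  obtain ⟨x, hx⟩ := E.isConnected.nonempty
  obtain ⟨r, hr, hball⟩ := Metric.isOpen_iff.1 E.isOpen x hx
  have hmem : x + EuclideanSpace.single (0 : Fin 2) (r / 2) ∈ E.carrier := by
    refine hball ?_
    simp [dist_eq_norm, abs_of_pos hr, hr]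
  have := E.dist_le_diam hmem hx
  simp only [dist_eq_norm, add_sub_cancel_left, PiLp.norm_single, Real.norm_eq_abs] at this
  rw [abs_of_pos (half_pos hr)] at this
  linarith

end PolygonalElement

theorem exists_starPieces {a : ℝ} (ha : 0 < a) : ∃ N : ℕ, 0 < N ∧ ∀ E : PolygonalElement,
    E.ShapeRegular a → ∃ (K : Fin N → Set Plane) (c : Fin N → Plane), E.carrier = ⋃ i, K i ∧
      ∀ i, StarPiece (K i) (c i) (a * E.diam / 2) := by
  classical
  obtain ⟨t, ht⟩ := exists_finset_cover_unit_ball (show 0 < a / 4 by positivity)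
  have htc : 0 < t.card := by
    obtain ⟨p, hp, -⟩ := ht 0 (by simp)
    exact Finset.card_pos.2 ⟨p, hp⟩
  refine ⟨t.card, htc, fun E hE => ?_⟩
  obtain ⟨⟨n, K, hcov, hK⟩, -⟩ := hE
  choose hopen c ρ hρ hball hstar using hK
  have hd := E.diam_pos
  have had : 0 < a * E.diam := by positivity
  obtain ⟨x₀, hx₀⟩ := E.isConnected.nonempty
  have hcmem : ∀ i, c i ∈ E.carrier := fun i => by
    rw [hcov]
    exact mem_iUnion.2 ⟨i, hball i (mem_ball_self (had.trans (hρ i)))⟩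
  let cell : Plane → Fin n → Prop := fun p i => dist (E.diam⁻¹ • (c i - x₀)) p < a / 4
  have hcell : ∀ i, ∃ p ∈ t, cell p i := fun i => by
    refine ht _ ?_
    rw [norm_smul, norm_inv, Real.norm_eq_abs, abs_of_pos hd, ← dist_eq_norm,
      inv_mul_le_iff₀ hd, mul_one]
    exact E.dist_le_diam (hcmem i) hx₀
  have hclose : ∀ p i j, cell p i → cell p j → ball (c i) (a * E.diam / 2) ⊆ ball (c j) (ρ j) := by
    intro p i j hi hj
    refine ball_subset_ball' ?_
    have h1 : dist (E.diam⁻¹ • (c i - x₀)) (E.diam⁻¹ • (c j - x₀)) < a / 2 := by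
      have := dist_triangle_right (E.diam⁻¹ • (c i - x₀)) (E.diam⁻¹ • (c j - x₀)) p
      simp only [cell] at hi hj
      linarith
    rw [dist_smul₀, dist_sub_right, norm_inv, Real.norm_eq_abs, abs_of_pos hd,
      inv_mul_lt_iff₀ hd] at h1
    have := hρ j
    linarith
  have hn : Nonempty (Fin n) := by
    rw [hcov] at hx₀
    exact ⟨(mem_iUnion.1 hx₀).choose⟩
  have key : ∀ p : Plane, ∃ (K' : Set Plane) (c' : Plane), StarPiece K' c' (a * E.diam / 2) ∧
      K' ⊆ E.carrier ∧ ∀ i, cell p i → K i ⊆ K' := by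
    intro p
    by_cases hp : ∃ i, cell p i
    · obtain ⟨i₀, hi₀⟩ := hp
      refine ⟨⋃ i : {i // cell p i}, K i, c i₀, ⟨isOpen_iUnion fun i => hopen i, ?_, ?_⟩, ?_, ?_⟩
      · exact ((hclose p i₀ i₀ hi₀ hi₀).trans (hball i₀)).trans
          (subset_iUnion (fun i : {i // cell p i} => K i) ⟨i₀, hi₀⟩)
      · exact fun y hy => starConvex_iUnion fun i => hstar i y (hclose p i₀ i hi₀ i.2 hy)
      · rw [hcov]
        exact iUnion_subset fun i => subset_iUnion K i
      · exact fun i hi => subset_iUnion (fun i : {i // cell p i} => K i) ⟨i, hi⟩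
    · obtain ⟨i₀⟩ := hn
      have hsub : ball (c i₀) (a * E.diam / 2) ⊆ ball (c i₀) (ρ i₀) :=
        ball_subset_ball (by linarith [hρ i₀])
      refine ⟨K i₀, c i₀, ⟨hopen i₀, hsub.trans (hball i₀), fun y hy => hstar i₀ y (hsub hy)⟩, ?_,
        fun i hi => (hp ⟨i, hi⟩).elim⟩
      rw [hcov]
      exact subset_iUnion K i₀
  choose K' c' hK' hsub hsup using key
  refine ⟨fun q => K' (t.equivFin.symm q), fun q => c' (t.equivFin.symm q), ?_, fun q => hK' _⟩
  refine Subset.antisymm ?_ (iUnion_subset fun q => hsub _)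
  intro x hx
  rw [hcov] at hx
  obtain ⟨i, hi⟩ := mem_iUnion.1 hx
  obtain ⟨p, hp, hpi⟩ := hcell i
  exact mem_iUnion.2 ⟨t.equivFin ⟨p, hp⟩, by simpa using hsup p i hpi hi⟩

/-! ### Chains of segments -/

/-- `x` and `y` are joined in `ω` by a chain of `n` segments. -/
def SegChain (ω : Set Plane) (n : ℕ) (x y : Plane) : Prop :=
  ∃ z : ℕ → Plane, z 0 = x ∧ z n = y ∧ ∀ i < n, segment ℝ (z i) (z (i + 1)) ⊆ ω

theorem SegChain.trans {ω : Set Plane} {m n : ℕ} {x y w : Plane} (h : SegChain ω m x y)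
    (h' : SegChain ω n y w) : SegChain ω (m + n) x w := by
  obtain ⟨z, h0, h1, h2⟩ := h
  obtain ⟨z', h0', h1', h2'⟩ := h'
  refine ⟨fun i => if i ≤ m then z i else z' (i - m), by simpa, ?_, fun i hi => ?_⟩
  · rcases Nat.eq_zero_or_pos n with rfl | hn
    · simp only [add_zero, le_refl, if_true]
      rw [h1, ← h0', h1']
    · simp only [if_neg (show ¬m + n ≤ m by omega), Nat.add_sub_cancel_left, h1']
  · rcases lt_trichotomy i m with him | rfl | him
    · simp only [if_pos him.le, if_pos (show i + 1 ≤ m by omega)]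
      exact h2 i him
    · simp only [le_refl, if_true, if_neg (show ¬i + 1 ≤ i by omega), Nat.add_sub_cancel_left]
      rw [h1, ← h0']
      exact h2' 0 (by omega)
    · simp only [if_neg (show ¬i ≤ m by omega), if_neg (show ¬i + 1 ≤ m by omega),
        Nat.sub_add_comm him.le]
      exact h2' (i - m) (by omega)

theorem SegChain.of_segment {ω : Set Plane} {x y : Plane} (h : segment ℝ x y ⊆ ω) :
    SegChain ω 1 x y :=
  ⟨fun i => if i = 0 then x else y, by simp, by simp, fun i hi => by
    obtain rfl : i = 0 := by omega
    simpa using h⟩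

theorem SegChain.refl {ω : Set Plane} {x : Plane} (hx : x ∈ ω) (n : ℕ) : SegChain ω n x x :=
  ⟨fun _ => x, rfl, rfl, fun i _ => by simpa using hx⟩

theorem SegChain.mono {ω : Set Plane} {m n : ℕ} {x y : Plane} (h : SegChain ω m x y)
    (hy : y ∈ ω) (hmn : m ≤ n) : SegChain ω n x y := by
  have := h.trans (SegChain.refl hy (n - m))
  rwa [Nat.add_sub_cancel' hmn] at this

theorem segChain_of_starPieces {N : ℕ} {K : Fin N → Set Plane} {c : Fin N → Plane} {ρ : ℝ}
    (hρ : 0 < ρ) (hK : ∀ i, StarPiece (K i) (c i) ρ) (hconn : IsPreconnected (⋃ i, K i))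
    {x y : Plane} (hx : x ∈ ⋃ i, K i) (hy : y ∈ ⋃ i, K i) : SegChain (⋃ i, K i) (2 * N) x y := by
  set ω := ⋃ i, K i with hω
  have hKω : ∀ i, K i ⊆ ω := fun i => subset_iUnion K i
  have hcK : ∀ i, c i ∈ K i := fun i => (hK i).ball_subset (mem_ball_self hρ)
  have hseg : ∀ i, ∀ z ∈ K i, segment ℝ (c i) z ⊆ ω := fun i z hz =>
    ((hK i).star _ (mem_ball_self hρ)).segment_subset hz |>.trans (hKω i)
  let G : SimpleGraph (Fin N) := SimpleGraph.fromRel fun i j => (K i ∩ K j).Nonempty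
  have hadj : ∀ i j, G.Adj i j → SegChain ω 2 (c i) (c j) := by
    intro i j hij
    have : (K i ∩ K j).Nonempty := by
      rcases hij.2 with h | h
      · exact h
      · rwa [inter_comm]
    obtain ⟨z, hzi, hzj⟩ := this
    refine (SegChain.of_segment (hseg i z hzi)).trans (SegChain.of_segment ?_)
    rw [segment_symm]
    exact hseg j z hzj
  have hwalk : ∀ i j, ∀ p : G.Walk i j, SegChain ω (2 * p.length) (c i) (c j) := by
    intro i j p
    induction p with
    | nil => exact SegChain.refl (hKω _ (hcK _)) 0
    | cons h p ih =>
      have := (hadj _ _ h).trans ih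
      rwa [show 2 + 2 * p.length = 2 * (p.length + 1) by ring] at this
  have hreach : ∀ i j, G.Reachable i j := by
    intro i
    by_contra! hne
    obtain ⟨j, hj⟩ := hne
    let U := ⋃ k : {k // G.Reachable i k}, K k
    let V := ⋃ k : {k // ¬G.Reachable i k}, K k
    have hdisj : Disjoint U V := by
      simp only [U, V, disjoint_iUnion_left, disjoint_iUnion_right]
      intro k k'
      rw [Set.disjoint_iff_inter_eq_empty]
      by_contra hkk
      have hne : (K k' ∩ K k).Nonempty := nonempty_iff_ne_empty.2 hkk
      have hne' : (k : Fin N) ≠ k' := fun h => k.2 (h ▸ k'.2)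
      exact k.2 (k'.2.trans (SimpleGraph.Adj.reachable ⟨hne'.symm, Or.inl hne⟩))
    have hsub : ω ⊆ U ∪ V := by
      intro z hz
      obtain ⟨k, hk⟩ := mem_iUnion.1 hz
      by_cases hr : G.Reachable i k
      · exact Or.inl (mem_iUnion.2 ⟨⟨k, hr⟩, hk⟩)
      · exact Or.inr (mem_iUnion.2 ⟨⟨k, hr⟩, hk⟩)
    have hU := hconn.subset_left_of_subset_union (u := U) (v := V)
      (isOpen_iUnion fun k => (hK k).isOpen) (isOpen_iUnion fun k => (hK k).isOpen) hdisj hsub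
      ⟨c i, hKω i (hcK i), mem_iUnion.2 ⟨⟨i, SimpleGraph.Reachable.refl i⟩, hcK i⟩⟩
    exact disjoint_left.1 hdisj (hU (hKω j (hcK j))) (mem_iUnion.2 ⟨⟨j, hj⟩, hcK j⟩)
  obtain ⟨i, hi⟩ := mem_iUnion.1 hx
  obtain ⟨j, hj⟩ := mem_iUnion.1 hy
  obtain ⟨p, hp⟩ := (hreach i j).exists_isPath
  have hlen : p.length < N := by simpa using hp.length_lt
  have hxi : SegChain ω 1 x (c i) := SegChain.of_segment (by
    rw [segment_symm]
    exact hseg i x hi)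
  refine ((hxi.trans (hwalk i j p)).trans (SegChain.of_segment (hseg j y hj))).mono hy ?_
  omega

/-! ### Neighbourhoods of the boundary -/

/-- The set of points within distance `ε` of `S`. -/
def nbhd (ε : ℝ) (S : Set Plane) : Set Plane := {z | ∃ x ∈ S, dist z x ≤ ε}

theorem StarPiece.volume_nbhd_frontier_le {K : Set Plane} {c : Plane} {ρ : ℝ}
    (hK : StarPiece K c ρ) {η ε : ℝ} (hη : 0 < η) (hη1 : η < 1) (hε : ε < η * ρ)
    (hfin : volume K ≠ ∞) :
    volume (nbhd ε (frontier K)) ≤ ENNReal.ofReal (4 * η) * volume K := by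
  by_cases hε0 : ε < 0
  · have : nbhd ε (frontier K) = ∅ := by
      refine eq_empty_of_forall_notMem fun z hz => ?_
      obtain ⟨x, -, h⟩ := hz
      linarith [dist_nonneg (x := z) (y := x)]
    simp [this]
  have hρ : 0 < ρ := by
    by_contra hρ
    have : η * ρ ≤ 0 := mul_nonpos_of_nonneg_of_nonpos hη.le (not_lt.1 hρ)
    linarith
  let A := AffineMap.homothety c (1 + η) '' K
  let B := AffineMap.homothety c (1 - η) '' K
  have hy : ∀ z x : Plane, dist z x ≤ ε → c + η⁻¹ • (z - x) ∈ ball c ρ := by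
    intro z x h
    rw [mem_ball, dist_eq_norm, add_sub_cancel_left, norm_smul, norm_inv, Real.norm_eq_abs,
      abs_of_pos hη, ← dist_eq_norm, inv_mul_lt_iff₀ hη]
    linarith
  have hsub : nbhd ε (frontier K) ⊆ A \ B := by
    rintro z ⟨x, hx, hzx⟩
    refine ⟨?_, ?_⟩
    · have h1 := hK.lineMap_mem (frontier_subset_closure hx) (hy z x hzx)
        (τ := η / (1 + η)) (by positivity) (by rw [div_le_one (by positivity)]; linarith)
      refine ⟨_, h1, ?_⟩
      rw [AffineMap.homothety_apply, vsub_eq_sub, vadd_eq_add]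
      have h2 : (1 + η) ≠ 0 := by positivity
      ext i
      simp only [PiLp.add_apply, PiLp.smul_apply, PiLp.sub_apply, smul_eq_mul]
      field_simp
      ring
    · rintro ⟨k, hk, rfl⟩
      have hxK : x ∉ K := by
        have := hx.2
        rwa [hK.isOpen.interior_eq] at this
      refine hxK ?_
      have h1 := hK.star _ (hy x _ (by rwa [dist_comm])) hk (a := η) (b := 1 - η) hη.le
        (by linarith) (by ring)
      convert h1 using 1
      rw [AffineMap.homothety_apply, vsub_eq_sub, vadd_eq_add]
      ext i
      simp only [PiLp.add_apply, PiLp.smul_apply, PiLp.sub_apply, smul_eq_mul]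
      field_simp
      ring
  have hBK : B ⊆ A := by
    rintro _ ⟨k, hk, rfl⟩
    have h1 := hK.star c (mem_ball_self hρ) hk (a := 2 * η / (1 + η)) (b := (1 - η) / (1 + η))
      (by positivity) (div_nonneg (by linarith) (by positivity)) (by field_simp; ring)
    refine ⟨_, h1, ?_⟩
    simp only [AffineMap.homothety_apply, vsub_eq_sub, vadd_eq_add]
    have h2 : (1 + η) ≠ 0 := by positivity
    ext i
    simp only [PiLp.add_apply, PiLp.smul_apply, PiLp.sub_apply, smul_eq_mul]
    field_simp
    ring
  have hA : volume A = ENNReal.ofReal ((1 + η) ^ 2) * volume K := by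
    rw [Measure.addHaar_image_homothety]
    simp
  have hB : volume B = ENNReal.ofReal ((1 - η) ^ 2) * volume K := by
    rw [Measure.addHaar_image_homothety]
    simp
  have hBm : NullMeasurableSet B volume := by
    have : IsOpen B := by
      have h2 : (1 - η) ≠ 0 := by linarith
      exact (AffineMap.homothety_isOpenMap c (1 - η) h2) _ hK.isOpen
    exact this.measurableSet.nullMeasurableSet
  calc _ ≤ volume (A \ B) := measure_mono hsub
    _ = volume A - volume B := measure_sdiff hBK hBm (by
        rw [hB]; exact ENNReal.mul_ne_top ENNReal.ofReal_ne_top hfin)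
    _ = _ := by
      rw [hA, hB, ← ENNReal.sub_mul fun _ _ => hfin, ← ENNReal.ofReal_sub _ (sq_nonneg _)]
      congr 2
      ring

theorem frontier_iUnion_subset {N : ℕ} {K : Fin N → Set Plane} :
    frontier (⋃ i, K i) ⊆ ⋃ i, frontier (K i) := by
  intro x hx
  rw [frontier, closure_iUnion_of_finite] at hx
  obtain ⟨i, hi⟩ := mem_iUnion.1 hx.1
  refine mem_iUnion.2 ⟨i, hi, fun h => hx.2 ?_⟩
  exact interior_mono (subset_iUnion K i) h

theorem exists_volume_nbhd_frontier_le {a : ℝ} (ha : 0 < a) : ∃ C > 0, ∀ E : PolygonalElement,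
    E.ShapeRegular a → ∀ ε > 0, 8 * ε ≤ a * E.diam →
      volume (nbhd ε (frontier E.carrier)) ≤ ENNReal.ofReal (C * ε * E.diam) := by
  obtain ⟨N, hN, hpieces⟩ := exists_starPieces ha
  have hball : volume (ball (0 : Plane) 1) ≠ ∞ := measure_ball_lt_top.ne
  set b := volume.real (ball (0 : Plane) 1) with hb
  have hbpos : 0 < b := ENNReal.toReal_pos (measure_ball_pos _ _ one_pos).ne' hball
  refine ⟨N * (64 / a) * b, by positivity, fun E hE ε hε hεa => ?_⟩
  obtain ⟨K, c, hcov, hK⟩ := hpieces E hE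
  have hd := E.diam_pos
  have hKc : ∀ i, K i ⊆ ball (c i) (2 * E.diam) := by
    intro i x hx
    have h1 : x ∈ E.carrier := hcov ▸ mem_iUnion.2 ⟨i, hx⟩
    have h2 : c i ∈ E.carrier := hcov ▸ mem_iUnion.2
      ⟨i, (hK i).ball_subset (mem_ball_self (by positivity))⟩
    have := E.dist_le_diam h1 h2
    rw [mem_ball]
    linarith
  have hvol : ∀ i, volume (K i) ≤ ENNReal.ofReal (4 * E.diam ^ 2 * b) := by
    intro i
    refine (measure_mono (hKc i)).trans ?_
    rw [Measure.addHaar_ball _ _ (by positivity), finrank_euclideanSpace, Fintype.card_fin,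
      ENNReal.ofReal_mul (by positivity), hb, Measure.real, ENNReal.ofReal_toReal hball, mul_pow]
    norm_num
  have hnb : nbhd ε (frontier E.carrier) ⊆ ⋃ i, nbhd ε (frontier (K i)) := by
    rintro z ⟨x, hx, hzx⟩
    rw [hcov] at hx
    obtain ⟨i, hi⟩ := mem_iUnion.1 (frontier_iUnion_subset hx)
    exact mem_iUnion.2 ⟨i, x, hi, hzx⟩
  have hη : 0 < a * E.diam := by positivity
  calc _ ≤ ∑ i, volume (nbhd ε (frontier (K i))) :=
        (measure_mono hnb).trans (measure_iUnion_fintype_le _ _)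
    _ ≤ ∑ _i : Fin N, ENNReal.ofReal (4 * (4 * ε / (a * E.diam))) *
          ENNReal.ofReal (4 * E.diam ^ 2 * b) := by
        refine Finset.sum_le_sum fun i _ => ?_
        refine ((hK i).volume_nbhd_frontier_le (η := 4 * ε / (a * E.diam)) (by positivity) ?_ ?_
          (ne_top_of_le_ne_top ENNReal.ofReal_ne_top (hvol i))).trans
            (mul_le_mul_right (hvol i) _)
        · rw [div_lt_one hη]
          linarith
        · rw [div_mul_eq_mul_div, lt_div_iff₀ hη]
          nlinarith
    _ ≤ _ := by
        rw [Finset.sum_const, Finset.card_univ, Fintype.card_fin, nsmul_eq_mul,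
          ← ENNReal.ofReal_mul (by positivity), ← ENNReal.ofReal_natCast,
          ← ENNReal.ofReal_mul (by positivity)]
        refine ENNReal.ofReal_le_ofReal (le_of_eq ?_)
        field_simp
        ring

/-! ### Derivatives of sums of monomials -/

theorem fderiv_eq_partialD (φ : Plane → ℝ) (x v : Plane) :
    fderiv ℝ φ x v = v 0 * partialD 0 φ x + v 1 * partialD 1 φ x := by
  have hv : v = v 0 • EuclideanSpace.single (0 : Fin 2) (1 : ℝ) +
      v 1 • EuclideanSpace.single (1 : Fin 2) (1 : ℝ) := by
    ext i
    fin_cases i <;> simp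
  conv_lhs => rw [hv]
  simp [partialD]

theorem norm_fderiv_le_of_partialD {φ : Plane → ℝ} {x : Plane} {B : ℝ}
    (h : ∀ i, |partialD i φ x| ≤ B) : ‖fderiv ℝ φ x‖ ≤ 2 * B := by
  have hB : 0 ≤ B := (abs_nonneg _).trans (h 0)
  refine ContinuousLinearMap.opNorm_le_bound _ (by positivity) fun v => ?_
  rw [fderiv_eq_partialD, Real.norm_eq_abs]
  refine (abs_add_le _ _).trans ?_
  rw [abs_mul, abs_mul]
  have h0 := mul_le_mul (abs_coord_le v 0) (h 0) (abs_nonneg _) (norm_nonneg v)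
  have h1 := mul_le_mul (abs_coord_le v 1) (h 1) (abs_nonneg _) (norm_nonneg v)
  linarith

theorem abs_sub_le_of_partialD_segment {φ : Plane → ℝ} (hφ : Differentiable ℝ φ) {B : ℝ}
    {x y : Plane} (h : ∀ z ∈ segment ℝ x y, ∀ i, |partialD i φ z| ≤ B) :
    ∀ z ∈ segment ℝ x y, |φ z - φ x| ≤ 2 * B * dist z x := by
  intro z hz
  rw [dist_eq_norm, ← Real.norm_eq_abs]
  exact (convex_segment x y).norm_image_sub_le_of_norm_fderiv_le (fun z _ => hφ z)
    (fun z hz => norm_fderiv_le_of_partialD (h z hz)) (left_mem_segment ℝ x y) hz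

theorem hasFDerivAt_coord (i : Fin 2) (x : Plane) :
    HasFDerivAt (fun y : Plane => y i) (EuclideanSpace.proj (𝕜 := ℝ) i) x :=
  (EuclideanSpace.proj (𝕜 := ℝ) i).hasFDerivAt

theorem partialD_zero_scaledMono (y : Plane) (m n : ℕ) :
    partialD 0 (scaledMono y 1 (m, n)) = fun x => m * scaledMono y 1 (m - 1, n) x := by
  funext x
  have h := (((hasFDerivAt_coord 0 x).sub_const (y 0)).pow m).fun_mul
    (((hasFDerivAt_coord 1 x).sub_const (y 1)).pow n)
  have e : scaledMono y 1 (m, n) = fun x => (x 0 - y 0) ^ m * (x 1 - y 1) ^ n := by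
    funext z
    simp [scaledMono]
  rw [partialD, e, h.fderiv]
  simp [scaledMono]
  ring

theorem partialD_one_scaledMono (y : Plane) (m n : ℕ) :
    partialD 1 (scaledMono y 1 (m, n)) = fun x => n * scaledMono y 1 (m, n - 1) x := by
  funext x
  have h := (((hasFDerivAt_coord 0 x).sub_const (y 0)).pow m).fun_mul
    (((hasFDerivAt_coord 1 x).sub_const (y 1)).pow n)
  have e : scaledMono y 1 (m, n) = fun x => (x 0 - y 0) ^ m * (x 1 - y 1) ^ n := by
    funext z
    simp [scaledMono]
  rw [partialD, e, h.fderiv]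
  simp [scaledMono]
  ring

theorem partialD_sum {ι : Type*} (s : Finset ι) (c : ι → ℝ) {f : ι → Plane → ℝ}
    (hf : ∀ j ∈ s, Differentiable ℝ (f j)) (i : Fin 2) :
    partialD i (fun x => ∑ j ∈ s, c j * f j x) = fun x => ∑ j ∈ s, c j * partialD i (f j) x := by
  funext x
  have h : HasFDerivAt (fun x => ∑ j ∈ s, c j * f j x) (∑ j ∈ s, c j • fderiv ℝ (f j) x) x :=
    HasFDerivAt.fun_sum fun j hj => ((hf j hj x).hasFDerivAt.const_mul (c j))
  rw [partialD, h.fderiv]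
  simp [partialD]

theorem differentiable_scaledMono (y : Plane) (d : ℝ) (β : ℕ × ℕ) :
    Differentiable ℝ (scaledMono y d β) :=
  (contDiff_scaledMono y d β (n := 1)).differentiable (by simp)

theorem iterate_partialD_one_sum (s : Finset (ℕ × ℕ)) (c : ℕ × ℕ → ℝ) (y : Plane) (b : ℕ) :
    (partialD 1)^[b] (fun x => ∑ γ ∈ s, c γ * scaledMono y 1 γ x) =
      fun x => ∑ γ ∈ s, c γ * γ.2.descFactorial b * scaledMono y 1 (γ.1, γ.2 - b) x := by
  induction b with
  | zero => simp
  | succ b ih =>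
    rw [Function.iterate_succ_apply', ih, partialD_sum _ _ fun γ _ =>
      differentiable_scaledMono y 1 _]
    funext x
    refine Finset.sum_congr rfl fun γ _ => ?_
    rw [partialD_one_scaledMono, Nat.descFactorial_succ, Nat.sub_sub]
    push_cast
    ring

theorem iterate_partialD_zero_sum (s : Finset (ℕ × ℕ)) (c : ℕ × ℕ → ℝ) (e : ℕ × ℕ → ℕ) (y : Plane)
    (a : ℕ) :
    (partialD 0)^[a] (fun x => ∑ γ ∈ s, c γ * scaledMono y 1 (γ.1, e γ) x) =
      fun x => ∑ γ ∈ s, c γ * γ.1.descFactorial a * scaledMono y 1 (γ.1 - a, e γ) x := by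
  induction a with
  | zero => simp
  | succ a ih =>
    rw [Function.iterate_succ_apply', ih, partialD_sum _ _ fun γ _ =>
      differentiable_scaledMono y 1 _]
    funext x
    refine Finset.sum_congr rfl fun γ _ => ?_
    rw [partialD_zero_scaledMono, Nat.descFactorial_succ, Nat.sub_sub]
    push_cast
    ring

theorem multiD_monoSum (k : ℕ) (y : Plane) (c : ℕ × ℕ → ℝ) (β : ℕ × ℕ) (x : Plane) :
    multiD β (monoSum k y 1 c) x = ∑ γ ∈ multiIdx k, c γ * γ.2.descFactorial β.2 *
      γ.1.descFactorial β.1 * scaledMono y 1 (γ.1 - β.1, γ.2 - β.2) x := by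
  have h := iterate_partialD_one_sum (multiIdx k) c y β.2
  have h' := iterate_partialD_zero_sum (multiIdx k) (fun γ => c γ * γ.2.descFactorial β.2)
    (fun γ => γ.2 - β.2) y β.1
  rw [multiD, show monoSum k y 1 c = fun x => ∑ γ ∈ multiIdx k, c γ * scaledMono y 1 γ x from rfl,
    h, h']

/-- The polynomial of degree `k` whose derivatives at `y` are prescribed. -/
noncomputable def taylorSum (k : ℕ) (y : Plane) (a : ℕ × ℕ → ℝ) : Plane → ℝ :=
  monoSum k y 1 fun β => a β / (β.1.factorial * β.2.factorial)

theorem contDiff_taylorSum (k : ℕ) (y : Plane) (a : ℕ × ℕ → ℝ) {n : WithTop ℕ∞} :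
    ContDiff ℝ n (taylorSum k y a) :=
  contDiff_monoSum _ _ _ _

theorem multiD_taylorSum_self {k : ℕ} (y : Plane) (a : ℕ × ℕ → ℝ) {β : ℕ × ℕ}
    (hβ : β.1 + β.2 ≤ k) : multiD β (taylorSum k y a) y = a β := by
  rw [taylorSum, multiD_monoSum, Finset.sum_eq_single β]
  · simp only [Nat.descFactorial_self, scaledMono, Nat.sub_self, pow_zero, mul_one]
    have h1 : (β.1.factorial : ℝ) ≠ 0 := by exact_mod_cast β.1.factorial_ne_zero
    have h2 : (β.2.factorial : ℝ) ≠ 0 := by exact_mod_cast β.2.factorial_ne_zero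
    field_simp
  · intro γ _ hγ
    by_cases h1 : γ.1 < β.1
    · simp [Nat.descFactorial_of_lt h1]
    by_cases h2 : γ.2 < β.2
    · simp [Nat.descFactorial_of_lt h2]
    have : γ.1 - β.1 ≠ 0 ∨ γ.2 - β.2 ≠ 0 := by
      by_contra! h
      exact hγ (Prod.ext (by omega) (by omega))
    rcases this with h | h <;> simp [scaledMono, h]
  · intro h
    exact (h (mem_multiIdx.2 hβ)).elim

theorem multiD_taylorSum_eq_zero {k : ℕ} (y : Plane) (a : ℕ × ℕ → ℝ) {β : ℕ × ℕ}
    (hβ : k < β.1 + β.2) (x : Plane) : multiD β (taylorSum k y a) x = 0 := by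
  rw [taylorSum, multiD_monoSum]
  refine Finset.sum_eq_zero fun γ hγ => ?_
  rw [mem_multiIdx] at hγ
  by_cases h1 : γ.1 < β.1
  · simp [Nat.descFactorial_of_lt h1]
  · have h2 : γ.2 < β.2 := by omega
    simp [Nat.descFactorial_of_lt h2]

theorem tendsto_multiD_taylorSum {k : ℕ} (y : Plane) {a : ℕ → ℕ × ℕ → ℝ} {b : ℕ × ℕ → ℝ}
    (h : ∀ β ∈ multiIdx k, Tendsto (fun n => a n β) atTop (𝓝 (b β))) (β : ℕ × ℕ) (x : Plane) :
    Tendsto (fun n => multiD β (taylorSum k y (a n)) x) atTop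
      (𝓝 (multiD β (taylorSum k y b) x)) := by
  simp only [taylorSum, multiD_monoSum]
  exact tendsto_finsetSum _ fun γ hγ =>
    ((((h γ hγ).div_const _).mul_const _).mul_const _).mul_const _

/-! ### Taylor approximation -/

theorem abs_le_of_segChain {φ : Plane → ℝ} (hφ : Differentiable ℝ φ) {B d : ℝ} {n : ℕ}
    {z : ℕ → Plane} (h0 : φ (z 0) = 0)
    (hB : ∀ i < n, ∀ x ∈ segment ℝ (z i) (z (i + 1)), ∀ j, |partialD j φ x| ≤ B)
    (hd : ∀ i < n, dist (z i) (z (i + 1)) ≤ d) :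
    ∀ i < n, ∀ x ∈ segment ℝ (z i) (z (i + 1)), |φ x| ≤ 2 * n * d * B := by
  have key : ∀ m ≤ n, (|φ (z m)| ≤ 2 * m * d * B) ∧
      ∀ i < m, ∀ x ∈ segment ℝ (z i) (z (i + 1)), |φ x| ≤ 2 * (i + 1 : ℕ) * d * B := by
    intro m
    induction m with
    | zero => exact fun _ => ⟨by simp [h0], fun i hi => absurd hi (by simp)⟩
    | succ m ih =>
      intro hm
      obtain ⟨h1, h2⟩ := ih (by omega)
      have h3 : ∀ x ∈ segment ℝ (z m) (z (m + 1)), |φ x| ≤ 2 * (m + 1 : ℕ) * d * B := by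
        intro x hx
        have h4 := abs_sub_le_of_partialD_segment hφ (hB m (by omega)) x hx
        have hB0 : 0 ≤ B := (abs_nonneg _).trans (hB m (by omega) x hx 0)
        have h5 : dist x (z m) ≤ d := by
          refine le_trans ?_ (hd m (by omega))
          obtain ⟨t, ht, rfl⟩ := (segment_eq_image_lineMap ℝ (z m) (z (m + 1))) ▸ hx
          rw [dist_lineMap_left, Real.norm_eq_abs, abs_of_nonneg ht.1]
          exact mul_le_of_le_one_left dist_nonneg ht.2
        have h6 : 2 * B * dist x (z m) ≤ 2 * B * d := by gcongr
        have h7 := abs_sub_abs_le_abs_sub (φ x) (φ (z m))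
        push_cast
        nlinarith
      refine ⟨h3 _ (right_mem_segment ℝ _ _), fun i hi => ?_⟩
      rcases Nat.lt_succ_iff_lt_or_eq.1 hi with hi | rfl
      · exact h2 i hi
      · exact h3
  intro i hi x hx
  refine ((key n le_rfl).2 i hi x hx).trans ?_
  have hB0 : 0 ≤ B := (abs_nonneg _).trans (hB i hi x hx 0)
  have hd0 : 0 ≤ d := dist_nonneg.trans (hd i hi)
  have : ((i + 1 : ℕ) : ℝ) ≤ n := by exact_mod_cast hi
  gcongr

theorem abs_multiD_le_of_segChain {f : Plane → ℝ} (hf : ContDiff ℝ (⊤ : ℕ∞) f) {K d : ℝ} {n l : ℕ}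
    {z : ℕ → Plane} (h0 : ∀ β : ℕ × ℕ, β.1 + β.2 ≤ l → multiD β f (z 0) = 0)
    (hK : ∀ β : ℕ × ℕ, β.1 + β.2 = l + 1 → ∀ i < n, ∀ x ∈ segment ℝ (z i) (z (i + 1)),
      |multiD β f x| ≤ K)
    (hd : ∀ i < n, dist (z i) (z (i + 1)) ≤ d) :
    ∀ j ≤ l + 1, ∀ β : ℕ × ℕ, β.1 + β.2 + j = l + 1 → ∀ i < n,
      ∀ x ∈ segment ℝ (z i) (z (i + 1)), |multiD β f x| ≤ (2 * n * d) ^ j * K := by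
  intro j
  induction j with
  | zero =>
    intro _ β hβ i hi x hx
    simpa using hK β hβ i hi x hx
  | succ j ih =>
    intro hj β hβ
    have h1 := abs_le_of_segChain (B := (2 * n * d) ^ j * K)
      (differentiable_of_smooth (contDiff_multiD hf β)) (h0 β (by omega)) ?_ hd
    · intro i hi x hx
      refine (h1 i hi x hx).trans_eq ?_
      ring
    · intro i hi x hx q
      fin_cases q
      · simp only [Fin.zero_eta]
        rw [partialD_zero_multiD]
        exact ih (by omega) (β.1 + 1, β.2) (by simp only; omega) i hi x hx
      · simp only [Fin.mk_one]
        rw [partialD_one_multiD hf]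
        exact ih (by omega) (β.1, β.2 + 1) (by simp only; omega) i hi x hx

theorem eventually_closedBall_subset {ω S : Set Plane} (hω : IsOpen ω) (hS : IsCompact S)
    (hSω : S ⊆ ω) : ∀ᶠ m in atTop, ∀ x ∈ S, closedBall x (molBump m).rOut ⊆ ω := by
  obtain ⟨δ, hδ, hsub⟩ := hS.exists_cthickening_subset_open hω hSω
  filter_upwards [eventually_rOut_lt hδ] with m hm x hx
  exact (closedBall_subset_closedBall hm.le).trans
    ((closedBall_subset_cthickening hx δ).trans hsub)

theorem exists_taylorSum_approx {ω : Set Plane} (hω : IsOpen ω) {d : ℝ} {n l : ℕ} (hn : 0 < n)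
    (hd : ∀ x ∈ ω, ∀ y ∈ ω, dist x y ≤ d) {x₀ : Plane} (hx₀ : x₀ ∈ ω)
    (hchain : ∀ x ∈ ω, SegChain ω n x₀ x) {u : Plane → ℝ} {w : ℕ × ℕ → Plane → ℝ}
    {M : ℕ × ℕ → ℝ} {K : ℝ} (hu : IntegrableOn u ω)
    (hw : ∀ β : ℕ × ℕ, β.1 + β.2 ≤ l + 1 → HasWeakDeriv ω β u (w β) ∧ IntegrableOn (w β) ω ∧
      ∀ᵐ x ∂volume.restrict ω, |w β x| ≤ M β)
    (hK : ∀ β : ℕ × ℕ, β.1 + β.2 = l + 1 → M β ≤ K) :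
    ∃ a : ℕ × ℕ → ℝ, (∀ β : ℕ × ℕ, β.1 + β.2 ≤ l → |a β| ≤ M β) ∧
      ∀ᵐ x ∂volume.restrict ω, ∀ β : ℕ × ℕ, β.1 + β.2 ≤ l →
        |w β x - multiD β (taylorSum l x₀ a) x| ≤ (2 * n * d) ^ (l + 1 - (β.1 + β.2)) * K := by
  have hωm := hω.measurableSet
  let f : ℕ → Plane → ℝ := fun m => mollify m (ω.indicator u)
  have hf : ∀ m, ContDiff ℝ (⊤ : ℕ∞) (f m) := fun m =>
    contDiff_mollify m (hu.integrable_indicator hωm).locallyIntegrable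
  have hbound : ∀ β : ℕ × ℕ, β.1 + β.2 ≤ l + 1 → ∀ m x, closedBall x (molBump m).rOut ⊆ ω →
      |multiD β (f m) x| ≤ M β := by
    intro β hβ m x hx
    obtain ⟨h1, h2, h3⟩ := hw β hβ
    rw [multiD_mollify hωm hu h1 hx]
    refine abs_mollify_le ?_
    filter_upwards [(ae_restrict_iff' hωm).1 h3] with y hy hyx
    rw [indicator_of_mem (hx hyx)]
    exact hy (hx hyx)
  let a : ℕ → ℕ × ℕ → ℝ := fun m β => multiD β (f m) x₀
  have hx₀ev : ∀ᶠ m in atTop, closedBall x₀ (molBump m).rOut ⊆ ω := by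
    filter_upwards [eventually_closedBall_subset hω isCompact_singleton
      (singleton_subset_iff.2 hx₀)] with m hm
    exact hm x₀ rfl
  have hbox : IsCompact (Icc (fun β => -M β) (fun β => M β) : Set (multiIdx l → ℝ)) :=
    isCompact_Icc
  obtain ⟨b, hb, σ, hσ, hlim⟩ := hbox.tendsto_subseq' (x := fun m (β : multiIdx l) => a m β) (by
      refine Eventually.frequently ?_
      filter_upwards [hx₀ev] with m hm
      have : ∀ β : multiIdx l, |a m β| ≤ M β := fun β =>
        hbound β (by have := mem_multiIdx.1 β.2; omega) m x₀ hm
      exact ⟨fun β => (abs_le.1 (this β)).1, fun β => (abs_le.1 (this β)).2⟩)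
  let b' : ℕ × ℕ → ℝ := fun β => if h : β ∈ multiIdx l then b ⟨β, h⟩ else 0
  have hlim' : ∀ β ∈ multiIdx l, Tendsto (fun m => a (σ m) β) atTop (𝓝 (b' β)) := by
    intro β hβ
    simp only [b', dif_pos hβ]
    exact (tendsto_pi_nhds.1 hlim) ⟨β, hβ⟩
  refine ⟨b', fun β hβ => ?_, ?_⟩
  · have hβ' := mem_multiIdx.2 hβ
    simp only [b', dif_pos hβ']
    exact abs_le.2 ⟨hb.1 ⟨β, hβ'⟩, hb.2 ⟨β, hβ'⟩⟩
  have hae : ∀ᵐ x ∂volume.restrict ω, ∀ β ∈ multiIdx l,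
      Tendsto (fun m => mollify m (ω.indicator (w β)) x) atTop (𝓝 (w β x)) := by
    rw [ae_restrict_iff' hωm]
    have : ∀ᵐ x : Plane, ∀ β ∈ multiIdx l, x ∈ ω →
        Tendsto (fun m => mollify m (ω.indicator (w β)) x) atTop (𝓝 (w β x)) := by
      rw [eventually_all_finset]
      intro β hβ
      have h2 := (hw β (by have := mem_multiIdx.1 hβ; omega)).2.1
      filter_upwards [ae_tendsto_mollify (h2.integrable_indicator hωm).locallyIntegrable]
        with x hx hxω
      rwa [indicator_of_mem hxω] at hx
    filter_upwards [this] with x hx hxω β hβ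
    exact hx β hβ hxω
  filter_upwards [hae, ae_restrict_mem hωm] with x hx hxω β hβ
  obtain ⟨z, hz0, hzn, hz⟩ := hchain x hxω
  let S : Set Plane := ⋃ i : Fin n, segment ℝ (z i) (z (i + 1))
  have hSc : IsCompact S := isCompact_iUnion fun i => by
    rw [segment_eq_image_lineMap]
    exact isCompact_Icc.image (AffineMap.lineMap_continuous)
  have hSω : S ⊆ ω := iUnion_subset fun i => hz i i.2
  have hlast : x ∈ segment ℝ (z (n - 1)) (z (n - 1 + 1)) := by
    rw [Nat.sub_add_cancel hn, hzn]
    exact right_mem_segment ℝ _ _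
  have hdz : ∀ i < n, dist (z i) (z (i + 1)) ≤ d := fun i hi =>
    hd _ (hz i hi (left_mem_segment ℝ _ _)) _ (hz i hi (right_mem_segment ℝ _ _))
  have hev : ∀ᶠ m in atTop,
      |mollify m (ω.indicator (w β)) x - multiD β (taylorSum l x₀ (a m)) x| ≤
        (2 * n * d) ^ (l + 1 - (β.1 + β.2)) * K := by
    filter_upwards [eventually_closedBall_subset hω hSc hSω] with m hm
    have hxS : x ∈ S := mem_iUnion.2 ⟨⟨n - 1, by omega⟩, hlast⟩
    have hT := contDiff_taylorSum l x₀ (a m) (n := (⊤ : ℕ∞))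
    have hsub : ∀ β y, multiD β (fun x => f m x - taylorSum l x₀ (a m) x) y =
        multiD β (f m) y - multiD β (taylorSum l x₀ (a m)) y :=
      fun β y => congrFun (multiD_sub (hf m) hT β) y
    have key := abs_multiD_le_of_segChain (K := K) (n := n) (l := l) (z := z) ((hf m).sub hT)
      (fun β hβ => by
        rw [hsub, hz0, multiD_taylorSum_self x₀ (a m) hβ, sub_self])
      (fun β hβ i hi y hy => by
        rw [hsub, multiD_taylorSum_eq_zero x₀ (a m) (by omega), sub_zero]
        exact (hbound β hβ.le m y (hm y (mem_iUnion.2 ⟨⟨i, hi⟩, hy⟩))).trans (hK β hβ)) hdz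
      (l + 1 - (β.1 + β.2)) (by omega) β (by omega) (n - 1) (by omega) x hlast
    rwa [hsub, multiD_mollify hωm hu (hw β (by omega)).1 (hm x hxS)] at key
  refine le_of_tendsto (((hx β (mem_multiIdx.2 hβ)).comp hσ.tendsto_atTop).sub
    (tendsto_multiD_taylorSum x₀ hlim' β x)).abs (hσ.tendsto_atTop.eventually hev)

/-! ### Polynomials on subsets of the unit interval -/

theorem exists_separated_points {S : Set ℝ} {σ : ℝ} {l : ℕ} (hσ : 0 < σ)
    (hfin : volume S ≠ ∞) (hvol : σ ≤ volume.real S) {f : ℝ → ℝ}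
    (hf : IntegrableOn f S) (hf0 : ∀ t, 0 ≤ f t) :
    ∀ j ≤ l + 1, ∃ s : Finset ℝ, s.card = j ∧ (∀ t ∈ s, t ∈ S) ∧ (∀ t ∈ s, f t ≤ 2 / σ * ∫ t in S, f t) ∧
      ∀ t ∈ s, ∀ t' ∈ s, t ≠ t' → σ / (4 * (l + 1)) ≤ |t - t'| := by
  classical
  set δ := σ / (4 * (l + 1)) with hδ
  have hδ0 : 0 < δ := by positivity
  intro j
  induction j with
  | zero => exact fun _ => ⟨∅, by simp⟩
  | succ j ih =>
    intro hj
    obtain ⟨s, hcard, hsS, hle, hsep⟩ := ih (by omega)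
    let U : Set ℝ := ⋃ t ∈ s, Ioo (t - δ) (t + δ)
    have hU : volume U ≤ ENNReal.ofReal (j * (2 * δ)) := by
      refine (measure_biUnion_finset_le _ _).trans ?_
      simp only [Real.volume_Ioo, add_sub_sub_cancel, ← two_mul]
      rw [Finset.sum_const, hcard, nsmul_eq_mul, ← ENNReal.ofReal_natCast,
        ← ENNReal.ofReal_mul (by positivity)]
    have hUr : volume.real U ≤ σ / 2 := by
      refine (ENNReal.toReal_le_of_le_ofReal (by positivity) hU).trans ?_
      have : (j : ℝ) ≤ l := by exact_mod_cast (by omega : j ≤ l)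
      rw [hδ, show (j : ℝ) * (2 * (σ / (4 * (l + 1)))) = j / (l + 1) * (σ / 2) by
        field_simp; ring]
      have h1 : (j : ℝ) / (l + 1) ≤ 1 := by
        rw [div_le_one (by positivity)]
        linarith
      nlinarith
    have hUm : MeasurableSet U := Finset.measurableSet_biUnion _ fun t _ => measurableSet_Ioo
    have hdiff : σ / 2 ≤ volume.real (S \ U) := by
      have h1 : volume.real S ≤ volume.real (S \ U) + volume.real U := by
        refine (measureReal_mono (s₂ := (S \ U) ∪ U) ?_ ?_).trans (measureReal_union_le _ _)
        · rw [sdiff_union_self]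
          exact subset_union_left
        · exact ((measure_union_lt_top ((measure_mono sdiff_subset).trans_lt hfin.lt_top)
            (hU.trans_lt ENNReal.ofReal_lt_top))).ne
      linarith
    have hne : volume (S \ U) ≠ 0 := by
      intro h0
      rw [Measure.real, h0] at hdiff
      simp only [ENNReal.toReal_zero] at hdiff
      linarith
    have hfS : IntegrableOn f (S \ U) := hf.mono_set sdiff_subset
    obtain ⟨t, ht, hft⟩ := exists_le_setAverage hne
      ((measure_mono sdiff_subset).trans_lt hfin.lt_top).ne hfS
    have hts : ∀ t' ∈ s, δ ≤ |t - t'| := by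
      intro t' ht'
      by_contra! hlt
      refine ht.2 (mem_biUnion (x := t') ht' ?_)
      rw [abs_lt] at hlt
      exact ⟨by linarith, by linarith⟩
    have htn : t ∉ s := by
      intro h
      have := hts t h
      rw [sub_self, abs_zero] at this
      linarith
    refine ⟨insert t s, by rw [Finset.card_insert_of_notMem htn, hcard], ?_, ?_, ?_⟩
    · intro t' ht'
      rcases Finset.mem_insert.1 ht' with rfl | ht'
      · exact ht.1
      · exact hsS t' ht'
    · intro t' ht'
      rcases Finset.mem_insert.1 ht' with rfl | ht'
      · refine hft.trans ?_
        rw [setAverage_eq, smul_eq_mul]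
        have hI : ∫ t in S \ U, f t ≤ ∫ t in S, f t :=
          setIntegral_mono_set hf (ae_of_all _ hf0) (LE.le.eventuallyLE sdiff_subset)
        have hI0 : 0 ≤ ∫ t in S \ U, f t := integral_nonneg hf0
        have : (volume.real (S \ U))⁻¹ ≤ 2 / σ := by
          rw [← inv_div]
          exact inv_anti₀ (by positivity) hdiff
        gcongr
      · exact hle t' ht'
    · intro t₁ h₁ t₂ h₂ hne
      rcases Finset.mem_insert.1 h₁ with rfl | h₁' <;> rcases Finset.mem_insert.1 h₂ with rfl | h₂'
      · exact (hne rfl).elim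
      · exact hts t₂ h₂'
      · rw [abs_sub_comm]
        exact hts t₁ h₁'
      · exact hsep t₁ h₁' t₂ h₂' hne

theorem exists_poly_subset_bound (l : ℕ) {σ : ℝ} (hσ : 0 < σ) : ∃ C > 0, ∀ q : Polynomial ℝ,
    q.natDegree ≤ l → ∀ S ⊆ Icc (0 : ℝ) 1, MeasurableSet S → σ ≤ volume.real S →
      ∀ x ∈ Icc (0 : ℝ) 1, |q.eval x| ≤ C * ∫ t in S, |q.eval t| := by
  classical
  set δ := σ / (4 * (l + 1)) with hδ
  have hδ0 : 0 < δ := by positivity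
  refine ⟨(l + 1) * (2 / σ) * (δ⁻¹) ^ l, by positivity, fun q hq S hS hSm hvol x hx => ?_⟩
  have hfin : volume S ≠ ∞ := ((measure_mono hS).trans_lt (by simp)).ne
  have hint : IntegrableOn (fun t => |q.eval t|) S :=
    (q.continuous.abs.continuousOn.integrableOn_compact isCompact_Icc).mono_set hS
  obtain ⟨s, hcard, hsS, hle, hsep⟩ := exists_separated_points (l := l) hσ hfin hvol hint
    (fun t => abs_nonneg _) (l + 1) le_rfl
  have hdeg : q.degree < s.card := by
    rw [hcard]
    exact lt_of_le_of_lt Polynomial.degree_le_natDegree (by exact_mod_cast Nat.lt_succ_of_le hq)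
  have hq' := Lagrange.eq_interpolate (f := q) (s := s) (v := id) (injOn_id _) hdeg
  have heval : q.eval x = ∑ i ∈ s, q.eval i * ∏ j ∈ s.erase i, (i - j)⁻¹ * (x - j) := by
    conv_lhs => rw [hq', Lagrange.interpolate_apply, Polynomial.eval_finsetSum]
    refine Finset.sum_congr rfl fun i _ => ?_
    simp [Lagrange.basis, Polynomial.eval_prod, Lagrange.basisDivisor]
  have hI : 0 ≤ ∫ t in S, |q.eval t| := integral_nonneg fun t => abs_nonneg _
  have hterm : ∀ i ∈ s, |q.eval i * ∏ j ∈ s.erase i, (i - j)⁻¹ * (x - j)| ≤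
      2 / σ * (∫ t in S, |q.eval t|) * δ⁻¹ ^ l := by
    intro i hi
    rw [abs_mul, Finset.abs_prod]
    refine mul_le_mul (hle i hi) ?_ (Finset.prod_nonneg fun _ _ => abs_nonneg _) (by positivity)
    have hc : (s.erase i).card = l := by
      rw [Finset.card_erase_of_mem hi, hcard]
      rfl
    rw [← hc, ← Finset.prod_const]
    refine Finset.prod_le_prod (fun _ _ => abs_nonneg _) fun j hj => ?_
    rw [Finset.mem_erase] at hj
    have hj1 := hS (hsS j hj.2)
    rw [abs_mul, abs_inv]
    have h1 := hsep i hi j hj.2 hj.1.symm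
    have h2 : |x - j| ≤ 1 := by
      rw [abs_le]
      constructor <;> linarith [hx.1, hx.2, hj1.1, hj1.2]
    calc _ ≤ δ⁻¹ * 1 := mul_le_mul (inv_anti₀ hδ0 h1) h2 (abs_nonneg _) (by positivity)
      _ = δ⁻¹ := mul_one _
  rw [heval]
  refine (Finset.abs_sum_le_sum_abs _ _).trans ((Finset.sum_le_sum hterm).trans_eq ?_)
  rw [Finset.sum_const, hcard, nsmul_eq_mul]
  push_cast
  ring

/-! ### Straight edges -/

theorem eVariationOn_lineMap (A B : Plane) {x y : ℝ} (hx : x ∈ Icc (0 : ℝ) 1)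
    (hy : y ∈ Icc (0 : ℝ) 1) (hxy : x ≤ y) :
    eVariationOn (fun t : ℝ => AffineMap.lineMap A B t) (Icc 0 1 ∩ Icc x y) =
      ENNReal.ofReal ((y - x) * dist A B) := by
  have h1 : eVariationOn (fun t : ℝ => AffineMap.lineMap A B t) (Icc 0 1 ∩ Icc x y) =
      eVariationOn (fun t : ℝ => t * dist A B) (Icc 0 1 ∩ Icc x y) := by
    simp only [eVariationOn]
    congr 1 with p : 1
    congr 1 with i : 1
    rw [edist_dist, edist_dist, dist_lineMap_lineMap, Real.dist_eq, Real.dist_eq, ← sub_mul,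
      abs_mul, abs_of_nonneg (dist_nonneg (x := A) (y := B))]
  rw [h1]
  have hmono : MonotoneOn (fun t : ℝ => t * dist A B) (Icc 0 1) := fun s _ t _ hst =>
    mul_le_mul_of_nonneg_right hst dist_nonneg
  refine le_antisymm ((hmono.eVariationOn_eq hx hy).le.trans_eq (by rw [sub_mul])) ?_
  have := eVariationOn.edist_le (fun t : ℝ => t * dist A B) (s := Icc 0 1 ∩ Icc x y)
    ⟨hy, hxy, le_rfl⟩ ⟨hx, le_rfl, hxy⟩
  rwa [edist_dist, Real.dist_eq, ← sub_mul, abs_of_nonneg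
    (mul_nonneg (sub_nonneg.2 hxy) dist_nonneg)] at this

theorem PolygonalElement.edgeLength_eq (E : PolygonalElement) (i : Fin E.numEdges) :
    E.toCurved.edgeLength i = dist (E.poly i) (E.poly (finRotate _ i)) := by
  have := eVariationOn_lineMap (E.poly i) (E.poly (finRotate _ i)) (x := 0) (y := 1)
    (by simp) (by simp) zero_le_one
  rw [inter_self, sub_zero, one_mul] at this
  change (eVariationOn (fun t : ℝ => AffineMap.lineMap (E.poly i) (E.poly (finRotate _ i)) t)
    (Icc 0 1)).toReal = _
  rw [this, ENNReal.toReal_ofReal dist_nonneg]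

theorem PolygonalElement.arcParam_mul (E : PolygonalElement) (i : Fin E.numEdges) {t : ℝ}
    (ht : t ∈ Icc (0 : ℝ) 1) :
    E.toCurved.arcParam i (t * E.toCurved.edgeLength i) = E.poly.edgePath ℝ i t := by
  rw [E.edgeLength_eq]
  set A := E.poly i
  set B := E.poly (finRotate _ i)
  have hedge : E.toCurved.edge i = fun t : ℝ => AffineMap.lineMap A B t := rfl
  have hbv : LocallyBoundedVariationOn (fun t : ℝ => AffineMap.lineMap A B t) (Icc 0 1) := by
    intro x y hx hy
    rcases le_total x y with hxy | hxy
    · rw [BoundedVariationOn, eVariationOn_lineMap A B hx hy hxy]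
      exact ENNReal.ofReal_ne_top
    · rw [BoundedVariationOn, eVariationOn.subsingleton]
      · simp
      · exact fun u hu v hv => by
          rw [le_antisymm (hu.2.2.trans hxy) hu.2.1, le_antisymm (hv.2.2.trans hxy) hv.2.1]
  have h0 : (0 : ℝ) ∈ Icc (0 : ℝ) 1 := by simp
  have hv : variationOnFromTo (fun t : ℝ => AffineMap.lineMap A B t) (Icc 0 1) 0 t =
      t * dist A B := by
    rw [variationOnFromTo.eq_of_le _ _ ht.1, eVariationOn_lineMap A B h0 ht ht.1, sub_zero,
      ENNReal.toReal_ofReal (mul_nonneg ht.1 dist_nonneg)]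
  have := edist_naturalParameterization_eq_zero hbv h0 ht
  rw [hv] at this
  simp only [CurvedPolygon.arcParam, hedge]
  exact edist_eq_zero.1 this

theorem PolygonalElement.exists_edge_polynomial (E : PolygonalElement) {k : ℕ} {v : Plane → ℝ}
    (hv : E.toCurved.MemW k v) (i : Fin E.numEdges) : ∃ q : Polynomial ℝ, q.natDegree ≤ k ∧
      ∀ t ∈ Icc (0 : ℝ) 1, v (E.poly.edgePath ℝ i t) = q.eval t := by
  obtain ⟨q, hq, hv⟩ := hv.2.2.2 i
  have hL : 0 ≤ E.toCurved.edgeLength i := ENNReal.toReal_nonneg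
  refine ⟨q.comp (Polynomial.C (E.toCurved.edgeLength i) * Polynomial.X), ?_, fun t ht => ?_⟩
  · refine (Polynomial.natDegree_comp_le).trans ?_
    calc _ ≤ k * 1 := Nat.mul_le_mul hq (Polynomial.natDegree_C_mul_le _ _ |>.trans Polynomial.natDegree_X_le)
      _ = k := mul_one k
  · rw [← E.arcParam_mul i ht, hv _ ⟨mul_nonneg ht.1 hL, mul_le_of_le_one_left hL ht.2⟩]
    rw [Polynomial.eval_comp, Polynomial.eval_mul, Polynomial.eval_C, Polynomial.eval_X, mul_comm]

/-! ### Fans of segments and the trace estimate -/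

/-- The point `x + σ (c - x)` for `x = A + t D`. -/
noncomputable def fan (c A D : Plane) (t σ : ℝ) : Plane := c + (1 - σ) • ((A - c) + t • D)

theorem fan_eq (c A D : Plane) (t σ : ℝ) :
    fan c A D t σ = (A + t • D) + σ • (c - (A + t • D)) := by
  simp only [fan, sub_smul, smul_sub, smul_add, one_smul]
  abel

theorem continuous_fan (c A D : Plane) : Continuous fun p : ℝ × ℝ => fan c A D p.1 p.2 := by
  unfold fan
  fun_prop

theorem measurePreserving_coords :
    MeasurePreserving (fun x : Plane => (x 0, x 1)) volume (volume : Measure (ℝ × ℝ)) :=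
  (volume_preserving_finTwoArrow ℝ).comp
    (EuclideanSpace.volume_preserving_symm_measurableEquiv_toLp (Fin 2))

theorem lintegral_fan_le {c A D : Plane} {κ : ℝ} (hκ : 0 < κ)
    (hcross : κ ≤ |D 1 * (A - c) 0 - D 0 * (A - c) 1|) {S I : Set ℝ} (hS : MeasurableSet S)
    (hI : MeasurableSet I) (hIsub : I ⊆ Iic (1 / 2)) {f : Plane → ℝ≥0∞} (hf : Measurable f) :
    ∫⁻ t in S, ∫⁻ σ in I, f (fan c A D t σ) ≤ ENNReal.ofReal (2 / κ) *
      ∫⁻ x in (fun p : ℝ × ℝ => fan c A D p.1 p.2) '' (S ×ˢ I), f x := by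
  set e := A - c with he
  let Ψ : Plane → Plane := fun p => fan c A D (p 0) (p 1)
  let s : Set Plane := (fun x : Plane => (x 0, x 1)) ⁻¹' (S ×ˢ I)
  have hcm : Measurable fun x : Plane => (x 0, x 1) := measurePreserving_coords.measurable
  have hs : MeasurableSet s := hcm (hS.prod hI)
  have hfan : Measurable fun p : ℝ × ℝ => f (fan c A D p.1 p.2) :=
    hf.comp (continuous_fan c A D).measurable
  have h1 : ∫⁻ t in S, ∫⁻ σ in I, f (fan c A D t σ) = ∫⁻ p in s, f (Ψ p) := by
    rw [← setLIntegral_prod (μ := volume) (ν := volume)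
      (fun p : ℝ × ℝ => f (fan c A D p.1 p.2)) hfan.aemeasurable]
    exact (measurePreserving_coords.setLIntegral_comp_preimage (hS.prod hI) hfan).symm
  let M : Plane → Matrix (Fin 2) (Fin 2) ℝ := fun p =>
    !![(1 - p 1) * D 0, -(e 0 + p 0 * D 0); (1 - p 1) * D 1, -(e 1 + p 0 * D 1)]
  let Ψ' : Plane → Plane →L[ℝ] Plane := fun p =>
    LinearMap.toContinuousLinearMap (Matrix.toEuclideanLin (M p))
  have hdet : ∀ p, (Ψ' p).det = (1 - p 1) * (D 1 * e 0 - D 0 * e 1) := by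
    intro p
    have : (Ψ' p).det = (M p).det := by
      rw [ContinuousLinearMap.det, LinearMap.coe_toContinuousLinearMap,
        Matrix.toEuclideanLin_eq_toLin_orthonormal, LinearMap.det_toLin]
    rw [this, Matrix.det_fin_two]
    simp [M]
    ring
  have hder : ∀ p ∈ s, HasFDerivWithinAt Ψ (Ψ' p) s p := by
    intro p _
    refine hasFDerivWithinAt_euclidean.2 fun i => ?_
    have h2 := (((hasFDerivAt_coord 1 p).const_sub 1).fun_mul
      (((hasFDerivAt_coord 0 p).mul_const (D i)).const_add (e i))).const_add (c i)
    have h3 : (fun x => Ψ x i) = fun x : Plane => c i + (1 - x 1) * (e i + x 0 * D i) := by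
      funext x
      simp [Ψ, fan, he, mul_add]
    rw [h3]
    refine HasFDerivAt.hasFDerivWithinAt (h2.congr_fderiv ?_)
    ext v
    fin_cases i <;>
      simp [Ψ', M, Matrix.mulVec, dotProduct, Fin.sum_univ_two] <;> ring
  have hinj : InjOn Ψ s := by
    intro p hp q hq hpq
    have hp1 : p 1 ≤ 1 / 2 := hIsub hp.2
    have hq1 : q 1 ≤ 1 / 2 := hIsub hq.2
    have hne : D 1 * e 0 - D 0 * e 1 ≠ 0 := by
      intro h0
      rw [h0, abs_zero] at hcross
      linarith
    have h0 := congrArg (fun x : Plane => x 0) hpq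
    have h1 := congrArg (fun x : Plane => x 1) hpq
    simp only [Ψ, fan, PiLp.add_apply, PiLp.smul_apply, smul_eq_mul, add_right_inj, ← he] at h0 h1
    have h2 : (p 1 - q 1) * (D 1 * e 0 - D 0 * e 1) = 0 := by
      linear_combination (-D 1) * h0 + D 0 * h1
    have h3 : p 1 = q 1 := by
      rcases mul_eq_zero.1 h2 with h | h
      · linarith
      · exact (hne h).elim
    rw [h3] at h0 h1
    have hq2 : (1 - q 1) ≠ 0 := by linarith
    have h0' := mul_left_cancel₀ hq2 h0
    have h1' := mul_left_cancel₀ hq2 h1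
    have h4 : p 0 = q 0 := by
      by_cases hD : D 0 = 0
      · have hD1 : D 1 ≠ 0 := by
          intro h
          exact hne (by rw [h, hD]; ring)
        exact mul_right_cancel₀ hD1 (by linarith)
      · exact mul_right_cancel₀ hD (by linarith)
    ext i
    fin_cases i
    · exact h4
    · exact h3
  have h4 := lintegral_image_eq_lintegral_abs_det_fderiv_mul volume hs hder hinj f
  have himg : Ψ '' s = (fun p : ℝ × ℝ => fan c A D p.1 p.2) '' (S ×ˢ I) := by
    ext x
    constructor
    · rintro ⟨p, hp, rfl⟩
      exact ⟨(p 0, p 1), hp, rfl⟩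
    · rintro ⟨p, hp, rfl⟩
      exact ⟨!₂[p.1, p.2], by simpa [s] using hp, by simp [Ψ]⟩
  rw [h1, ← himg, h4, ← lintegral_const_mul' _ _ ENNReal.ofReal_ne_top]
  refine setLIntegral_mono' hs fun p hp => ?_
  rw [hdet, ← mul_assoc, ← ENNReal.ofReal_mul (by positivity)]
  have hp1 : p 1 ≤ 1 / 2 := hIsub hp.2
  refine le_mul_of_one_le_left zero_le ?_
  rw [ENNReal.one_le_ofReal, abs_mul, abs_of_nonneg (by linarith : 0 ≤ 1 - p 1), div_mul_eq_mul_div,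
    le_div_iff₀ hκ]
  nlinarith

theorem abs_le_integral_of_deriv {φ φ' G : ℝ → ℝ} (hφ : ∀ σ, HasDerivAt φ (φ' σ) σ)
    (hφ' : Continuous φ') (hG : Continuous G) (hle : ∀ σ, |φ' σ| ≤ G σ) {τ : ℝ}
    (hτ : τ ≤ 1 / 4) :
    |φ τ| ≤ ∫ σ in τ..(1 / 2), (4 * |φ σ| + G σ) := by
  have hcφ : Continuous φ := continuous_iff_continuousAt.2 fun σ => (hφ σ).continuousAt
  have hG0 : ∀ σ, 0 ≤ G σ := fun σ => (abs_nonneg _).trans (hle σ)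
  set J := ∫ σ in τ..(1 / 2), G σ with hJ
  have h1 : ∀ s ∈ Icc (1 / 4 : ℝ) (1 / 2), |φ τ| ≤ |φ s| + J := by
    intro s hs
    have hτs : τ ≤ s := hτ.trans hs.1
    have h2 := intervalIntegral.integral_eq_sub_of_hasDerivAt (a := τ) (b := s)
      (fun σ _ => hφ σ) (hφ'.intervalIntegrable _ _)
    have h3 : ‖∫ σ in τ..s, φ' σ‖ ≤ ∫ σ in τ..s, G σ :=
      intervalIntegral.norm_integral_le_of_norm_le hτs (ae_of_all _ fun σ _ => hle σ)
        (hG.intervalIntegrable _ _)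
    have h4 : ∫ σ in τ..s, G σ ≤ J :=
      intervalIntegral.integral_mono_interval le_rfl hτs hs.2 (ae_of_all _ hG0)
        (hG.intervalIntegrable _ _)
    rw [h2, Real.norm_eq_abs, abs_sub_comm] at h3
    have := abs_sub_abs_le_abs_sub (φ τ) (φ s)
    linarith
  have h5 : ∫ _s in (1 / 4 : ℝ)..(1 / 2), |φ τ| ≤ ∫ s in (1 / 4 : ℝ)..(1 / 2), (|φ s| + J) :=
    intervalIntegral.integral_mono_on (by norm_num) (continuous_const.intervalIntegrable _ _)
      ((hcφ.abs.add continuous_const).intervalIntegrable _ _) h1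
  have h6 : ∫ s in (1 / 4 : ℝ)..(1 / 2), |φ s| ≤ ∫ s in τ..(1 / 2), |φ s| :=
    intervalIntegral.integral_mono_interval hτ (by norm_num) le_rfl
      (ae_of_all _ fun _ => abs_nonneg _) (hcφ.abs.intervalIntegrable _ _)
  rw [intervalIntegral.integral_add (hcφ.abs.intervalIntegrable _ _)
    (continuous_const.intervalIntegrable _ _)] at h5
  simp only [intervalIntegral.integral_const, smul_eq_mul] at h5
  rw [intervalIntegral.integral_add ((hcφ.abs.const_mul 4).intervalIntegrable _ _)
    (hG.intervalIntegrable _ _), intervalIntegral.integral_const_mul]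
  linarith

theorem enorm_fan_le {f : Plane → ℝ} (hf : ContDiff ℝ (⊤ : ℕ∞) f) {c A D : Plane} {t τ h : ℝ}
    (hτ : τ ≤ 1 / 4) (hh : ‖c - (A + t • D)‖ ≤ h) :
    ‖f (fan c A D t τ)‖ₑ ≤ ∫⁻ σ in Icc τ (1 / 2), (4 * ‖f (fan c A D t σ)‖ₑ +
      ENNReal.ofReal h * (‖partialD 0 f (fan c A D t σ)‖ₑ +
        ‖partialD 1 f (fan c A D t σ)‖ₑ)) := by
  have hh0 : 0 ≤ h := (norm_nonneg _).trans hh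
  set v := c - (A + t • D) with hv
  have hfanc : Continuous fun σ => fan c A D t σ := by
    unfold fan
    fun_prop
  let G : ℝ → ℝ := fun σ =>
    h * (|partialD 0 f (fan c A D t σ)| + |partialD 1 f (fan c A D t σ)|)
  have hc0 := (contDiff_partialD hf 0).continuous.comp hfanc
  have hc1 := (contDiff_partialD hf 1).continuous.comp hfanc
  have hG : Continuous G := continuous_const.mul (hc0.abs.add hc1.abs)
  have hder : ∀ σ, HasDerivAt (fun σ => f (fan c A D t σ))
      (fderiv ℝ f (fan c A D t σ) v) σ := by
    intro σ
    have h1 : HasDerivAt (fun σ => fan c A D t σ) v σ := by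
      simp only [fan_eq, ← hv]
      simpa using ((hasDerivAt_id σ).smul_const v).const_add (A + t • D)
    exact (differentiable_of_smooth hf _).hasFDerivAt.comp_hasDerivAt σ h1
  have hle : ∀ σ, |fderiv ℝ f (fan c A D t σ) v| ≤ G σ := by
    intro σ
    rw [fderiv_eq_partialD]
    refine (abs_add_le _ _).trans ?_
    rw [abs_mul, abs_mul]
    simp only [G, mul_add]
    have h0 := (abs_coord_le v 0).trans hh
    have h1 := (abs_coord_le v 1).trans hh
    gcongr
  have hcd : Continuous fun σ => fderiv ℝ f (fan c A D t σ) v := by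
    simp only [fderiv_eq_partialD]
    exact (continuous_const.mul hc0).add (continuous_const.mul hc1)
  have key := abs_le_integral_of_deriv hder hcd hG hle hτ
  have hfc := hf.continuous.comp hfanc
  have hi : Continuous fun σ => 4 * |f (fan c A D t σ)| + G σ := (hfc.abs.const_mul 4).add hG
  rw [intervalIntegral.integral_of_le (by linarith), ← integral_Icc_eq_integral_Ioc] at key
  rw [← ofReal_norm, Real.norm_eq_abs]
  refine (ENNReal.ofReal_le_ofReal key).trans_eq ?_
  rw [ofReal_integral_eq_lintegral_ofReal hi.continuousOn.integrableOn_Icc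
    (ae_of_all _ fun σ => by positivity)]
  refine lintegral_congr fun σ => ?_
  rw [ENNReal.ofReal_add (by positivity) (by positivity), ENNReal.ofReal_mul (by norm_num),
    ENNReal.ofReal_mul hh0, ENNReal.ofReal_add (by positivity) (by positivity)]
  simp only [← Real.norm_eq_abs, ofReal_norm]
  norm_num

theorem lintegral_le_of_tendsto_of_le {α : Type*} [MeasurableSpace α] {μ : Measure α}
    {f : ℕ → α → ℝ≥0∞} {g : α → ℝ≥0∞} {B : ℝ≥0∞} (hf : ∀ n, AEMeasurable (f n) μ)
    (hlim : ∀ᵐ x ∂μ, Tendsto (fun n => f n x) atTop (𝓝 (g x)))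
    (hB : ∀ᶠ n in atTop, ∫⁻ x, f n x ∂μ ≤ B) : ∫⁻ x, g x ∂μ ≤ B := by
  calc ∫⁻ x, g x ∂μ = ∫⁻ x, liminf (fun n => f n x) atTop ∂μ :=
        lintegral_congr_ae (hlim.mono fun x hx => hx.liminf_eq.symm)
    _ ≤ liminf (fun n => ∫⁻ x, f n x ∂μ) atTop := lintegral_liminf_le' hf
    _ ≤ liminf (fun _ => B) (atTop : Filter ℕ) := liminf_le_liminf hB
    _ = B := by simp

theorem lintegral_trace_le {ω : Set Plane} (hω : IsOpen ω) {c A D : Plane} {κ h : ℝ} (hκ : 0 < κ)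
    (hcross : κ ≤ |D 1 * (A - c) 0 - D 0 * (A - c) 1|) {S : Set ℝ} (hS : IsCompact S)
    (hfan : ∀ t ∈ S, ∀ σ ∈ Ioc (0 : ℝ) (1 / 2), fan c A D t σ ∈ ω)
    (hh : ∀ t ∈ S, ‖c - (A + t • D)‖ ≤ h) {w g₀ g₁ : Plane → ℝ}
    (hw : ContinuousOn w (closure ω)) (hwi : IntegrableOn w ω)
    (h₀ : HasWeakDeriv ω (1, 0) w g₀) (h₀i : IntegrableOn g₀ ω)
    (h₁ : HasWeakDeriv ω (0, 1) w g₁) (h₁i : IntegrableOn g₁ ω) :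
    ∫⁻ t in S, ‖w (A + t • D)‖ₑ ≤ ENNReal.ofReal (2 / κ) * (4 * (∫⁻ x in ω, ‖w x‖ₑ) +
      ENNReal.ofReal h * ((∫⁻ x in ω, ‖g₀ x‖ₑ) + ∫⁻ x in ω, ‖g₁ x‖ₑ)) := by
  have hωm := hω.measurableSet
  set B := ENNReal.ofReal (2 / κ) * (4 * (∫⁻ x in ω, ‖w x‖ₑ) +
      ENNReal.ofReal h * ((∫⁻ x in ω, ‖g₀ x‖ₑ) + ∫⁻ x in ω, ‖g₁ x‖ₑ)) with hB
  have hfant : ∀ τ, Continuous fun t => fan c A D t τ := fun τ => by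
    unfold fan
    fun_prop
  have hwl := (hwi.integrable_indicator hωm)
  let f : ℕ → Plane → ℝ := fun m => mollify m (ω.indicator w)
  have hf : ∀ m, ContDiff ℝ (⊤ : ℕ∞) (f m) := fun m => contDiff_mollify m hwl.locallyIntegrable
  have hmol : ∀ {g : Plane → ℝ} (m : ℕ) (Φ : Set Plane), IntegrableOn g ω →
      ∫⁻ x in Φ, ‖mollify m (ω.indicator g) x‖ₑ ≤ ∫⁻ x in ω, ‖g x‖ₑ := by
    intro g m Φ hg
    refine (setLIntegral_le_lintegral _ _).trans ((lintegral_mollify_le m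
      (hg.integrable_indicator hωm)).trans_eq ?_)
    rw [← lintegral_indicator hωm]
    refine lintegral_congr fun x => ?_
    by_cases hx : x ∈ ω <;> simp [hx]
  have step1 : ∀ τ ∈ Ioc (0 : ℝ) (1 / 4), ∫⁻ t in S, ‖w (fan c A D t τ)‖ₑ ≤ B := by
    intro τ hτ
    set Φ := (fun p : ℝ × ℝ => fan c A D p.1 p.2) '' (S ×ˢ Icc τ (1 / 2)) with hΦ
    have hΦc : IsCompact Φ := (hS.prod isCompact_Icc).image (continuous_fan c A D)
    have hΦω : Φ ⊆ ω := by
      rintro _ ⟨p, hp, rfl⟩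
      exact hfan _ hp.1 _ ⟨hτ.1.trans_le hp.2.1, hp.2.2⟩
    refine lintegral_le_of_tendsto_of_le (f := fun m t => ‖f m (fan c A D t τ)‖ₑ)
      (fun m => ((hf m).continuous.comp (hfant τ)).enorm.aemeasurable) ?_ ?_
    · rw [ae_restrict_iff' hS.measurableSet]
      refine ae_of_all _ fun t ht => ?_
      have hmem : fan c A D t τ ∈ ω := hfan t ht τ ⟨hτ.1, by linarith [hτ.2]⟩
      have hca : ContinuousAt (ω.indicator w) (fan c A D t τ) := by
        refine ((hw.continuousAt (mem_of_superset (hω.mem_nhds hmem) subset_closure))).congr ?_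
        filter_upwards [hω.mem_nhds hmem] with x hx
        rw [indicator_of_mem hx]
      have := (tendstoUniformlyOn_mollify hwl.locallyIntegrable isCompact_singleton
        (fun x hx => by rwa [mem_singleton_iff.1 hx])).tendsto_at
          (mem_singleton (fan c A D t τ))
      rw [indicator_of_mem hmem] at this
      exact this.enorm
    · filter_upwards [eventually_closedBall_subset hω hΦc hΦω] with m hm
      have e0 : ∀ x ∈ Φ, partialD 0 (f m) x = mollify m (ω.indicator g₀) x := fun x hx =>
        multiD_mollify hωm hwi h₀ (hm x hx)
      have e1 : ∀ x ∈ Φ, partialD 1 (f m) x = mollify m (ω.indicator g₁) x := fun x hx =>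
        multiD_mollify hωm hwi h₁ (hm x hx)
      have c0 : Continuous (partialD 0 (f m)) := (contDiff_partialD (hf m) 0).continuous
      have c1 : Continuous (partialD 1 (f m)) := (contDiff_partialD (hf m) 1).continuous
      have hc01 : Measurable fun x => ‖partialD 0 (f m) x‖ₑ + ‖partialD 1 (f m) x‖ₑ :=
        c0.enorm.measurable.add c1.enorm.measurable
      have d0 : ∫⁻ x in Φ, ‖partialD 0 (f m) x‖ₑ = ∫⁻ x in Φ, ‖mollify m (ω.indicator g₀) x‖ₑ :=
        setLIntegral_congr_fun hΦc.measurableSet fun x hx => by simp only [e0 x hx]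
      have d1 : ∫⁻ x in Φ, ‖partialD 1 (f m) x‖ₑ = ∫⁻ x in Φ, ‖mollify m (ω.indicator g₁) x‖ₑ :=
        setLIntegral_congr_fun hΦc.measurableSet fun x hx => by simp only [e1 x hx]
      calc ∫⁻ t in S, ‖f m (fan c A D t τ)‖ₑ
          ≤ ∫⁻ t in S, ∫⁻ σ in Icc τ (1 / 2), (fun x => 4 * ‖f m x‖ₑ + ENNReal.ofReal h *
              (‖partialD 0 (f m) x‖ₑ + ‖partialD 1 (f m) x‖ₑ)) (fan c A D t σ) :=
            setLIntegral_mono' hS.measurableSet fun t ht => enorm_fan_le (hf m) hτ.2 (hh t ht)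
        _ ≤ ENNReal.ofReal (2 / κ) * ∫⁻ x in Φ, (4 * ‖f m x‖ₑ + ENNReal.ofReal h *
              (‖partialD 0 (f m) x‖ₑ + ‖partialD 1 (f m) x‖ₑ)) :=
            lintegral_fan_le hκ hcross hS.measurableSet measurableSet_Icc
              (fun σ hσ => hσ.2) (((hf m).continuous.enorm.measurable.const_mul 4).add
                (hc01.const_mul _))
        _ = ENNReal.ofReal (2 / κ) * (4 * (∫⁻ x in Φ, ‖f m x‖ₑ) + ENNReal.ofReal h *
              ((∫⁻ x in Φ, ‖mollify m (ω.indicator g₀) x‖ₑ) +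
                ∫⁻ x in Φ, ‖mollify m (ω.indicator g₁) x‖ₑ)) := by
            rw [lintegral_add_left ((hf m).continuous.enorm.measurable.const_mul 4),
              lintegral_const_mul _ (hf m).continuous.enorm.measurable,
              lintegral_const_mul _ hc01,
              lintegral_add_left c0.enorm.measurable,
              d0, d1]
        _ ≤ B := by
            rw [hB]
            have b1 := hmol m Φ hwi
            have b2 := add_le_add (hmol m Φ h₀i) (hmol m Φ h₁i)
            exact mul_le_mul_right (add_le_add (mul_le_mul_right b1 _)
              (mul_le_mul_right b2 _)) _
  have hτn : ∀ n : ℕ, (1 / ((n : ℝ) + 4)) ∈ Ioc (0 : ℝ) (1 / 4) := fun n =>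
    ⟨by positivity, one_div_le_one_div_of_le (by norm_num) (by linarith [n.cast_nonneg (α := ℝ)])⟩
  refine lintegral_le_of_tendsto_of_le
    (f := fun n t => ‖w (fan c A D t (1 / ((n : ℝ) + 4)))‖ₑ) (fun n => ?_) ?_
    (Eventually.of_forall fun n => step1 _ (hτn n))
  · have : ContinuousOn (fun t => w (fan c A D t (1 / ((n : ℝ) + 4)))) S :=
      hw.comp (hfant _).continuousOn fun t ht => subset_closure
        (hfan t ht _ ⟨(hτn n).1, by linarith [(hτn n).2]⟩)
    exact (this.aemeasurable hS.measurableSet).enorm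
  · rw [ae_restrict_iff' hS.measurableSet]
    refine ae_of_all _ fun t ht => ?_
    have hlim : Tendsto (fun n : ℕ => fan c A D t (1 / ((n : ℝ) + 4))) atTop (𝓝 (A + t • D)) := by
      have h1 : Tendsto (fun n : ℕ => 1 / ((n : ℝ) + 4)) atTop (𝓝 0) := by
        refine tendsto_const_nhds.div_atTop ?_
        exact tendsto_atTop_add_const_right _ _ tendsto_natCast_atTop_atTop
      have h2 : Continuous fun σ => fan c A D t σ := by
        unfold fan
        fun_prop
      have h3 := (h2.tendsto 0).comp h1
      rw [fan_eq, zero_smul, add_zero] at h3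
      exact h3
    have hmem : ∀ n : ℕ, fan c A D t (1 / ((n : ℝ) + 4)) ∈ ω := fun n =>
      hfan t ht _ ⟨(hτn n).1, by linarith [(hτn n).2]⟩
    have hcl : A + t • D ∈ closure ω :=
      mem_closure_of_tendsto hlim (Eventually.of_forall hmem)
    exact ((hw _ hcl).tendsto.comp (tendsto_nhdsWithin_iff.2
      ⟨hlim, Eventually.of_forall fun n => subset_closure (hmem n)⟩)).enorm

end IsoVEM

open Filter Metric
open scoped Topology

namespace IsoVEM

/-! ### Bound on the boundary of an element -/

theorem le_abs_cross_of_line_disjoint_ball {A D c : Plane} {ρ : ℝ} (hρ : 0 ≤ ρ) (hD : D ≠ 0)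
    (h : ∀ t : ℝ, A + t • D ∉ ball c ρ) :
    ρ * ‖D‖ ≤ |D 1 * (A - c) 0 - D 0 * (A - c) 1| := by
  have hD2 : 0 < ‖D‖ ^ 2 := by positivity
  have hn : ∀ v : Plane, ‖v‖ ^ 2 = v 0 ^ 2 + v 1 ^ 2 := fun v => by
    rw [EuclideanSpace.norm_sq_eq, Fin.sum_univ_two, Real.norm_eq_abs, Real.norm_eq_abs, sq_abs,
      sq_abs]
  set t : ℝ := -(D 0 * (A - c) 0 + D 1 * (A - c) 1) / ‖D‖ ^ 2 with ht
  have h1 := h t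
  rw [mem_ball, not_lt, dist_eq_norm] at h1
  have h2 : ρ ^ 2 ≤ ‖A + t • D - c‖ ^ 2 := by gcongr
  have h3 : ‖A + t • D - c‖ ^ 2 * ‖D‖ ^ 2 = (D 1 * (A - c) 0 - D 0 * (A - c) 1) ^ 2 := by
    have e0 : t * ‖D‖ ^ 2 = -(D 0 * (A - c) 0 + D 1 * (A - c) 1) := by
      rw [ht]; field_simp
    have e1 : (A + t • D - c) 0 = (A - c) 0 + t * D 0 := by simp; ring
    have e2 : (A + t • D - c) 1 = (A - c) 1 + t * D 1 := by simp; ring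
    rw [hn, e1, e2]
    rw [hn D] at e0 ⊢
    linear_combination ((D 0 * (A - c) 0 + D 1 * (A - c) 1) + t * (D 0 ^ 2 + D 1 ^ 2)) * e0
  refine (pow_le_pow_iff_left₀ (by positivity) (abs_nonneg _) two_ne_zero).1 ?_
  rw [sq_abs, ← h3, mul_pow]
  gcongr

namespace PolygonalElement

theorem edgePath_eq (E : PolygonalElement) (i : Fin E.numEdges) (t : ℝ) :
    E.poly.edgePath ℝ i t = E.poly i + t • (E.poly (finRotate _ i) - E.poly i) := by
  change AffineMap.lineMap (E.poly i) (E.poly (finRotate _ i)) t = _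
  rw [AffineMap.lineMap_apply, vsub_eq_sub, vadd_eq_add, add_comm]

theorem edgePath_mem_frontier (E : PolygonalElement) (i : Fin E.numEdges) {t : ℝ}
    (ht : t ∈ Icc (0 : ℝ) 1) : E.poly.edgePath ℝ i t ∈ frontier E.carrier := by
  rw [E.frontier_eq]
  exact mem_iUnion.2 ⟨i, t, ht, rfl⟩

theorem exists_edgePath_eq (E : PolygonalElement) {x : Plane} (hx : x ∈ frontier E.carrier) :
    ∃ i, ∃ t ∈ Icc (0 : ℝ) 1, E.poly.edgePath ℝ i t = x := by
  rw [E.frontier_eq] at hx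
  obtain ⟨i, t, ht, h⟩ := mem_iUnion.1 hx
  exact ⟨i, t, ht, h⟩

theorem dist_le_diam_of_mem_closure (E : PolygonalElement) {x y : Plane}
    (hx : x ∈ closure E.carrier) (hy : y ∈ closure E.carrier) : dist x y ≤ E.diam := by
  have := dist_le_diam_of_mem E.isBounded.closure hx hy
  rwa [Metric.diam_closure] at this

end PolygonalElement

/-- A large part of each edge is visible from a single ball inside the element. -/
theorem exists_visible_part {a : ℝ} (ha : 0 < a) {N : ℕ} (hN : 0 < N) {E : PolygonalElement}
    {K : Fin N → Set Plane} {c : Fin N → Plane} (hcov : E.carrier = ⋃ p, K p)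
    (hK : ∀ p, StarPiece (K p) (c p) (a * E.diam / 2))
    (i : Fin E.numEdges) (hlen : a * E.diam < E.toCurved.edgeLength i) :
    ∃ p, ∃ S ⊆ Icc (0 : ℝ) 1, IsCompact S ∧ 1 / (N : ℝ) ≤ volume.real S ∧
      (∀ t ∈ S, E.poly.edgePath ℝ i t ∈ closure (K p)) ∧
      a ^ 2 * E.diam ^ 2 / 2 ≤ |(E.poly (finRotate _ i) - E.poly i) 1 * (E.poly i - c p) 0 -
        (E.poly (finRotate _ i) - E.poly i) 0 * (E.poly i - c p) 1| := by
  have hd := E.diam_pos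
  have hρ : 0 < a * E.diam / 2 := by positivity
  set A := E.poly i with hA
  set D := E.poly (finRotate _ i) - A with hD
  have hγ : ∀ t : ℝ, E.poly.edgePath ℝ i t = A + t • D := E.edgePath_eq i
  have hγc : Continuous fun t : ℝ => A + t • D := by fun_prop
  let S : Fin N → Set ℝ := fun p => Icc 0 1 ∩ (fun t : ℝ => A + t • D) ⁻¹' closure (K p)
  have hSc : ∀ p, IsCompact (S p) := fun p =>
    isCompact_Icc.inter_right (isClosed_closure.preimage hγc)
  have hcover : Icc (0 : ℝ) 1 ⊆ ⋃ p, S p := by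
    intro t ht
    have h1 := frontier_subset_closure (E.edgePath_mem_frontier i ht)
    rw [hcov, closure_iUnion_of_finite, hγ] at h1
    obtain ⟨p, hp⟩ := mem_iUnion.1 h1
    exact mem_iUnion.2 ⟨p, ht, hp⟩
  have hbig : ∃ p, 1 / (N : ℝ) ≤ volume.real (S p) := by
    by_contra! hlt
    have h1 : volume.real (Icc (0 : ℝ) 1) ≤ ∑ p, volume.real (S p) := by
      refine (measureReal_mono hcover ?_).trans (measureReal_iUnion_fintype_le _)
      exact ((measure_iUnion_le _).trans_lt (by
        rw [tsum_fintype]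
        exact ENNReal.sum_lt_top.2 fun p _ => (hSc p).measure_lt_top)).ne
    have : Nonempty (Fin N) := ⟨⟨0, hN⟩⟩
    have h2 : ∑ p, volume.real (S p) < ∑ _p : Fin N, 1 / (N : ℝ) :=
      Finset.sum_lt_sum_of_nonempty Finset.univ_nonempty fun p _ => hlt p
    have hN' : (N : ℝ) ≠ 0 := by positivity
    simp [hN'] at h1 h2
    linarith
  obtain ⟨p, hp⟩ := hbig
  refine ⟨p, S p, inter_subset_left, hSc p, hp, fun t ht => by rw [hγ]; exact ht.2, ?_⟩
  have hKsub : K p ⊆ E.carrier := by rw [hcov]; exact subset_iUnion K p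
  have hfr : ∀ t ∈ Icc (0 : ℝ) 1, A + t • D ∉ E.carrier := fun t ht hmem => by
    have h1 := E.edgePath_mem_frontier i ht
    rw [hγ, E.isOpen.frontier_eq] at h1
    exact h1.2 hmem
  have hnD : a * E.diam < ‖D‖ := by
    rwa [E.edgeLength_eq, dist_comm, dist_eq_norm] at hlen
  have hD0 : D ≠ 0 := norm_pos_iff.1 (lt_trans (by positivity) hnD)
  have hmiss : ∀ t : ℝ, A + t • D ∉ ball (c p) (a * E.diam / 2) := by
    intro t₀ ht₀
    have hsub : S p ⊆ {0, 1} := by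
      rintro t ⟨ht, htK⟩
      by_contra hne
      simp only [mem_insert_iff, mem_singleton_iff, not_or] at hne
      have ht' : t ∈ Ioo (0 : ℝ) 1 :=
        ⟨lt_of_le_of_ne ht.1 (Ne.symm hne.1), lt_of_le_of_ne ht.2 hne.2⟩
      have hcont : Tendsto (fun τ : ℝ => t + τ * (t₀ - t)) (𝓝[>] 0) (𝓝 t) := by
        have : Continuous fun τ : ℝ => t + τ * (t₀ - t) := by fun_prop
        simpa using (this.tendsto 0).mono_left nhdsWithin_le_nhds
      have hτ1 : ∀ᶠ τ : ℝ in 𝓝[>] 0, τ ≤ 1 :=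
        nhdsWithin_le_nhds (Iic_mem_nhds one_pos)
      obtain ⟨τ, h1, h2, h3⟩ := ((hcont.eventually_mem (Ioo_mem_nhds ht'.1 ht'.2)).and
        (hτ1.and self_mem_nhdsWithin)).exists
      refine hfr _ ⟨h1.1.le, h1.2.le⟩ (hKsub ?_)
      have h4 := (hK p).lineMap_mem htK ht₀ h3 h2
      have h5 : A + t • D + τ • (A + t₀ • D - (A + t • D)) = A + (t + τ * (t₀ - t)) • D := by
        module
      rwa [h5] at h4
    have h0 : volume.real (S p) = 0 := by
      rw [measureReal_def, measure_mono_null hsub ((Set.toFinite _).measure_zero _)]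
      rfl
    rw [h0] at hp
    have : 0 < 1 / (N : ℝ) := by positivity
    linarith
  have := le_abs_cross_of_line_disjoint_ball hρ.le hD0 hmiss
  calc a ^ 2 * E.diam ^ 2 / 2 = a * E.diam / 2 * (a * E.diam) := by ring
    _ ≤ a * E.diam / 2 * ‖D‖ := by gcongr
    _ ≤ _ := this

/-- A function which is a polynomial on each edge is controlled on the boundary by its `W^{1,1}`
norm. -/
theorem exists_frontier_sup_bound (l : ℕ) {a : ℝ} (ha : 0 < a) : ∃ C > 0, ∀ E : PolygonalElement,
    E.ShapeRegular a → ∀ w g₀ g₁ : Plane → ℝ, ContinuousOn w (closure E.carrier) →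
    IntegrableOn w E.carrier → HasWeakDeriv E.carrier (1, 0) w g₀ → IntegrableOn g₀ E.carrier →
    HasWeakDeriv E.carrier (0, 1) w g₁ → IntegrableOn g₁ E.carrier →
    (∀ i, ∃ q : Polynomial ℝ, q.natDegree ≤ l ∧
      ∀ t ∈ Icc (0 : ℝ) 1, w (E.poly.edgePath ℝ i t) = q.eval t) →
    ∀ x ∈ frontier E.carrier, |w x| * E.diam ^ 2 ≤ C * ((∫ y in E.carrier, |w y|) +
      E.diam * ((∫ y in E.carrier, |g₀ y|) + ∫ y in E.carrier, |g₁ y|)) := by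
  obtain ⟨N, hN, hpieces⟩ := exists_starPieces ha
  obtain ⟨C, hC, hpoly⟩ := exists_poly_subset_bound l (show (0 : ℝ) < 1 / N by positivity)
  refine ⟨C * (16 / a ^ 2), by positivity, ?_⟩
  intro E hE w g₀ g₁ hw hwi h₀ h₀i h₁ h₁i hedge x hx
  have hd := E.diam_pos
  obtain ⟨K, c, hcov, hK⟩ := hpieces E hE
  obtain ⟨i, t, ht, rfl⟩ := E.exists_edgePath_eq hx
  obtain ⟨q, hq, hwq⟩ := hedge i
  obtain ⟨p, S, hS, hSc, hvol, hSK, hcross⟩ := exists_visible_part ha hN hcov hK i (hE.2 i)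
  have hKsub : K p ⊆ E.carrier := by rw [hcov]; exact subset_iUnion K p
  have hcp : c p ∈ ball (c p) (a * E.diam / 2) := mem_ball_self (by positivity)
  have htrace := lintegral_trace_le (ω := E.carrier) E.isOpen (c := c p) (A := E.poly i)
    (D := E.poly (finRotate _ i) - E.poly i) (κ := a ^ 2 * E.diam ^ 2 / 2) (h := E.diam)
    (by positivity) hcross hSc (fun t ht σ hσ => by
      have h1 := hSK t ht
      rw [E.edgePath_eq] at h1
      rw [fan_eq]
      exact hKsub ((hK p).lineMap_mem h1 hcp hσ.1 (hσ.2.trans (by norm_num))))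
    (fun t ht => by
      rw [← dist_eq_norm]
      refine E.dist_le_diam_of_mem_closure
        (subset_closure (hKsub ((hK p).ball_subset hcp))) ?_
      have := closure_mono hKsub (hSK t ht)
      rwa [E.edgePath_eq] at this) hw hwi h₀ h₀i h₁ h₁i
  have key : ∀ {f : Plane → ℝ}, IntegrableOn f E.carrier →
      ∫⁻ x in E.carrier, ‖f x‖ₑ = ENNReal.ofReal (∫ x in E.carrier, |f x|) := fun hf =>
    (ofReal_integral_norm_eq_lintegral_enorm hf).symm
  rw [key hwi, key h₀i, key h₁i] at htrace
  have n₀ : 0 ≤ ∫ x in E.carrier, |g₀ x| := integral_nonneg fun _ => abs_nonneg _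
  have n₁ : 0 ≤ ∫ x in E.carrier, |g₁ x| := integral_nonneg fun _ => abs_nonneg _
  have nw : 0 ≤ ∫ x in E.carrier, |w x| := integral_nonneg fun _ => abs_nonneg _
  have hqi : IntegrableOn (fun t => q.eval t) S :=
    q.continuous.continuousOn.integrableOn_compact hSc
  have hL : ∫⁻ t in S, ‖w (E.poly i + t • (E.poly (finRotate _ i) - E.poly i))‖ₑ =
      ENNReal.ofReal (∫ t in S, |q.eval t|) := by
    refine Eq.trans ?_ (ofReal_integral_norm_eq_lintegral_enorm hqi).symm
    refine setLIntegral_congr_fun hSc.measurableSet fun t ht => ?_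
    simp only [← E.edgePath_eq, hwq t (hS ht)]
  rw [hL, show (4 : ℝ≥0∞) = ENNReal.ofReal 4 by simp, ← ENNReal.ofReal_add n₀ n₁,
    ← ENNReal.ofReal_mul hd.le, ← ENNReal.ofReal_mul (by norm_num),
    ← ENNReal.ofReal_add (by positivity) (by positivity), ← ENNReal.ofReal_mul (by positivity),
    ENNReal.ofReal_le_ofReal_iff (by positivity)] at htrace
  have h1 := hpoly q hq S hS hSc.measurableSet hvol t ht
  rw [hwq t ht]
  calc |q.eval t| * E.diam ^ 2 ≤ (C * ∫ t in S, |q.eval t|) * E.diam ^ 2 := by gcongr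
    _ ≤ (C * (2 / (a ^ 2 * E.diam ^ 2 / 2) * (4 * (∫ x in E.carrier, |w x|) + E.diam *
          ((∫ x in E.carrier, |g₀ x|) + ∫ x in E.carrier, |g₁ x|)))) * E.diam ^ 2 := by gcongr
    _ = C * (4 / a ^ 2) * (4 * (∫ x in E.carrier, |w x|) + E.diam *
          ((∫ x in E.carrier, |g₀ x|) + ∫ x in E.carrier, |g₁ x|)) := by
        field_simp
        ring
    _ ≤ C * (4 / a ^ 2) * (4 * (∫ x in E.carrier, |w x|) + 4 * (E.diam *
          ((∫ x in E.carrier, |g₀ x|) + ∫ x in E.carrier, |g₁ x|))) := by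
        refine mul_le_mul_of_nonneg_left ?_ (by positivity)
        have : 0 ≤ E.diam * ((∫ x in E.carrier, |g₀ x|) + ∫ x in E.carrier, |g₁ x|) := by
          positivity
        linarith
    _ = _ := by ring

/-! ### Functions with a polynomial Laplacian -/

/-- The Laplacian of a smooth function. -/
noncomputable def laplacian (φ : Plane → ℝ) : Plane → ℝ :=
  fun x => multiD (2, 0) φ x + multiD (0, 2) φ x

theorem laplacian_eq (φ : Plane → ℝ) (x : Plane) :
    laplacian φ x = partialD 0 (partialD 0 φ) x + partialD 1 (partialD 1 φ) x := rfl

/-- The distributional Laplacian of `w` on `ω` is the function `f`. -/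
def HasWeakLaplacian (ω : Set Plane) (w f : Plane → ℝ) : Prop :=
  ∀ φ, IsTest ω φ → ∫ x in ω, w x * laplacian φ x = ∫ x in ω, f x * φ x

theorem contDiff_laplacian {φ : Plane → ℝ} (h : ContDiff ℝ (⊤ : ℕ∞) φ) :
    ContDiff ℝ (⊤ : ℕ∞) (laplacian φ) :=
  (contDiff_multiD h _).add (contDiff_multiD h _)

theorem partialD_comp_scale {f : Plane → ℝ} (hf : ContDiff ℝ (⊤ : ℕ∞) f) (i : Fin 2) (s : ℝ)
    (c x : Plane) :
    partialD i (fun x => f (s • (x - c))) x = s * partialD i f (s • (x - c)) := by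
  unfold partialD
  have h1 : HasFDerivAt (fun x : Plane => s • (x - c)) (s • ContinuousLinearMap.id ℝ Plane) x :=
    ((hasFDerivAt_id x).sub_const c).const_smul s
  have h2 := (differentiable_of_smooth hf (s • (x - c))).hasFDerivAt.comp x h1
  have h3 : fderiv ℝ (fun x => f (s • (x - c))) x = _ := h2.fderiv
  rw [h3]
  simp

theorem laplacian_comp_scale {f : Plane → ℝ} (hf : ContDiff ℝ (⊤ : ℕ∞) f) (s : ℝ) (c x : Plane) :
    laplacian (fun x => f (s • (x - c))) x = s ^ 2 * laplacian f (s • (x - c)) := by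
  have h : ∀ i, partialD i (partialD i fun x => f (s • (x - c))) x =
      s ^ 2 * partialD i (partialD i f) (s • (x - c)) := fun i => by
    have h1 : partialD i (fun x => f (s • (x - c))) = fun x => s * partialD i f (s • (x - c)) :=
      funext fun x => partialD_comp_scale hf i s c x
    have hs : ContDiff ℝ (⊤ : ℕ∞) fun y => s * partialD i f y :=
      contDiff_const.mul (contDiff_partialD hf i)
    rw [h1, partialD_comp_scale hs]
    rw [show (fun y => s * partialD i f y) = fun y => s * (partialD i f) y from rfl,
      partialD_const_mul (differentiable_of_smooth (contDiff_partialD hf i))]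
    ring
  rw [laplacian_eq, h, h, ← mul_add, laplacian_eq]

theorem exists_bump : ∃ b : Plane → ℝ, ContDiff ℝ (⊤ : ℕ∞) b ∧ (∀ x, 0 ≤ b x) ∧
    (∀ x ∈ closedBall (0 : Plane) 1, b x = 1) ∧ ∀ x, x ∉ ball (0 : Plane) (3 / 2) → b x = 0 := by
  let f : ContDiffBump (0 : Plane) := ⟨1, 3 / 2, one_pos, by norm_num⟩
  refine ⟨f, f.contDiff, fun x => f.nonneg, fun x hx => f.one_of_mem_closedBall hx, fun x hx => ?_⟩
  have := f.support_eq
  by_contra h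
  have h1 : x ∈ Function.support f := h
  rw [this] at h1
  exact hx h1

theorem isTest_comp_scale {ω : Set Plane} {ψ : Plane → ℝ} (hψ : ContDiff ℝ (⊤ : ℕ∞) ψ)
    (h0 : ∀ x, x ∉ ball (0 : Plane) (3 / 2) → ψ x = 0) {c : Plane} {d : ℝ} (hd : 0 < d)
    (hsub : ball c (2 * d) ⊆ ω) : IsTest ω fun x => ψ (d⁻¹ • (x - c)) := by
  have hts : tsupport (fun x => ψ (d⁻¹ • (x - c))) ⊆ closedBall c (3 / 2 * d) := by
    refine closure_minimal (fun x hx => ?_) isClosed_closedBall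
    by_contra hne
    refine hx (h0 _ fun hmem => hne ?_)
    rw [mem_ball_zero_iff, norm_smul, norm_inv, Real.norm_of_nonneg hd.le, inv_mul_lt_iff₀ hd]
      at hmem
    rw [mem_closedBall, dist_eq_norm]
    linarith
  refine ⟨hψ.comp (by fun_prop), ?_, hts.trans (Subset.trans ?_ hsub)⟩
  · exact (isCompact_closedBall c _).of_isClosed_subset (isClosed_tsupport _) hts
  · exact closedBall_subset_ball (by linarith)

/-- Inverse estimate for a polynomial distributional Laplacian. -/
theorem exists_weakLaplacian_bound (l : ℕ) {r : ℝ} (hr : 1 ≤ r) : ∃ C > 0, ∀ (ω : Set Plane)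
    (c : Plane) (d : ℝ), 0 < d → ball c (2 * d) ⊆ ω → ∀ (w : Plane → ℝ) (p : Poly),
    p.totalDegree ≤ l → IntegrableOn w ω → HasWeakLaplacian ω w (peval p) →
    ∀ x, dist x c ≤ r * d → |peval p x| * d ^ 4 ≤ C * ∫ y in ω, |w y| := by
  obtain ⟨κ, hκ, hcoef⟩ := exists_coef_bound l
  obtain ⟨b, hb, hb0, hb1, hbs⟩ := exists_bump
  let ψ : ℕ × ℕ → Plane → ℝ := fun β y => scaledMono 0 1 β y * b y
  have hψ : ∀ β, ContDiff ℝ (⊤ : ℕ∞) (ψ β) := fun β => (contDiff_scaledMono 0 1 β).mul hb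
  have hψ0 : ∀ β x, x ∉ ball (0 : Plane) (3 / 2) → ψ β x = 0 := fun β x hx => by
    simp only [ψ, hbs x hx, mul_zero]
  have hbd : ∀ β, ∃ M, ∀ x, |laplacian (ψ β) x| ≤ M := fun β => by
    have ht : IsTest univ fun x => ψ β ((1 : ℝ)⁻¹ • (x - 0)) :=
      isTest_comp_scale (hψ β) (hψ0 β) one_pos (subset_univ _)
    simp only [inv_one, one_smul, sub_zero] at ht
    have h2 : HasCompactSupport (laplacian (ψ β)) :=
      (ht.multiD (2, 0)).2.1.add (ht.multiD (0, 2)).2.1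
    exact (contDiff_laplacian (hψ β)).continuous.bounded_above_of_compact_support h2
  choose M hM using hbd
  set M₀ := ∑ β ∈ multiIdx l, M β with hM₀
  have hMn : ∀ β, 0 ≤ M β := fun β => (abs_nonneg _).trans (hM β 0)
  have hM₀n : 0 ≤ M₀ := Finset.sum_nonneg fun β _ => hMn β
  have hMle : ∀ β ∈ multiIdx l, M β ≤ M₀ := fun β hβ =>
    Finset.single_le_sum (fun β _ => hMn β) hβ
  refine ⟨r ^ l * ((multiIdx l).card * (M₀ + 1) / κ), ?_, ?_⟩
  · have : (0, 0) ∈ multiIdx l := by simp [mem_multiIdx]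
    have : 0 < ((multiIdx l).card : ℝ) := by exact_mod_cast Finset.card_pos.2 ⟨_, this⟩
    positivity
  intro ω c d hd hsub w p hp hw hlap x hx
  obtain ⟨a, ha⟩ := exists_peval_eq_monoSum hp c hd.ne'
  set W := ∫ y in ω, |w y| with hW
  have hW0 : 0 ≤ W := integral_nonneg fun _ => abs_nonneg _
  let φ : ℕ × ℕ → Plane → ℝ := fun β x => ψ β (d⁻¹ • (x - c))
  have hφ : ∀ β, IsTest ω (φ β) := fun β => isTest_comp_scale (hψ β) (hψ0 β) hd hsub
  set S := ∑ β ∈ multiIdx l, |a β| with hS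
  have hS0 : 0 ≤ S := Finset.sum_nonneg fun β _ => abs_nonneg _
  have h1 : ∀ β ∈ multiIdx l, |∫ y in ω, peval p y * φ β y| ≤ d⁻¹ ^ 2 * M₀ * W := by
    intro β hβ
    rw [← hlap _ (hφ β), ← Real.norm_eq_abs]
    refine (norm_integral_le_integral_norm _).trans ?_
    rw [hW, ← integral_const_mul]
    refine integral_mono_of_nonneg (ae_of_all _ fun _ => norm_nonneg _) (hw.norm.const_mul _)
      (ae_of_all _ fun y => ?_)
    simp only [φ, laplacian_comp_scale (hψ β), norm_mul, Real.norm_eq_abs]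
    rw [abs_of_nonneg (show 0 ≤ d⁻¹ ^ 2 by positivity), mul_comm]
    gcongr
    exact (hM β _).trans (hMle β hβ)
  have hpb : ∀ y, ∑ β ∈ multiIdx l, a β * (peval p y * φ β y) =
      peval p y ^ 2 * b (d⁻¹ • (y - c)) := fun y => by
    have : peval p y = ∑ β ∈ multiIdx l, a β * scaledMono 0 1 β (d⁻¹ • (y - c)) := by
      rw [ha]
      exact Finset.sum_congr rfl fun β _ => by rw [scaledMono_eq_unit c d]
    rw [sq, mul_assoc, show peval p y * b (d⁻¹ • (y - c)) =
      (∑ β ∈ multiIdx l, a β * scaledMono 0 1 β (d⁻¹ • (y - c))) * b (d⁻¹ • (y - c)) by rw [← this],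
      Finset.sum_mul, Finset.mul_sum]
    refine Finset.sum_congr rfl fun β _ => ?_
    simp only [φ, ψ]
    ring
  have hint : ∀ β, IntegrableOn (fun y => peval p y * φ β y) ω := fun β =>
    (integrable_mul_isTest (hφ β)
      ((peval_continuous p).locallyIntegrable.locallyIntegrableOn ω)).integrableOn
  have h2 : ∫ y in ball c d, peval p y ^ 2 ≤ ∫ y in ω, peval p y ^ 2 * b (d⁻¹ • (y - c)) := by
    have hi : IntegrableOn (fun y => peval p y ^ 2 * b (d⁻¹ • (y - c))) ω :=
      (integrable_finsetSum (multiIdx l) fun β _ => (hint β).const_mul (a β)).congr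
        (ae_of_all _ hpb)
    calc ∫ y in ball c d, peval p y ^ 2
        = ∫ y in ball c d, peval p y ^ 2 * b (d⁻¹ • (y - c)) := by
          refine setIntegral_congr_fun measurableSet_ball fun y hy => ?_
          rw [hb1, mul_one]
          rw [mem_closedBall_zero_iff, norm_smul, norm_inv, Real.norm_of_nonneg hd.le,
            inv_mul_le_iff₀ hd, mul_one, ← dist_eq_norm]
          exact (mem_ball.1 hy).le
      _ ≤ _ := setIntegral_mono_set hi (ae_of_all _ fun y => mul_nonneg (sq_nonneg _) (hb0 _))
          (((ball_subset_ball (by linarith)).trans hsub).eventuallyLE)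
  have h3 : ∫ y in ω, peval p y ^ 2 * b (d⁻¹ • (y - c)) ≤ S * (d⁻¹ ^ 2 * M₀ * W) := by
    simp only [← hpb]
    rw [integral_finsetSum _ fun β _ => (hint β).const_mul _, hS, Finset.sum_mul]
    refine Finset.sum_le_sum fun β hβ => ?_
    rw [integral_const_mul]
    calc _ ≤ |a β * ∫ y in ω, peval p y * φ β y| := le_abs_self _
      _ = |a β| * |∫ y in ω, peval p y * φ β y| := abs_mul _ _
      _ ≤ _ := mul_le_mul_of_nonneg_left (h1 β hβ) (abs_nonneg _)
  have h4 : κ * d ^ 2 * ∑ β ∈ multiIdx l, a β ^ 2 ≤ S * (d⁻¹ ^ 2 * M₀ * W) := by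
    refine (hcoef c d hd a).trans ?_
    simp only [← ha]
    exact h2.trans h3
  have h5 : S ^ 2 ≤ (multiIdx l).card * ∑ β ∈ multiIdx l, a β ^ 2 := by
    have := sq_sum_le_card_mul_sum_sq (s := multiIdx l) (f := fun β => |a β|)
    simpa only [sq_abs] using this
  have h6 : S * d ^ 4 ≤ (multiIdx l).card * (M₀ + 1) / κ * W := by
    rcases hS0.eq_or_lt with h | h
    · rw [← h, zero_mul]; positivity
    · have h7 : κ * d ^ 2 * S ^ 2 ≤ (multiIdx l).card * (S * (d⁻¹ ^ 2 * M₀ * W)) := by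
        calc κ * d ^ 2 * S ^ 2 ≤ κ * d ^ 2 * ((multiIdx l).card * ∑ β ∈ multiIdx l, a β ^ 2) := by
              gcongr
          _ = (multiIdx l).card * (κ * d ^ 2 * ∑ β ∈ multiIdx l, a β ^ 2) := by ring
          _ ≤ _ := by gcongr
      have h8 : κ * (S * d ^ 4) ≤ (multiIdx l).card * M₀ * W := by
        have e : (multiIdx l).card * (S * (d⁻¹ ^ 2 * M₀ * W)) * d ^ 2 =
            S * ((multiIdx l).card * M₀ * W) := by
          field_simp
        have h9 := mul_le_mul_of_nonneg_right h7 (sq_nonneg d)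
        rw [e] at h9
        refine le_of_mul_le_mul_left ?_ h
        linarith [h9]
      rw [div_mul_eq_mul_div, le_div_iff₀ hκ]
      have : 0 ≤ ((multiIdx l).card : ℝ) * W := by positivity
      linarith
  have h10 : |peval p x| ≤ r ^ l * S := by
    rw [ha, monoSum, hS, Finset.mul_sum]
    refine (Finset.abs_sum_le_sum_abs _ _).trans (Finset.sum_le_sum fun β hβ => ?_)
    rw [abs_mul, mul_comm]
    gcongr
    exact abs_scaledMono_le hd hr hx ((mem_multiIdx).1 hβ)
  calc |peval p x| * d ^ 4 ≤ r ^ l * S * d ^ 4 := by gcongr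
    _ = r ^ l * (S * d ^ 4) := by ring
    _ ≤ r ^ l * ((multiIdx l).card * (M₀ + 1) / κ * W) := by gcongr
    _ = _ := by ring

/-! ### The maximum principle -/

theorem deriv_deriv_nonpos_of_isLocalMax {g g' : ℝ → ℝ} {g'' t : ℝ}
    (hg : ∀ s, HasDerivAt g (g' s) s) (hg' : HasDerivAt g' g'' t) (h : IsLocalMax g t) :
    g'' ≤ 0 := by
  by_contra! hpos
  have hd : deriv g = g' := funext fun s => (hg s).deriv
  have h0 : deriv g t = 0 := h.deriv_eq_zero
  have hmin : IsLocalMin g t :=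
    isLocalMin_of_deriv_deriv_pos (by rw [hd, hg'.deriv]; exact hpos) h0 (hg t).continuousAt
  have hc : g =ᶠ[𝓝 t] fun _ => g t := by
    filter_upwards [h, hmin] with s h1 h2 using le_antisymm h1 h2
  have h1 : deriv g =ᶠ[𝓝 t] fun _ => 0 := by
    have := hc.deriv
    simpa using this
  have h2 : deriv (deriv g) t = 0 := by
    rw [h1.deriv_eq]
    simp
  rw [hd, hg'.deriv] at h2
  exact hpos.ne' h2

theorem laplacian_le_of_isLocalMax {f : Plane → ℝ} (hf : ContDiff ℝ (⊤ : ℕ∞) f) {κ : ℝ}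
    {x₀ z : Plane} (h : IsLocalMax (fun x => f x + κ * ‖x - x₀‖ ^ 2) z) :
    laplacian f z + 4 * κ ≤ 0 := by
  have key : ∀ i : Fin 2, partialD i (partialD i f) z + 2 * κ ≤ 0 := by
    intro i
    let e : Plane := EuclideanSpace.single i 1
    have hline : ∀ {f : Plane → ℝ}, ContDiff ℝ (⊤ : ℕ∞) f → ∀ t : ℝ,
        HasDerivAt (fun t : ℝ => f (z + t • e)) (partialD i f (z + t • e)) t := fun hf t => by
      have h1 : HasDerivAt (fun t : ℝ => z + t • e) e t := by
        simpa using ((hasDerivAt_id t).smul_const e).const_add z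
      exact (differentiable_of_smooth hf _).hasFDerivAt.comp_hasDerivAt t h1
    have hsq : ∀ t : ℝ, ‖z + t • e - x₀‖ ^ 2 =
        ‖z - x₀‖ ^ 2 + 2 * t * (z - x₀) i + t ^ 2 := fun t => by
      rw [show z + t • e - x₀ = (z - x₀) + t • e by abel, norm_add_sq_real, norm_smul,
        inner_smul_right]
      simp only [e, EuclideanSpace.inner_single_right, PiLp.norm_single]
      simp
      ring
    have hg : ∀ t : ℝ, HasDerivAt (fun t : ℝ => f (z + t • e) + κ * ‖z + t • e - x₀‖ ^ 2)
        (partialD i f (z + t • e) + κ * (2 * (z - x₀) i + 2 * t)) t := fun t => by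
      simp only [hsq]
      have h2 : HasDerivAt (fun t : ℝ => ‖z - x₀‖ ^ 2 + 2 * t * (z - x₀) i + t ^ 2)
          (2 * (z - x₀) i + 2 * t) t := by
        have h3 := (((hasDerivAt_id t).const_mul 2).mul_const ((z - x₀) i)).const_add
          (‖z - x₀‖ ^ 2)
        have h4 := h3.add (hasDerivAt_pow 2 t)
        refine (h4.congr_of_eventuallyEq (Eventually.of_forall fun _ => rfl)).congr_deriv ?_
        simp
      exact (hline hf t).add (h2.const_mul κ)
    have hg' : HasDerivAt (fun t : ℝ => partialD i f (z + t • e) + κ * (2 * (z - x₀) i + 2 * t))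
        (partialD i (partialD i f) (z + (0 : ℝ) • e) + κ * 2) 0 := by
      have h2 : HasDerivAt (fun t : ℝ => 2 * (z - x₀) i + 2 * t) 2 0 := by
        simpa using ((hasDerivAt_id (0 : ℝ)).const_mul 2).const_add (2 * (z - x₀) i)
      exact (hline (contDiff_partialD hf i) 0).add (h2.const_mul κ)
    have hmax : IsLocalMax (fun t : ℝ => f (z + t • e) + κ * ‖z + t • e - x₀‖ ^ 2) 0 := by
      have hc : ContinuousAt (fun t : ℝ => z + t • e) 0 := by fun_prop
      have h5 : IsLocalMax (fun x => f x + κ * ‖x - x₀‖ ^ 2) (z + (0 : ℝ) • e) := by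
        simpa using h
      exact hc.eventually h5
    have := deriv_deriv_nonpos_of_isLocalMax hg hg' hmax
    simp only [zero_smul, add_zero] at this
    linarith
  have h0 := key 0
  have h1 := key 1
  rw [laplacian_eq]
  linarith

theorem laplacian_mollify {ω : Set Plane} (hω : MeasurableSet ω) {w p : Plane → ℝ}
    (hw : IntegrableOn w ω) (hp : IntegrableOn p ω) (h : HasWeakLaplacian ω w p) {n : ℕ} {x : Plane}
    (hx : closedBall x (molBump n).rOut ⊆ ω) :
    laplacian (mollify n (ω.indicator w)) x = mollify n (ω.indicator p) x := by
  have ht := isTest_molBump_comp n hx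
  have hi : ∀ β : ℕ × ℕ, IntegrableOn (fun y => w y *
      multiD β (fun y => (molBump n).normed volume (x - y)) y) ω := fun β =>
    (integrable_mul_isTest (ht.multiD β) hw.locallyIntegrableOn).integrableOn
  have h1 := h _ ht
  simp only [laplacian, mul_add] at h1
  rw [integral_add (hi _) (hi _)] at h1
  have h2 := multiD_mollify_eq (n := n) hω hp (0, 0) x
  simp only [multiD, Function.iterate_zero, id] at h2
  rw [h2, laplacian, multiD_mollify_eq hω hw, multiD_mollify_eq hω hw]
  simp only [multiD, Function.iterate_zero, id] at h1 ⊢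
  norm_num
  exact h1

theorem le_of_hasWeakLaplacian {ω : Set Plane} (hω : IsOpen ω) (hωb : Bornology.IsBounded ω)
    {w p : Plane → ℝ} (hw : ContinuousOn w (closure ω)) (hwi : IntegrableOn w ω)
    (hpi : IntegrableOn p ω)
    (hlap : HasWeakLaplacian ω w p) {Q B h : ℝ} (hQ : ∀ x ∈ ω, |p x| ≤ Q)
    (hB : ∀ x ∈ frontier ω, w x ≤ B) {x₀ : Plane} (hh : ∀ x ∈ ω, dist x x₀ ≤ h) :
    ∀ x ∈ closure ω, w x ≤ B + Q * h ^ 2 := by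
  have hcl : IsCompact (closure ω) := hωb.isCompact_closure
  have hωm := hω.measurableSet
  intro x₁ hx₁
  have hne : ω.Nonempty := closure_nonempty_iff.1 ⟨x₁, hx₁⟩
  obtain ⟨y₀, hy₀⟩ := hne
  have hQ0 : 0 ≤ Q := (abs_nonneg _).trans (hQ y₀ hy₀)
  have hhc : ∀ x ∈ closure ω, ‖x - x₀‖ ≤ h := fun x hx => by
    have h1 : closure ω ⊆ closedBall x₀ h := closure_minimal hh isClosed_closedBall
    rw [← dist_eq_norm]
    exact h1 hx
  have hh0 : 0 ≤ h := (norm_nonneg _).trans (hhc x₁ hx₁)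
  refine le_of_forall_pos_le_add fun η hη => ?_
  -- it suffices to bound the perturbed function
  obtain ⟨κ, hκQ, hκ⟩ : ∃ κ, Q / 4 < κ ∧ κ * h ^ 2 ≤ Q * h ^ 2 + η := by
    refine ⟨Q / 4 + η / (h ^ 2 + 1), by linarith [show 0 < η / (h ^ 2 + 1) by positivity], ?_⟩
    have h1 : η / (h ^ 2 + 1) * h ^ 2 ≤ η := by
      rw [div_mul_eq_mul_div, div_le_iff₀ (by positivity)]
      nlinarith
    nlinarith [mul_nonneg hQ0 (sq_nonneg h)]
  have hκ0 : 0 < κ := by linarith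
  set v : Plane → ℝ := fun x => w x + κ * ‖x - x₀‖ ^ 2 with hv
  have hvc : ContinuousOn v (closure ω) := hw.add (by fun_prop)
  obtain ⟨z₀, hz₀, hz₀max⟩ := hcl.exists_isMaxOn ⟨x₁, hx₁⟩ hvc
  suffices hkey : v z₀ ≤ B + κ * h ^ 2 by
    have h1 : v x₁ ≤ v z₀ := hz₀max hx₁
    have h2 : w x₁ ≤ v x₁ := by
      simp only [hv]
      have : 0 ≤ κ * ‖x₁ - x₀‖ ^ 2 := by positivity
      linarith
    linarith
  by_contra! hlt
  set B' := B + κ * h ^ 2 with hB'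
  have hvfr : ∀ x ∈ frontier ω, v x ≤ B' := fun x hx => by
    have h1 := hhc x (frontier_subset_closure hx)
    have h2 := hB x hx
    simp only [hv, hB']
    gcongr
  set t := (v z₀ + B') / 2 with ht
  have htB : B' < t := by rw [ht]; linarith
  have htz : t < v z₀ := by rw [ht]; linarith
  let L : Set Plane := {x ∈ closure ω | t ≤ v x}
  have hLc : IsCompact L := by
    have : IsClosed L := hvc.preimage_isClosed_of_isClosed isClosed_closure isClosed_Ici
    exact hcl.of_isClosed_subset this fun x hx => hx.1
  have hLω : L ⊆ ω := fun x hx => by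
    by_contra hxω
    have : x ∈ frontier ω := by rw [hω.frontier_eq]; exact ⟨hx.1, hxω⟩
    have := hvfr x this
    have := hx.2
    linarith
  have hLne : z₀ ∈ L := ⟨hz₀, htz.le⟩
  have hU : IsOpen {x ∈ ω | t < v x} :=
    (hvc.mono subset_closure).isOpen_inter_preimage hω isOpen_Ioi
  have hwint : Integrable (ω.indicator w) := (integrable_indicator_iff hωm).2 hwi
  have hcont : ∀ x ∈ L, ContinuousAt (ω.indicator w) x := fun x hx => by
    have h1 : ω.indicator w =ᶠ[𝓝 x] w := by
      filter_upwards [hω.mem_nhds (hLω hx)] with y hy using indicator_of_mem hy w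
    exact ((hw.mono subset_closure).continuousAt (hω.mem_nhds (hLω hx))).congr h1.symm
  set ε := (v z₀ - t) / 4 with hε
  have hε0 : 0 < ε := by rw [hε]; linarith
  have hunif := Metric.tendstoUniformlyOn_iff.1
    (tendstoUniformlyOn_mollify hwint.locallyIntegrable hLc hcont) ε hε0
  obtain ⟨n, hn, hnb⟩ := (hunif.and (eventually_closedBall_subset hω hLc hLω)).exists
  set f := mollify n (ω.indicator w) with hf
  have hfs : ContDiff ℝ (⊤ : ℕ∞) f := contDiff_mollify n hwint.locallyIntegrable
  have hfw : ∀ x ∈ L, |w x - f x| < ε := fun x hx => by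
    have h1 := hn x hx
    rwa [indicator_of_mem (hLω hx), Real.dist_eq] at h1
  obtain ⟨z, hz, hzmax⟩ := hLc.exists_isMaxOn (f := fun x => f x + κ * ‖x - x₀‖ ^ 2) ⟨z₀, hLne⟩
    ((hfs.continuous.add (by fun_prop)).continuousOn)
  have hzt : t < v z := by
    have h1 : f z₀ + κ * ‖z₀ - x₀‖ ^ 2 ≤ f z + κ * ‖z - x₀‖ ^ 2 := hzmax hLne
    have h2 := abs_lt.1 (hfw z₀ hLne)
    have h3 := abs_lt.1 (hfw z hz)
    have h4 : v z₀ - 2 * ε < v z := by simp only [hv]; linarith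
    linarith
  have hloc : IsLocalMax (fun x => f x + κ * ‖x - x₀‖ ^ 2) z := by
    filter_upwards [hU.mem_nhds ⟨hLω hz, hzt⟩] with y hy
    exact hzmax ⟨subset_closure hy.1, hy.2.le⟩
  have h5 := laplacian_le_of_isLocalMax hfs hloc
  rw [hf, laplacian_mollify hωm hwi hpi hlap (hnb z hz)] at h5
  have h6 : |mollify n (ω.indicator p) z| ≤ Q := abs_mollify_le (ae_of_all _ fun y hy => by
    rw [indicator_of_mem (hnb z hz hy)]
    exact hQ y (hnb z hz hy))
  have := (abs_le.1 h6).1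
  linarith

theorem HasWeakLaplacian.neg {ω : Set Plane} {w p : Plane → ℝ} (h : HasWeakLaplacian ω w p) :
    HasWeakLaplacian ω (fun x => -w x) (fun x => -p x) := fun φ hφ => by
  simp only [neg_mul, integral_neg, h φ hφ]

/-- The maximum principle for functions with a bounded distributional Laplacian. -/
theorem abs_le_of_hasWeakLaplacian {ω : Set Plane} (hω : IsOpen ω) (hωb : Bornology.IsBounded ω)
    {w p : Plane → ℝ} (hw : ContinuousOn w (closure ω)) (hwi : IntegrableOn w ω)
    (hpi : IntegrableOn p ω)
    (hlap : HasWeakLaplacian ω w p) {Q B h : ℝ} (hQ : ∀ x ∈ ω, |p x| ≤ Q)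
    (hB : ∀ x ∈ frontier ω, |w x| ≤ B) {x₀ : Plane} (hh : ∀ x ∈ ω, dist x x₀ ≤ h) :
    ∀ x ∈ closure ω, |w x| ≤ B + Q * h ^ 2 := fun x hx =>
  abs_le'.2 ⟨le_of_hasWeakLaplacian hω hωb hw hwi hpi hlap hQ
    (fun x hx => (le_abs_self _).trans (hB x hx)) hh x hx,
    le_of_hasWeakLaplacian hω hωb (w := fun x => -w x) (p := fun x => -p x) hw.neg hwi.neg hpi.neg
      hlap.neg (fun x hx => by rw [abs_neg]; exact hQ x hx)
    (fun x hx => (neg_le_abs _).trans (hB x hx)) hh x hx⟩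

/-- Sup norm bound for functions with polynomial Laplacian and polynomial edge values. -/
theorem exists_sup_bound (l : ℕ) {a : ℝ} (ha : 0 < a) : ∃ C > 0, ∀ E : PolygonalElement,
    E.ShapeRegular a → ∀ (w g₀ g₁ : Plane → ℝ) (p : Poly), ContinuousOn w (closure E.carrier) →
    IntegrableOn w E.carrier → HasWeakDeriv E.carrier (1, 0) w g₀ → IntegrableOn g₀ E.carrier →
    HasWeakDeriv E.carrier (0, 1) w g₁ → IntegrableOn g₁ E.carrier →
    (∀ i, ∃ q : Polynomial ℝ, q.natDegree ≤ l ∧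
      ∀ t ∈ Icc (0 : ℝ) 1, w (E.poly.edgePath ℝ i t) = q.eval t) →
    p.totalDegree ≤ l → HasWeakLaplacian E.carrier w (peval p) →
    ∀ x ∈ closure E.carrier, |w x| * E.diam ^ 2 ≤ C * ((∫ y in E.carrier, |w y|) +
      E.diam * ((∫ y in E.carrier, |g₀ y|) + ∫ y in E.carrier, |g₁ y|)) := by
  obtain ⟨N, hN, hpieces⟩ := exists_starPieces ha
  obtain ⟨C₁, hC₁, hfr⟩ := exists_frontier_sup_bound l ha
  obtain ⟨C₂, hC₂, hlapb⟩ := exists_weakLaplacian_bound l (r := max 1 (4 / a)) (le_max_left _ _)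
  refine ⟨C₁ + C₂ * (4 / a) ^ 4, by positivity, ?_⟩
  intro E hE w g₀ g₁ p hw hwi h₀ h₀i h₁ h₁i hedge hp hlap x hx
  have hd := E.diam_pos
  obtain ⟨K, c, hcov, hK⟩ := hpieces E hE
  have hKsub : K ⟨0, hN⟩ ⊆ E.carrier := by rw [hcov]; exact subset_iUnion K _
  set x₀ := c ⟨0, hN⟩ with hx₀
  have hball : ball x₀ (2 * (a * E.diam / 4)) ⊆ E.carrier := by
    refine Subset.trans ?_ ((hK ⟨0, hN⟩).ball_subset.trans hKsub)
    rw [← hx₀]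
    exact ball_subset_ball (by linarith)
  have hx₀E : x₀ ∈ E.carrier := hball (mem_ball_self (by positivity))
  have n₀ : 0 ≤ ∫ x in E.carrier, |g₀ x| := integral_nonneg fun _ => abs_nonneg _
  have n₁ : 0 ≤ ∫ x in E.carrier, |g₁ x| := integral_nonneg fun _ => abs_nonneg _
  set W := ∫ x in E.carrier, |w x| with hW
  have nw : 0 ≤ W := integral_nonneg fun _ => abs_nonneg _
  set G := E.diam * ((∫ y in E.carrier, |g₀ y|) + ∫ y in E.carrier, |g₁ y|) with hG
  have hG0 : 0 ≤ G := by positivity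
  have hQ : ∀ y ∈ E.carrier, |peval p y| ≤ C₂ * (4 / a) ^ 4 * W / E.diam ^ 4 := fun y hy => by
    have h1 := hlapb E.carrier x₀ (a * E.diam / 4) (by positivity) hball w p hp hwi hlap y (by
      refine (E.dist_le_diam hy hx₀E).trans ?_
      calc E.diam = 4 / a * (a * E.diam / 4) := by field_simp
        _ ≤ _ := by gcongr; exact le_max_right _ _)
    rw [le_div_iff₀ (by positivity)]
    calc |peval p y| * E.diam ^ 4 = |peval p y| * (a * E.diam / 4) ^ 4 * (4 / a) ^ 4 := by
          field_simp
      _ ≤ C₂ * W * (4 / a) ^ 4 := by gcongr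
      _ = _ := by ring
  have hB : ∀ y ∈ frontier E.carrier, |w y| ≤ C₁ * (W + G) / E.diam ^ 2 := fun y hy => by
    rw [le_div_iff₀ (by positivity)]
    exact hfr E hE w g₀ g₁ hw hwi h₀ h₀i h₁ h₁i hedge y hy
  have hpi : IntegrableOn (peval p) E.carrier :=
    ((peval_continuous p).continuousOn.integrableOn_compact
      E.isBounded.isCompact_closure).mono_set subset_closure
  have h2 := abs_le_of_hasWeakLaplacian E.isOpen E.isBounded hw hwi hpi hlap hQ hB
    (fun y hy => E.dist_le_diam hy hx₀E) x hx
  calc |w x| * E.diam ^ 2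
      ≤ (C₁ * (W + G) / E.diam ^ 2 + C₂ * (4 / a) ^ 4 * W / E.diam ^ 4 * E.diam ^ 2) *
        E.diam ^ 2 := by gcongr
    _ = C₁ * (W + G) + C₂ * (4 / a) ^ 4 * W := by field_simp
    _ ≤ C₁ * (W + G) + C₂ * (4 / a) ^ 4 * (W + G) := by gcongr; linarith
    _ = _ := by ring

/-! ### Maps of the plane close to the identity -/

/-- A nowhere vanishing continuous function on the closed unit disk has a continuous logarithm. -/
theorem exists_continuous_log {f : ℂ → ℂ} (hf : ContinuousOn f (closedBall 0 1))
    (h0 : ∀ z ∈ closedBall (0 : ℂ) 1, f z ≠ 0) :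
    ∃ g : ℂ → ℂ, ContinuousOn g (closedBall 0 1) ∧
      ∀ z ∈ closedBall (0 : ℂ) 1, Complex.exp (g z) = f z := by
  have hK : IsCompact (closedBall (0 : ℂ) 1) := isCompact_closedBall 0 1
  obtain ⟨z₀, hz₀, hmin⟩ := hK.exists_isMinOn ⟨0, by simp⟩ hf.norm
  set m := ‖f z₀‖ with hm
  have hm0 : 0 < m := norm_pos_iff.2 (h0 z₀ hz₀)
  have huc := Metric.uniformContinuousOn_iff.1 (hK.uniformContinuousOn_of_continuous hf) m hm0
  obtain ⟨δ, hδ, hδf⟩ := huc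
  obtain ⟨n, hn⟩ := exists_nat_one_div_lt hδ
  let s : ℕ → ℂ → ℂ := fun j z => ((j : ℝ) / (n + 1) : ℝ) • z
  have hn1 : (0 : ℝ) < n + 1 := by positivity
  have hs : ∀ j ≤ n + 1, ∀ z ∈ closedBall (0 : ℂ) 1, s j z ∈ closedBall (0 : ℂ) 1 := by
    intro j hj z hz
    rw [mem_closedBall_zero_iff] at hz ⊢
    have : (j : ℝ) / (n + 1) ≤ 1 := by
      rw [div_le_one hn1]
      exact_mod_cast hj
    rw [norm_smul, Real.norm_of_nonneg (by positivity)]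
    exact mul_le_one₀ this (norm_nonneg _) hz
  have hsc : ∀ j, Continuous (s j) := fun j => continuous_const_smul _
  have hratio : ∀ j < n + 1, ∀ z ∈ closedBall (0 : ℂ) 1,
      f (s (j + 1) z) / f (s j z) ∈ Complex.slitPlane := by
    intro j hj z hz
    have h1 := hs j hj.le z hz
    have h2 := hs (j + 1) hj z hz
    have hd : dist (s (j + 1) z) (s j z) < δ := by
      simp only [s, dist_eq_norm, ← sub_smul, norm_smul]
      rw [show ((j + 1 : ℕ) : ℝ) / (n + 1) - (j : ℝ) / (n + 1) = 1 / (n + 1) by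
        push_cast; field_simp; ring, Real.norm_of_nonneg (by positivity)]
      rw [mem_closedBall_zero_iff] at hz
      exact (mul_le_of_le_one_right (by positivity) hz).trans_lt hn
    have h3 := hδf _ h2 _ h1 hd
    have h4 : m ≤ ‖f (s j z)‖ := hmin h1
    have h5 : ‖f (s (j + 1) z) / f (s j z) - 1‖ < 1 := by
      rw [div_sub_one (h0 _ h1), norm_div, div_lt_one (hm0.trans_le h4), ← dist_eq_norm]
      exact h3.trans_le h4
    have h6 := Complex.mem_slitPlane_of_norm_lt_one h5
    rwa [add_sub_cancel] at h6
  refine ⟨fun z => Complex.log (f 0) +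
    ∑ j ∈ Finset.range (n + 1), Complex.log (f (s (j + 1) z) / f (s j z)), ?_, ?_⟩
  · refine continuousOn_const.add (continuousOn_finsetSum _ fun j hj => ?_)
    rw [Finset.mem_range] at hj
    refine ContinuousOn.clog ?_ (hratio j hj)
    exact (hf.comp (hsc _).continuousOn (hs _ hj)).div
      (hf.comp (hsc _).continuousOn (hs _ hj.le)) fun z hz => h0 _ (hs j hj.le z hz)
  · intro z hz
    have key : ∀ k ≤ n + 1, Complex.exp (Complex.log (f 0) +
        ∑ j ∈ Finset.range k, Complex.log (f (s (j + 1) z) / f (s j z))) = f (s k z) := by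
      intro k
      induction k with
      | zero =>
        intro _
        simp only [Finset.range_zero, Finset.sum_empty, add_zero, s, Nat.cast_zero, zero_div,
          zero_smul]
        exact Complex.exp_log (h0 0 (by simp))
      | succ k ih =>
        intro hk
        have hne : f (s k z) ≠ 0 := h0 _ (hs k (by omega) z hz)
        have hne' : f (s (k + 1) z) ≠ 0 := h0 _ (hs (k + 1) hk z hz)
        rw [Finset.sum_range_succ, ← add_assoc, Complex.exp_add, ih (by omega),
          Complex.exp_log (div_ne_zero hne' hne)]
        field_simp
    rw [key (n + 1) le_rfl]
    simp only [s, Nat.cast_add, Nat.cast_one]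
    rw [div_self hn1.ne', one_smul]

/-- There is no continuous logarithm of the identity on the unit circle. -/
theorem not_exists_circle_log {L : ℝ → ℂ} (hL : Continuous L)
    (h : ∀ t : ℝ, Complex.exp (L t) = Complex.exp (t * Complex.I)) :
    L (2 * Real.pi) ≠ L 0 := by
  intro heq
  let r : ℝ → ℝ := fun t => ((L t).im - t) / (2 * Real.pi)
  have hr : Continuous r := ((Complex.continuous_im.comp hL).sub continuous_id).div_const _
  have hint : ∀ t, ∃ n : ℤ, r t = n := fun t => by
    obtain ⟨n, hn⟩ := Complex.exp_eq_exp_iff_exists_int.1 (h t)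
    refine ⟨n, ?_⟩
    have him := congrArg Complex.im hn
    simp only [Complex.add_im, Complex.mul_im, Complex.ofReal_re, Complex.I_im, mul_one,
      Complex.ofReal_im, Complex.I_re, mul_zero, add_zero, Complex.intCast_re, Complex.intCast_im,
      zero_mul, Complex.mul_re, Complex.re_ofNat, Complex.im_ofNat, sub_zero] at him
    simp only [r, him]
    field_simp
    ring
  have h1 : r (2 * Real.pi) = r 0 - 1 := by
    simp only [r, heq]
    field_simp
    ring
  have hivt := intermediate_value_Icc' (a := 0) (b := 2 * Real.pi) (by positivity) hr.continuousOn
  obtain ⟨t, -, ht⟩ := hivt (show r 0 - 1 / 2 ∈ Icc (r (2 * Real.pi)) (r 0) by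
    rw [h1]; constructor <;> linarith)
  obtain ⟨n, hn⟩ := hint t
  obtain ⟨m, hm⟩ := hint 0
  rw [hn, hm] at ht
  have h2 : (2 * n : ℝ) = 2 * m - 1 := by linarith
  have h3 : 2 * n = 2 * m - 1 := by exact_mod_cast h2
  omega

theorem exists_zero_of_norm_sub_le {f : ℂ → ℂ} (hf : ContinuousOn f (closedBall 0 1))
    (h : ∀ z : ℂ, ‖z‖ = 1 → ‖f z - z‖ ≤ 1) : ∃ z ∈ closedBall (0 : ℂ) 1, f z = 0 := by
  by_contra! h0
  obtain ⟨g, hg, hgf⟩ := exists_continuous_log hf h0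
  let γ : ℝ → ℂ := fun t => Complex.exp (t * Complex.I)
  have hγ : Continuous γ := by fun_prop
  have hγ1 : ∀ t, ‖γ t‖ = 1 := fun t => Complex.norm_exp_ofReal_mul_I t
  have hγm : ∀ t, γ t ∈ closedBall (0 : ℂ) 1 := fun t => by
    rw [mem_closedBall_zero_iff, hγ1]
  have hγ0 : ∀ t, γ t ≠ 0 := fun t => Complex.exp_ne_zero _
  have hslit : ∀ t, f (γ t) / γ t ∈ Complex.slitPlane := fun t => by
    have h1 : ‖f (γ t) / γ t - 1‖ ≤ 1 := by
      rw [div_sub_one (hγ0 t), norm_div, hγ1, div_one]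
      exact h _ (hγ1 t)
    have h2 : f (γ t) / γ t ≠ 0 := div_ne_zero (h0 _ (hγm t)) (hγ0 t)
    set u := f (γ t) / γ t
    refine Or.inl ?_
    have h3 : ‖u - 1‖ ^ 2 ≤ 1 := by
      have := pow_le_one₀ (n := 2) (norm_nonneg _) h1
      exact this
    rw [← Complex.normSq_eq_norm_sq, Complex.normSq_apply] at h3
    simp only [Complex.sub_re, Complex.one_re, Complex.sub_im, Complex.one_im, sub_zero] at h3
    have h4 : 0 < Complex.normSq u := Complex.normSq_pos.2 h2
    rw [Complex.normSq_apply] at h4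
    nlinarith
  refine not_exists_circle_log (L := fun t => g (γ t) - Complex.log (f (γ t) / γ t)) ?_ ?_ ?_
  · refine (hg.comp_continuous hγ hγm).sub (Continuous.clog ?_ hslit)
    exact (hf.comp_continuous hγ hγm).div hγ hγ0
  · intro t
    have h1 := h0 _ (hγm t)
    have h2 := hγ0 t
    rw [Complex.exp_sub, hgf _ (hγm t), Complex.exp_log (div_ne_zero h1 h2)]
    change _ = γ t
    field_simp
  · have h1 : γ (2 * Real.pi) = γ 0 := by
      simp only [γ]
      push_cast
      rw [Complex.exp_two_pi_mul_I, zero_mul, Complex.exp_zero]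
    simp only [h1]

theorem exists_eq_of_dist_le {G : Plane → Plane} {y : Plane} {ε : ℝ} (hε : 0 < ε)
    (hG : ContinuousOn G (closedBall y ε)) (h : ∀ x ∈ closedBall y ε, dist (G x) x ≤ ε) :
    ∃ x ∈ closedBall y ε, G x = y := by
  let e : ℂ ≃ₗᵢ[ℝ] Plane := Complex.orthonormalBasisOneI.repr
  have hmaps : ∀ z ∈ closedBall (0 : ℂ) 1, y + ε • e z ∈ closedBall y ε := fun z hz => by
    rw [mem_closedBall_zero_iff] at hz
    rw [mem_closedBall, dist_eq_norm, add_sub_cancel_left, norm_smul, e.norm_map,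
      Real.norm_of_nonneg hε.le]
    exact mul_le_of_le_one_right hε.le hz
  have hcont : Continuous fun z : ℂ => y + ε • e z :=
    continuous_const.add (e.continuous.const_smul ε)
  have hc : ContinuousOn (fun z : ℂ => ε⁻¹ • (G (y + ε • e z) - y)) (closedBall 0 1) := by
    have h1 := ((hG.comp hcont.continuousOn hmaps).sub (continuousOn_const (c := y))).const_smul ε⁻¹
    exact h1
  obtain ⟨z, hz, hz0⟩ := exists_zero_of_norm_sub_le
    (f := fun z => e.symm (ε⁻¹ • (G (y + ε • e z) - y)))
    (e.symm.continuous.comp_continuousOn hc) (fun z hz => by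
      have h1 := h _ (hmaps z (by rw [mem_closedBall_zero_iff, hz]))
      have h2 : e.symm (ε⁻¹ • (G (y + ε • e z) - y)) - z =
          e.symm (ε⁻¹ • (G (y + ε • e z) - (y + ε • e z))) := by
        apply e.injective
        rw [map_sub, e.apply_symm_apply, e.apply_symm_apply, ← sub_sub, smul_sub _ _ (ε • e z),
          inv_smul_smul₀ hε.ne']
      rw [h2, e.symm.norm_map, norm_smul, ← dist_eq_norm, norm_inv, Real.norm_of_nonneg hε.le,
        inv_mul_le_iff₀ hε, mul_one]
      exact h1)
  refine ⟨_, hmaps z hz, ?_⟩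
  have h1 : ε⁻¹ • (G (y + ε • e z) - y) = 0 := by
    have := congrArg e hz0
    rwa [e.apply_symm_apply, map_zero] at this
  rcases smul_eq_zero.1 h1 with h2 | h2
  · exact absurd h2 (inv_ne_zero hε.ne')
  · exact sub_eq_zero.1 h2

/-- A map close to an affine isomorphism on a ball attains the values close to that of the
centre. -/
theorem exists_eq_of_norm_sub_le {f : Plane → Plane} {A : Plane ≃L[ℝ] Plane} {Λ r : ℝ} (hΛ : 0 < Λ)
    (hr : 0 < r) (hA : ∀ v, ‖A.symm v‖ ≤ Λ * ‖v‖) {x y : Plane}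
    (hf : ContinuousOn f (closedBall x r))
    (h : ∀ z ∈ closedBall x r, ‖f z - y - A (z - x)‖ ≤ r / Λ) : ∃ z ∈ closedBall x r, f z = y := by
  obtain ⟨z, hz, hzx⟩ := exists_eq_of_dist_le (G := fun z => x + A.symm (f z - y)) hr
    (continuousOn_const.add (A.symm.continuous.comp_continuousOn (hf.sub continuousOn_const)))
    (fun z hz => by
      have h1 : x + A.symm (f z - y) - z = A.symm (f z - y - A (z - x)) := by
        rw [map_sub _ (f z - y), A.symm_apply_apply]
        abel
      rw [dist_eq_norm, h1]
      refine (hA _).trans ?_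
      calc Λ * ‖f z - y - A (z - x)‖ ≤ Λ * (r / Λ) := by
            gcongr
            exact h z hz
        _ = r := by field_simp)
  refine ⟨z, hz, ?_⟩
  have h1 : A.symm (f z - y) = 0 := by simpa using hzx
  exact sub_eq_zero.1 (A.symm.injective (by rw [h1, map_zero]))

/-! ### Images of an element under perturbations of a nearly affine map -/

theorem exists_mem_segment_frontier {U : Set Plane} (hU : IsOpen U) {x z : Plane} (hx : x ∈ U)
    (hz : z ∉ U) : ∃ p ∈ segment ℝ x z, p ∈ frontier U := by
  by_cases hzc : z ∈ closure U
  · exact ⟨z, right_mem_segment ℝ x z, by rw [hU.frontier_eq]; exact ⟨hzc, hz⟩⟩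
  by_contra! hno
  obtain ⟨p, -, hp⟩ := (convex_segment (𝕜 := ℝ) x z).isPreconnected U (closure U)ᶜ hU
    isClosed_closure.isOpen_compl (fun p hp => by
      by_cases h : p ∈ U
      · exact Or.inl h
      · refine Or.inr fun hcl => hno p hp ?_
        rw [hU.frontier_eq]
        exact ⟨hcl, h⟩)
    ⟨x, left_mem_segment ℝ x z, hx⟩ ⟨z, right_mem_segment ℝ x z, hzc⟩
  exact hp.2 (subset_closure hp.1)

theorem mem_nbhd_frontier {U : Set Plane} (hU : IsOpen U) {x z : Plane} {r : ℝ} (hx : x ∈ U)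
    (hz : z ∉ U) (h : dist z x ≤ r) : z ∈ nbhd r (frontier U) ∧ x ∈ nbhd r (frontier U) := by
  obtain ⟨p, hp, hpf⟩ := exists_mem_segment_frontier hU hx hz
  have h1 := dist_add_dist_of_mem_segment hp
  rw [dist_comm z x] at h
  refine ⟨⟨p, hpf, ?_⟩, ⟨p, hpf, ?_⟩⟩
  · rw [dist_comm]
    linarith [dist_nonneg (x := x) (y := p)]
  · linarith [dist_nonneg (x := p) (y := z)]

theorem closedBall_subset_of_notMem_nbhd {U : Set Plane} (hU : IsOpen U) {x : Plane} {r : ℝ}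
    (hx : x ∈ U) (h : x ∉ nbhd r (frontier U)) : closedBall x r ⊆ U := fun z hz => by
  by_contra hzU
  exact h (mem_nbhd_frontier hU hx hzU hz).2

theorem isCompact_nbhd {S : Set Plane} (hS : IsCompact S) {r : ℝ} (hr : 0 ≤ r) :
    IsCompact (nbhd r S) := by
  have : nbhd r S = cthickening r S := by
    rw [hS.cthickening_eq_biUnion_closedBall hr]
    ext z
    simp [nbhd]
  rw [this]
  exact hS.cthickening

theorem abs_det_le {M : ℝ} (L : Plane →L[ℝ] Plane) (hL : ‖L‖ ≤ M) : |L.det| ≤ M ^ 2 := by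
  have hM : 0 ≤ M := (norm_nonneg _).trans hL
  have hsub : L '' closedBall 0 1 ⊆ closedBall 0 M := by
    rintro _ ⟨x, hx, rfl⟩
    rw [mem_closedBall_zero_iff] at hx ⊢
    exact (L.le_of_opNorm_le_of_le hL hx).trans_eq (mul_one M)
  have h1 := measure_mono (μ := volume) hsub
  rw [Measure.addHaar_image_continuousLinearMap, Measure.addHaar_closedBall _ _ hM,
    Measure.addHaar_closedBall _ _ zero_le_one, finrank_euclideanSpace, Fintype.card_fin, one_pow,
    ENNReal.ofReal_one, one_mul] at h1
  have hne : volume (ball (0 : Plane) 1) ≠ 0 := (measure_ball_pos _ _ one_pos).ne'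
  rw [ENNReal.mul_le_mul_iff_left hne measure_ball_lt_top.ne] at h1
  exact (ENNReal.ofReal_le_ofReal_iff (by positivity)).1 h1

/-- `T` is close to the affine map with linear part `A` on `B`, quantitatively in terms of the
norm `Λ` of the inverse of `A`. -/
structure NearAffine (T : Plane → Plane) (A : Plane ≃L[ℝ] Plane) (Λ : ℝ) (B : Set Plane) :
    Prop where
  pos : 0 < Λ
  symm_le : ∀ v, ‖A.symm v‖ ≤ Λ * ‖v‖
  continuous : Continuous T
  approx : ∀ x ∈ B, ∀ z ∈ B, ‖T z - T x - A (z - x)‖ ≤ ‖z - x‖ / (2 * Λ)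

namespace NearAffine

variable {T : Plane → Plane} {A : Plane ≃L[ℝ] Plane} {Λ : ℝ} {B U : Set Plane}

theorem exists_eq_of_dist_le (h : NearAffine T A Λ B) {f : Plane → Plane} {x y : Plane} {r δ : ℝ}
    (hr : 0 < r) (hrδ : 2 * Λ * δ ≤ r) (hxB : closedBall x r ⊆ B)
    (hf : ContinuousOn f (closedBall x r)) (hfT : ∀ z ∈ closedBall x r, dist (f z) (T z) ≤ δ)
    (hy : y = T x) : ∃ z ∈ closedBall x r, f z = y := by
  have hΛ := h.pos
  refine exists_eq_of_norm_sub_le hΛ hr h.symm_le hf fun z hz => ?_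
  have h1 := h.approx x (hxB (mem_closedBall_self hr.le)) z (hxB hz)
  have h2 := hfT z hz
  rw [mem_closedBall, dist_eq_norm] at hz
  rw [dist_eq_norm] at h2
  calc ‖f z - y - A (z - x)‖ = ‖(f z - T z) + (T z - T x - A (z - x))‖ := by
        rw [hy]; congr 1; abel
    _ ≤ δ + r / (2 * Λ) := by
        refine (norm_add_le _ _).trans (add_le_add h2 (h1.trans ?_))
        gcongr
    _ ≤ r / (2 * Λ) + r / (2 * Λ) := by
        gcongr
        rw [le_div_iff₀ (by positivity)]
        linarith
    _ = r / Λ := by field_simp; norm_num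

theorem exists_preimage (h : NearAffine T A Λ B) {x y : Plane} {r δ : ℝ}
    (hr : 0 < r) (hrδ : 2 * Λ * δ ≤ r) (hxB : closedBall x r ⊆ B) (hy : dist y (T x) ≤ δ) :
    ∃ z ∈ closedBall x r, T z = y := by
  have hΛ := h.pos
  refine exists_eq_of_norm_sub_le hΛ hr h.symm_le h.continuous.continuousOn fun z hz => ?_
  have h1 := h.approx x (hxB (mem_closedBall_self hr.le)) z (hxB hz)
  rw [mem_closedBall, dist_eq_norm] at hz
  rw [dist_comm, dist_eq_norm] at hy
  calc ‖T z - y - A (z - x)‖ = ‖(T x - y) + (T z - T x - A (z - x))‖ := by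
        congr 1; abel
    _ ≤ δ + r / (2 * Λ) := by
        refine (norm_add_le _ _).trans (add_le_add hy (h1.trans ?_))
        gcongr
    _ ≤ r / (2 * Λ) + r / (2 * Λ) := by
        gcongr
        rw [le_div_iff₀ (by positivity)]
        linarith
    _ = r / Λ := by field_simp; norm_num

/-- Two perturbations of a nearly affine map have images which differ only close to the image of
the boundary. -/
theorem image_diff_subset (h : NearAffine T A Λ B) (hU : IsOpen U) {f₁ f₂ : Plane → Plane}
    {r δ : ℝ} (hr : 0 < r) (hrδ : 2 * Λ * δ ≤ r) (hUB : ∀ x ∈ U, closedBall x r ⊆ B)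
    (hf₂ : ContinuousOn f₂ U) (h₁ : ∀ z ∈ U, dist (f₁ z) (T z) ≤ δ)
    (h₂ : ∀ z ∈ U, dist (f₂ z) (T z) ≤ δ) :
    f₁ '' U \ f₂ '' U ⊆ T '' (nbhd r (frontier U) ∩ B) := by
  rintro _ ⟨⟨x, hx, rfl⟩, hnot⟩
  obtain ⟨z, hz, hzy⟩ := h.exists_preimage hr hrδ (hUB x hx) (h₁ x hx)
  refine ⟨z, ⟨?_, hUB x hx hz⟩, hzy⟩
  by_cases hzU : z ∈ U
  · by_contra hn
    have hsub := closedBall_subset_of_notMem_nbhd hU hzU hn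
    obtain ⟨z', hz', hz'y⟩ := h.exists_eq_of_dist_le hr hrδ (hUB z hzU) (hf₂.mono hsub)
      (fun p hp => h₂ p (hsub hp)) hzy.symm
    exact hnot ⟨z', hsub hz', hz'y⟩
  · exact (mem_nbhd_frontier hU hx hzU hz).1

theorem ball_subset_image (h : NearAffine T A Λ B) {f : Plane → Plane} {c : Plane} {r ρ δ : ℝ}
    (hr : 0 < r) (hrδ : 2 * Λ * δ ≤ r) (hrρ : 2 * r ≤ ρ) (hUB : U ⊆ B)
    (hf : ContinuousOn f U) (hfT : ∀ z ∈ U, dist (f z) (T z) ≤ δ) (hc : closedBall c ρ ⊆ U) :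
    ball (T c) (ρ / (4 * Λ)) ⊆ f '' U := by
  have hΛ := h.pos
  intro y hy
  have hsub : closedBall c (ρ / 2) ⊆ U :=
    (closedBall_subset_closedBall (by linarith)).trans hc
  obtain ⟨x, hx, hxy⟩ := h.exists_preimage (r := ρ / 2) (δ := ρ / (4 * Λ)) (by linarith)
    (le_of_eq (by field_simp; ring)) (hsub.trans hUB) (mem_ball.1 hy).le
  have hsub' : closedBall x r ⊆ U := by
    refine (closedBall_subset_closedBall' ?_).trans hc
    rw [mem_closedBall] at hx
    linarith
  obtain ⟨z, hz, hzy⟩ := h.exists_eq_of_dist_le hr hrδ (hsub'.trans hUB) (hf.mono hsub')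
    (fun p hp => hfT p (hsub' hp)) hxy.symm
  exact ⟨z, hsub' hz, hzy⟩

end NearAffine

theorem volume_image_le {T : Plane → Plane} (hT : Differentiable ℝ T) {M : ℝ} {B : Set Plane}
    (hB : MeasurableSet B) (hM : ∀ x ∈ B, ‖fderiv ℝ T x‖ ≤ M) :
    volume (T '' B) ≤ ENNReal.ofReal (M ^ 2) * volume B := by
  refine (addHaar_image_le_lintegral_abs_det_fderiv volume hB
    fun x _ => (hT x).hasFDerivAt.hasFDerivWithinAt).trans ?_
  rw [← setLIntegral_const]
  exact setLIntegral_mono' hB fun x hx => ENNReal.ofReal_le_ofReal (abs_det_le _ (hM x hx))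

/-! ### Taylor fields on an element -/

theorem abs_scaledMono_sub_le {x y : Plane} {d : ℝ} (hd : 0 < d) (hd1 : d ≤ 1)
    (hx : dist x y ≤ 2 * d) {η : ℕ × ℕ} {l : ℕ} (hη : η.1 + η.2 ≤ l) :
    |scaledMono y 1 η x - scaledMono y 1 η y| ≤ 2 ^ l * d := by
  by_cases h0 : η.1 + η.2 = 0
  · have h1 : η.1 = 0 := by omega
    have h2 : η.2 = 0 := by omega
    simp only [scaledMono, h1, h2, pow_zero, sub_self, abs_zero]
    positivity
  have hy : scaledMono y 1 η y = 0 := by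
    simp only [scaledMono, sub_self, zero_div]
    rcases Nat.eq_zero_or_pos η.1 with h | h
    · rw [zero_pow (n := η.2) (by omega), mul_zero]
    · rw [zero_pow (n := η.1) (by omega), zero_mul]
  have hx' : scaledMono y 1 η x = d ^ (η.1 + η.2) * scaledMono y d η x := by
    simp only [scaledMono, div_pow, div_one, pow_add]
    field_simp
  rw [hy, sub_zero, hx', abs_mul, abs_of_nonneg (by positivity), mul_comm]
  have h1 := abs_scaledMono_le hd one_le_two hx hη
  have h2 : d ^ (η.1 + η.2) ≤ d := by
    calc d ^ (η.1 + η.2) ≤ d ^ 1 := pow_le_pow_of_le_one hd.le hd1 (by omega)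
      _ = d := pow_one d
  gcongr

theorem exists_multiD_taylorSum_sub_bound (l : ℕ) (β : ℕ × ℕ) : ∃ C > 0, ∀ (y : Plane)
    (a : ℕ × ℕ → ℝ) (K d : ℝ), 0 < d → d ≤ 1 → (∀ γ : ℕ × ℕ, γ.1 + γ.2 ≤ l → |a γ| ≤ K) →
    ∀ x, dist x y ≤ 2 * d →
      |multiD β (taylorSum l y a) x - multiD β (taylorSum l y a) y| ≤ C * K * d := by
  refine ⟨∑ γ ∈ multiIdx l, ((γ.2.descFactorial β.2 : ℝ) * γ.1.descFactorial β.1 * 2 ^ l) + 1,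
    by positivity, fun y a K d hd hd1 ha x hx => ?_⟩
  have hK : 0 ≤ K := (abs_nonneg _).trans (ha (0, 0) (by simp))
  rw [taylorSum, multiD_monoSum, multiD_monoSum, ← Finset.sum_sub_distrib]
  refine (Finset.abs_sum_le_sum_abs _ _).trans ?_
  rw [add_mul, add_mul, Finset.sum_mul, Finset.sum_mul]
  refine (Finset.sum_le_sum fun γ hγ => ?_).trans (le_add_of_nonneg_right (by positivity))
  rw [mem_multiIdx] at hγ
  rw [← mul_sub, abs_mul, abs_mul, abs_mul, Nat.abs_cast, Nat.abs_cast, abs_div]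
  have h1 : |a γ| / |(γ.1.factorial * γ.2.factorial : ℝ)| ≤ K := by
    refine (div_le_self (abs_nonneg _) ?_).trans (ha γ hγ)
    rw [abs_of_nonneg (by positivity)]
    have h1 : (1 : ℝ) ≤ γ.1.factorial := by exact_mod_cast γ.1.factorial_pos
    have h2 : (1 : ℝ) ≤ γ.2.factorial := by exact_mod_cast γ.2.factorial_pos
    exact one_le_mul_of_one_le_of_one_le h1 h2
  have h2 := abs_scaledMono_sub_le hd hd1 hx (η := (γ.1 - β.1, γ.2 - β.2)) (l := l) (by
    simp only; omega)
  calc _ ≤ K * γ.2.descFactorial β.2 * γ.1.descFactorial β.1 * (2 ^ l * d) := by gcongr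
    _ = _ := by ring

/-- Bounds for the weak derivatives of a vector field on an element. -/
structure FieldBounds (l : ℕ) (U : Set Plane) (G : Plane → Plane) (j₀ M K : ℝ) : Prop where
  integrable : ∀ i, IntegrableOn (fun x => G x i) U
  weak : ∀ i, ∀ β : ℕ × ℕ, β.1 + β.2 ≤ l + 1 →
    HasWeakDeriv U β (fun x => G x i) (weakDeriv U β fun x => G x i)
  abs_le : ∀ i, ∀ β : ℕ × ℕ, β.1 + β.2 ≤ l + 1 →
    ∀ᵐ x ∂volume.restrict U, |weakDeriv U β (fun x => G x i) x| ≤ K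
  abs_le_one : ∀ i, ∀ β : ℕ × ℕ, β.1 + β.2 = 1 →
    ∀ᵐ x ∂volume.restrict U, |weakDeriv U β (fun x => G x i) x| ≤ M
  nonneg : 0 ≤ M
  le : M ≤ K
  det : ∀ᵐ x ∂volume.restrict U, j₀ ≤ jacobianDet U G x

theorem hasWeakDeriv_zero {U : Set Plane} {u : Plane → ℝ} (hu : LocallyIntegrableOn u U) :
    HasWeakDeriv U (0, 0) u u :=
  ⟨hu, hu, fun φ _ => by simp [multiD]⟩

theorem HasWeakDeriv.integrableOn_of_abs_le {U : Set Plane} (hU : volume U ≠ ∞) {β : ℕ × ℕ}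
    {u w : Plane → ℝ} {K : ℝ} (h : HasWeakDeriv U β u w)
    (hK : ∀ᵐ x ∂volume.restrict U, |w x| ≤ K) : IntegrableOn w U := by
  have : IsFiniteMeasure (volume.restrict U) := isFiniteMeasure_restrict.2 hU
  exact Integrable.of_bound h.2.1.aestronglyMeasurable K hK

/-- Taylor approximation of the components of a Sobolev field. -/
theorem exists_taylor_poly (l : ℕ) (hl : 1 ≤ l) {a : ℝ} (ha : 0 < a) : ∃ C > 0,
    ∀ E : PolygonalElement, E.ShapeRegular a → E.diam ≤ 1 → ∀ x₀ ∈ E.carrier,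
    ∀ (G : Plane → Plane) (j₀ M K : ℝ), FieldBounds l E.carrier G j₀ M K → ∀ i : Fin 2,
    ∃ p : Poly, p.totalDegree ≤ l ∧ (∀ j, |partialD j (peval p) x₀| ≤ M) ∧
      (∃ q : Poly, q.totalDegree ≤ l ∧ ∀ x, laplacian (peval p) x = peval q x) ∧
      (∀ j, ∀ x, dist x x₀ ≤ 2 * E.diam →
        |partialD j (peval p) x - partialD j (peval p) x₀| ≤ C * K * E.diam) ∧
      (∀ᵐ x ∂volume.restrict E.carrier, |G x i - peval p x| ≤ C * K * E.diam ^ (l + 1)) ∧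
      (∀ᵐ x ∂volume.restrict E.carrier,
        |weakDeriv E.carrier (1, 0) (fun x => G x i) x - partialD 0 (peval p) x| ≤
          C * K * E.diam ^ l) ∧
      ∀ᵐ x ∂volume.restrict E.carrier,
        |weakDeriv E.carrier (0, 1) (fun x => G x i) x - partialD 1 (peval p) x| ≤
          C * K * E.diam ^ l := by
  obtain ⟨N, hN, hpieces⟩ := exists_starPieces ha
  obtain ⟨C₁, hC₁, hT₁⟩ := exists_multiD_taylorSum_sub_bound l (1, 0)
  obtain ⟨C₂, hC₂, hT₂⟩ := exists_multiD_taylorSum_sub_bound l (0, 1)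
  set D : ℝ := (2 * (2 * N : ℕ)) ^ (l + 1) with hD
  set D' : ℝ := (2 * (2 * N : ℕ)) ^ l with hD'
  refine ⟨C₁ + C₂ + D + D', by positivity, ?_⟩
  intro E hE hd1 x₀ hx₀ G j₀ M K hG i
  have hd := E.diam_pos
  have hK0 : 0 ≤ K := hG.nonneg.trans hG.le
  have hU := E.isOpen
  have hfin : volume E.carrier ≠ ∞ := E.isBounded.measure_lt_top.ne
  obtain ⟨S, c, hcov, hS⟩ := hpieces E hE
  have hchain : ∀ x ∈ E.carrier, SegChain E.carrier (2 * N) x₀ x := fun x hx => by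
    have hconn := E.isConnected.isPreconnected
    rw [hcov] at hx hx₀ hconn ⊢
    exact segChain_of_starPieces (by positivity) hS hconn hx₀ hx
  obtain ⟨α, hα, hαT⟩ := exists_taylorSum_approx hU (d := E.diam) (n := 2 * N) (l := l)
    (by omega) (fun x hx y hy => E.dist_le_diam hx hy) hx₀ hchain (u := fun x => G x i)
    (w := fun β => weakDeriv E.carrier β fun x => G x i)
    (M := fun β => if β.1 + β.2 = 1 then M else K) (K := K) (hG.integrable i)
    (fun β hβ => ⟨hG.weak i β hβ,
      (hG.weak i β hβ).integrableOn_of_abs_le hfin (hG.abs_le i β hβ), by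
        split_ifs with h
        · exact hG.abs_le_one i β h
        · exact hG.abs_le i β hβ⟩)
    (fun β hβ => by rw [if_neg (by omega)])
  obtain ⟨p, hp, hpe⟩ := exists_poly_eq_monoSum l x₀ 1 fun β =>
    α β / (β.1.factorial * β.2.factorial)
  have hpT : peval p = taylorSum l x₀ α := funext hpe
  have hαK : ∀ γ : ℕ × ℕ, γ.1 + γ.2 ≤ l → |α γ| ≤ K := fun γ hγ => by
    refine (hα γ hγ).trans ?_
    split_ifs
    exacts [hG.le, le_rfl]
  have hsum : ∀ C' ≤ C₁ + C₂ + D + D', ∀ e : ℝ, 0 ≤ e →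
      C' * K * e ≤ (C₁ + C₂ + D + D') * K * e := fun C' h e he => by gcongr
  have hDp : 0 < D := by positivity
  have hDp' : 0 < D' := by positivity
  refine ⟨p, hp, fun j => ?_, ?_, fun j x hx => ?_, ?_, ?_, ?_⟩
  · rw [hpT]
    fin_cases j
    · change |multiD (1, 0) (taylorSum l x₀ α) x₀| ≤ M
      rw [multiD_taylorSum_self x₀ α (by simpa using hl)]
      simpa using hα (1, 0) (by simpa using hl)
    · change |multiD (0, 1) (taylorSum l x₀ α) x₀| ≤ M
      rw [multiD_taylorSum_self x₀ α (by simpa using hl)]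
      simpa using hα (0, 1) (by simpa using hl)
  · have hmono : ∀ β : ℕ × ℕ, ∃ q : Poly, q.totalDegree ≤ l ∧
        ∀ x, multiD β (taylorSum l x₀ α) x = peval q x := fun β => by
      have hpoly : ∀ γ : ℕ × ℕ, ∃ q : Poly, γ ∈ multiIdx l → q.totalDegree ≤ l ∧
          ∀ x, peval q x = scaledMono x₀ 1 (γ.1 - β.1, γ.2 - β.2) x := fun γ => by
        by_cases hγ : γ ∈ multiIdx l
        · rw [mem_multiIdx] at hγ
          obtain ⟨q, hq, hqe⟩ := exists_poly_eq_monoSum l x₀ 1 fun η =>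
            if η = (γ.1 - β.1, γ.2 - β.2) then 1 else 0
          refine ⟨q, fun _ => ⟨hq, fun x => ?_⟩⟩
          rw [hqe, monoSum, Finset.sum_eq_single (γ.1 - β.1, γ.2 - β.2)]
          · simp
          · intro η _ h
            simp [h]
          · intro h
            exact absurd (mem_multiIdx.2 (by simp only; omega)) h
        · exact ⟨0, fun h => absurd h hγ⟩
      choose q hq using hpoly
      refine ⟨∑ γ ∈ multiIdx l, MvPolynomial.C (α γ / (γ.1.factorial * γ.2.factorial) *
        γ.2.descFactorial β.2 * γ.1.descFactorial β.1) * q γ, ?_, fun x => ?_⟩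
      · refine MvPolynomial.totalDegree_finsetSum_le fun γ hγ => ?_
        refine (MvPolynomial.totalDegree_mul _ _).trans ?_
        rw [MvPolynomial.totalDegree_C, zero_add]
        exact (hq γ hγ).1
      · rw [taylorSum, multiD_monoSum, peval, map_sum]
        refine Finset.sum_congr rfl fun γ hγ => ?_
        rw [map_mul, MvPolynomial.eval_C, ← (hq γ hγ).2 x, peval]
    obtain ⟨q₁, hq₁, hq₁e⟩ := hmono (2, 0)
    obtain ⟨q₂, hq₂, hq₂e⟩ := hmono (0, 2)
    refine ⟨q₁ + q₂, (MvPolynomial.totalDegree_add _ _).trans (max_le hq₁ hq₂), fun x => ?_⟩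
    rw [hpT, laplacian, hq₁e, hq₂e, peval_add]
  · rw [hpT]
    fin_cases j
    · exact (hT₁ x₀ α K E.diam hd hd1 hαK x hx).trans (hsum _ (by linarith) _ hd.le)
    · exact (hT₂ x₀ α K E.diam hd hd1 hαK x hx).trans (hsum _ (by linarith) _ hd.le)
  · have h0 := weakDeriv_ae_eq hU (hasWeakDeriv_zero (hG.integrable i).locallyIntegrableOn)
    filter_upwards [h0, hαT] with x hx hT
    have h1 := hT (0, 0) (by simp)
    rw [hx, hpT.symm] at h1
    refine Eq.trans_le rfl (h1.trans ?_)
    simp only [add_zero, Nat.sub_zero, mul_pow]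
    refine le_trans (le_of_eq ?_) (hsum D (by linarith) _ (by positivity))
    rw [hD, mul_pow]
    ring
  · filter_upwards [hαT] with x hT
    have h1 := hT (1, 0) (by simpa using hl)
    rw [hpT.symm] at h1
    refine Eq.trans_le rfl (h1.trans ?_)
    simp only [add_zero, Nat.add_sub_cancel, mul_pow]
    refine le_trans (le_of_eq ?_) (hsum D' (by linarith) _ (by positivity))
    rw [hD', mul_pow]
    ring
  · filter_upwards [hαT] with x hT
    have h1 := hT (0, 1) (by simpa using hl)
    rw [hpT.symm] at h1
    refine Eq.trans_le rfl (h1.trans ?_)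
    simp only [zero_add, Nat.add_sub_cancel, mul_pow]
    refine le_trans (le_of_eq ?_) (hsum D' (by linarith) _ (by positivity))
    rw [hD', mul_pow]
    ring

/-! ### Polynomial vector fields -/

/-- The vector field with polynomial components `p 0` and `p 1`. -/
noncomputable def polyField (p : Fin 2 → Poly) (x : Plane) : Plane :=
  WithLp.toLp 2 fun i => peval (p i) x

theorem continuous_polyField (p : Fin 2 → Poly) : Continuous (polyField p) :=
  (PiLp.continuous_toLp 2 _).comp (continuous_pi fun i => peval_continuous (p i))

theorem norm_le_abs_add_abs (v : Plane) : ‖v‖ ≤ |v 0| + |v 1| := by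
  rw [EuclideanSpace.norm_eq, Fin.sum_univ_two, Real.sqrt_le_left (by positivity),
    Real.norm_eq_abs, Real.norm_eq_abs]
  nlinarith [mul_nonneg (abs_nonneg (v 0)) (abs_nonneg (v 1))]

theorem dist_le_of_abs_le {x y : Plane} {δ : ℝ} (h : ∀ i, |x i - y i| ≤ δ) :
    dist x y ≤ 2 * δ := by
  rw [dist_eq_norm]
  refine (norm_le_abs_add_abs _).trans ?_
  have h0 := h 0
  have h1 := h 1
  simp only [PiLp.sub_apply]
  linarith

/-- The linear map with matrix `b`. -/
noncomputable def matMap (b : Fin 2 → Fin 2 → ℝ) : Plane →L[ℝ] Plane :=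
  LinearMap.toContinuousLinearMap
    { toFun := fun v => WithLp.toLp 2 fun i => b i 0 * v 0 + b i 1 * v 1
      map_add' := fun v w => by
        ext i
        simp only [PiLp.add_apply]
        ring
      map_smul' := fun s v => by
        ext i
        simp only [PiLp.smul_apply, smul_eq_mul, RingHom.id_apply]
        ring }

@[simp] theorem matMap_apply (b : Fin 2 → Fin 2 → ℝ) (v : Plane) (i : Fin 2) :
    matMap b v i = b i 0 * v 0 + b i 1 * v 1 := rfl

theorem norm_matMap_le {b : Fin 2 → Fin 2 → ℝ} {η : ℝ} (h : ∀ i j, |b i j| ≤ η) :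
    ‖matMap b‖ ≤ 4 * η := by
  have hη : 0 ≤ η := (abs_nonneg _).trans (h 0 0)
  refine ContinuousLinearMap.opNorm_le_bound _ (by positivity) fun v => ?_
  have key : ∀ i, |matMap b v i| ≤ 2 * η * ‖v‖ := fun i => by
    rw [matMap_apply]
    refine (abs_add_le _ _).trans ?_
    rw [abs_mul, abs_mul]
    have h0 := mul_le_mul (h i 0) (abs_coord_le v 0) (abs_nonneg _) hη
    have h1 := mul_le_mul (h i 1) (abs_coord_le v 1) (abs_nonneg _) hη
    linarith
  refine (norm_le_abs_add_abs _).trans ?_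
  linarith [key 0, key 1]

theorem matMap_sub (b b' : Fin 2 → Fin 2 → ℝ) :
    matMap b - matMap b' = matMap fun i j => b i j - b' i j := by
  ext v i
  simp only [_root_.sub_apply, PiLp.sub_apply, matMap_apply]
  ring

theorem hasFDerivAt_polyField (p : Fin 2 → Poly) (x : Plane) :
    HasFDerivAt (polyField p) (matMap fun i j => partialD j (peval (p i)) x) x := by
  rw [← hasFDerivWithinAt_univ, hasFDerivWithinAt_euclidean]
  intro i
  have h1 := ((peval_contDiff (p i)).differentiable (n := 1) one_ne_zero x).hasFDerivAt
  refine (h1.congr_fderiv ?_).hasFDerivWithinAt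
  ext v
  rw [fderiv_eq_partialD]
  change _ = matMap (fun i j => partialD j (peval (p i)) x) v i
  rw [matMap_apply]
  ring

/-- An invertible matrix as a linear isomorphism of the plane. -/
theorem exists_matMap_equiv {b : Fin 2 → Fin 2 → ℝ} {M j : ℝ} (hb : ∀ i j, |b i j| ≤ M)
    (hj : 0 < j) (hdet : j ≤ b 0 0 * b 1 1 - b 0 1 * b 1 0) :
    ∃ A : Plane ≃L[ℝ] Plane, (A : Plane →L[ℝ] Plane) = matMap b ∧
      ∀ v, ‖A.symm v‖ ≤ 4 * M / j * ‖v‖ := by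
  set D := b 0 0 * b 1 1 - b 0 1 * b 1 0 with hD
  have hD0 : 0 < D := hj.trans_le hdet
  let b' : Fin 2 → Fin 2 → ℝ := ![![b 1 1 / D, -b 0 1 / D], ![-b 1 0 / D, b 0 0 / D]]
  have hb' : ∀ i k, |b' i k| ≤ M / j := by
    have key : ∀ t, |t| ≤ M → |t / D| ≤ M / j := fun t ht => by
      rw [abs_div, abs_of_pos hD0]
      gcongr
      exact (abs_nonneg _).trans ht
    intro i k
    fin_cases i <;> fin_cases k
    · exact key _ (hb 1 1)
    · exact key _ (by rw [abs_neg]; exact hb 0 1)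
    · exact key _ (by rw [abs_neg]; exact hb 1 0)
    · exact key _ (hb 0 0)
  have hl : Function.LeftInverse (matMap b') (matMap b) := fun v => by
    ext i
    fin_cases i
    · simp only [Fin.zero_eta, matMap_apply, b', Matrix.cons_val_zero, Matrix.cons_val_one]
      field_simp
      rw [hD]
      ring
    · simp only [Fin.mk_one, matMap_apply, b', Matrix.cons_val_zero, Matrix.cons_val_one]
      field_simp
      rw [hD]
      ring
  have hr : Function.RightInverse (matMap b') (matMap b) := fun v => by
    ext i
    fin_cases i
    · simp only [Fin.zero_eta, matMap_apply, b', Matrix.cons_val_zero, Matrix.cons_val_one]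
      field_simp
      rw [hD]
      ring
    · simp only [Fin.mk_one, matMap_apply, b', Matrix.cons_val_zero, Matrix.cons_val_one]
      field_simp
      rw [hD]
      ring
  refine ⟨ContinuousLinearEquiv.equivOfInverse (matMap b) (matMap b') hl hr, rfl, fun v => ?_⟩
  change ‖matMap b' v‖ ≤ _
  refine ((matMap b').le_of_opNorm_le (norm_matMap_le hb') v).trans_eq ?_
  ring

theorem abs_det_sub_le {a b : Fin 2 → Fin 2 → ℝ} {M η : ℝ} (ha : ∀ i j, |a i j| ≤ M)
    (hb : ∀ i j, |b i j| ≤ M) (h : ∀ i j, |b i j - a i j| ≤ η) :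
    (b 0 0 * b 1 1 - b 0 1 * b 1 0) - (a 0 0 * a 1 1 - a 0 1 * a 1 0) ≤ 4 * M * η := by
  have hM : 0 ≤ M := (abs_nonneg _).trans (ha 0 0)
  have key : ∀ s t, |s| ≤ η → |t| ≤ M → |s * t| ≤ η * M := fun s t hs ht => by
    rw [abs_mul]
    exact mul_le_mul hs ht (abs_nonneg _) ((abs_nonneg _).trans hs)
  have h1 := (abs_le.1 (key _ _ (h 0 0) (hb 1 1))).2
  have h2 := (abs_le.1 (key _ _ (h 1 1) (ha 0 0))).2
  have h3 := (abs_le.1 (key _ _ (h 0 1) (hb 1 0))).1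
  have h4 := (abs_le.1 (key _ _ (h 1 0) (ha 0 1))).1
  nlinarith

/-- Approximation of a Sobolev field on an element by a nearly affine polynomial field. -/
theorem exists_taylor_field (l : ℕ) (hl : 1 ≤ l) {a j₀ : ℝ} (ha : 0 < a) (hj₀ : 0 < j₀) :
    ∃ C > 0, ∃ ε > 0, ∀ E : PolygonalElement, E.ShapeRegular a → E.diam ≤ 1 → ∀ x₀ ∈ E.carrier,
    ∀ (G : Plane → Plane) (M K : ℝ), FieldBounds l E.carrier G j₀ M K →
    (1 + K) ^ 2 * E.diam ≤ ε → ∃ (p : Fin 2 → Poly) (A : Plane ≃L[ℝ] Plane),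
      (∀ i, (p i).totalDegree ≤ l) ∧
      (∀ i, ∃ q : Poly, q.totalDegree ≤ l ∧ ∀ x, laplacian (peval (p i)) x = peval q x) ∧
      NearAffine (polyField p) A (8 * (1 + M) / j₀) (closedBall x₀ (2 * E.diam)) ∧
      (∀ x ∈ closedBall x₀ (2 * E.diam), ‖fderiv ℝ (polyField p) x‖ ≤ 4 * (1 + M)) ∧
      ∀ i, (∀ᵐ x ∂volume.restrict E.carrier, |G x i - peval (p i) x| ≤ C * K * E.diam ^ (l + 1)) ∧
        (∀ᵐ x ∂volume.restrict E.carrier,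
          |weakDeriv E.carrier (1, 0) (fun x => G x i) x - partialD 0 (peval (p i)) x| ≤
            C * K * E.diam ^ l) ∧
        ∀ᵐ x ∂volume.restrict E.carrier,
          |weakDeriv E.carrier (0, 1) (fun x => G x i) x - partialD 1 (peval (p i)) x| ≤
            C * K * E.diam ^ l := by
  obtain ⟨C, hC, hT⟩ := exists_taylor_poly l hl ha
  refine ⟨C, hC, min (j₀ / (64 * C)) (1 / C), by positivity, ?_⟩
  intro E hE hd1 x₀ hx₀ G M K hG hε
  have hd := E.diam_pos
  have hM0 := hG.nonneg
  have hMK := hG.le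
  have hK0 : 0 ≤ K := hM0.trans hMK
  choose p hp hp₁ hlap hpd h0 h10 h01 using hT E hE hd1 x₀ hx₀ G j₀ M K hG
  let b : Fin 2 → Fin 2 → ℝ := fun i j => partialD j (peval (p i)) x₀
  have hεj : 64 * C * (1 + K) ^ 2 * E.diam ≤ j₀ := by
    have := hε.trans (min_le_left _ _)
    rw [le_div_iff₀ (by positivity)] at this
    linarith
  have hε1 : C * K * E.diam ≤ 1 := by
    have := hε.trans (min_le_right _ _)
    rw [le_div_iff₀ hC] at this
    have h2 : K ≤ (1 + K) ^ 2 := by nlinarith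
    calc C * K * E.diam ≤ C * (1 + K) ^ 2 * E.diam := by gcongr
      _ ≤ 1 := by linarith
  have hpos : (0 : ℝ≥0∞) < volume E.carrier := E.isOpen.measure_pos _ E.isConnected.nonempty
  have hneBot : (ae (volume.restrict E.carrier)).NeBot := ae_restrict_neBot.2 hpos.ne'
  have hdet : j₀ / 2 ≤ b 0 0 * b 1 1 - b 0 1 * b 1 0 := by
    have hall : ∀ᵐ x ∂volume.restrict E.carrier, ∀ i j : Fin 2,
        |weakDeriv E.carrier (if j = 0 then (1, 0) else (0, 1)) (fun x => G x i) x -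
          partialD j (peval (p i)) x| ≤ C * K * E.diam ^ l ∧
        |weakDeriv E.carrier (if j = 0 then (1, 0) else (0, 1)) (fun x => G x i) x| ≤ M := by
      rw [ae_all_iff]
      intro i
      rw [ae_all_iff]
      intro j
      fin_cases j
      · exact (h10 i).and (hG.abs_le_one i (1, 0) rfl)
      · exact (h01 i).and (hG.abs_le_one i (0, 1) rfl)
    obtain ⟨x, ⟨hx, hxd⟩, hxE⟩ :=
      ((hall.and hG.det).and (ae_restrict_mem E.isOpen.measurableSet)).exists
    let b' : Fin 2 → Fin 2 → ℝ := fun i j =>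
      weakDeriv E.carrier (if j = 0 then (1, 0) else (0, 1)) (fun x => G x i) x
    have hb' : jacobianDet E.carrier G x = b' 0 0 * b' 1 1 - b' 0 1 * b' 1 0 := by
      rw [jacobianDet, Matrix.det_fin_two]
      rfl
    have hdist : dist x x₀ ≤ 2 * E.diam := by linarith [E.dist_le_diam hxE hx₀]
    have hbb : ∀ i j, |b' i j - b i j| ≤ 2 * (C * K * E.diam) := fun i j => by
      have h1 := (hx i j).1
      have h2 := hpd i j x hdist
      have h3 : C * K * E.diam ^ l ≤ C * K * E.diam := by
        have : E.diam ^ l ≤ E.diam := by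
          calc E.diam ^ l ≤ E.diam ^ 1 := pow_le_pow_of_le_one hd.le hd1 hl
            _ = E.diam := pow_one _
        gcongr
      calc |b' i j - b i j| ≤ |b' i j - partialD j (peval (p i)) x| +
            |partialD j (peval (p i)) x - b i j| := abs_sub_le _ _ _
        _ ≤ _ := by linarith
    have h4 := abs_det_sub_le (a := b) (b := b') (fun i j => hp₁ i j) (fun i j => (hx i j).2) hbb
    rw [← hb'] at h4
    have h5 : 4 * M * (2 * (C * K * E.diam)) ≤ j₀ / 2 := by
      have : M * K ≤ (1 + K) ^ 2 := by nlinarith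
      calc 4 * M * (2 * (C * K * E.diam)) = 8 * C * (M * K) * E.diam := by ring
        _ ≤ 8 * C * (1 + K) ^ 2 * E.diam := by gcongr
        _ ≤ j₀ / 2 := by linarith
    linarith
  obtain ⟨A, hA, hAs⟩ := exists_matMap_equiv (b := b) (M := M) (fun i j => hp₁ i j)
    (half_pos hj₀) hdet
  have hΛ : 0 < 8 * (1 + M) / j₀ := by positivity
  have hderiv : ∀ x, fderiv ℝ (polyField p) x = matMap fun i j => partialD j (peval (p i)) x :=
    fun x => (hasFDerivAt_polyField p x).fderiv
  refine ⟨p, A, hp, hlap, ⟨hΛ, fun v => (hAs v).trans ?_, continuous_polyField p, ?_⟩, ?_,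
    fun i => ⟨h0 i, h10 i, h01 i⟩⟩
  · refine mul_le_mul_of_nonneg_right ?_ (norm_nonneg v)
    rw [div_le_div_iff₀ (by positivity) hj₀]
    nlinarith
  · intro x hx z hz
    have h1 := (convex_closedBall x₀ (2 * E.diam)).norm_image_sub_le_of_norm_fderiv_le'
      (φ := (A : Plane →L[ℝ] Plane)) (C := 4 * (C * K * E.diam))
      (fun x _ => (hasFDerivAt_polyField p x).differentiableAt) (fun x hx => by
        rw [hderiv, hA, matMap_sub]
        exact norm_matMap_le fun i j => hpd i j x (mem_closedBall.1 hx)) hx hz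
    refine h1.trans ?_
    rw [div_eq_mul_inv, mul_comm]
    refine mul_le_mul_of_nonneg_left ?_ (norm_nonneg _)
    rw [← one_div, le_div_iff₀ (by positivity)]
    have : K * (1 + M) ≤ (1 + K) ^ 2 := by nlinarith
    have h2 : 64 * C * (K * (1 + M)) * E.diam ≤ j₀ := by
      refine le_trans ?_ hεj
      gcongr
    rw [show 4 * (C * K * E.diam) * (2 * (8 * (1 + M) / j₀)) =
      64 * C * (K * (1 + M)) * E.diam / j₀ by ring, div_le_one hj₀]
    exact h2
  · intro x hx
    rw [hderiv]
    refine norm_matMap_le fun i j => ?_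
    have h1 := hpd i j x (mem_closedBall.1 hx)
    have h2 := hp₁ i j
    have h3 := abs_add_le (partialD j (peval (p i)) x - partialD j (peval (p i)) x₀)
      (partialD j (peval (p i)) x₀)
    rw [sub_add_cancel] at h3
    linarith

/-! ### The `L²` norm and the `L²` projection -/

theorem l2Norm_eq {ω : Set Plane} {u : Plane → ℝ} (hu : MemLp u 2 (volume.restrict ω)) :
    l2Norm ω u = ENNReal.ofReal √(∫ x in ω, u x ^ 2) := by
  rw [l2Norm, hu.eLpNorm_eq_integral_rpow_norm two_ne_zero ENNReal.ofNat_ne_top]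
  congr 1
  rw [Real.sqrt_eq_rpow]
  simp

theorem integral_abs_mul_le {ω : Set Plane} {f g : Plane → ℝ} (hf : MemLp f 2 (volume.restrict ω))
    (hg : MemLp g 2 (volume.restrict ω)) :
    ∫ x in ω, |f x| * |g x| ≤ √(∫ x in ω, f x ^ 2) * √(∫ x in ω, g x ^ 2) := by
  have h := integral_mul_norm_le_Lp_mul_Lq (μ := volume.restrict ω) (f := f) (g := g)
    Real.HolderConjugate.two_two (by simpa using hf) (by simpa using hg)
  simpa [Real.sqrt_eq_rpow] using h

theorem memLp_two_of_continuous {ω : Set Plane} (hω : Bornology.IsBounded ω) {f : Plane → ℝ}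
    (hf : Continuous f) : MemLp f 2 (volume.restrict ω) := by
  obtain ⟨C, hC⟩ := hω.isCompact_closure.exists_bound_of_continuousOn hf.continuousOn
  have : IsFiniteMeasure (volume.restrict ω) := isFiniteMeasure_restrict.2 hω.measure_lt_top.ne
  have h2 : ∀ᵐ x ∂volume.restrict (closure ω), ‖f x‖ ≤ C :=
    (ae_restrict_iff' isClosed_closure.measurableSet).2 (ae_of_all _ hC)
  exact MemLp.of_bound hf.aestronglyMeasurable C
    (ae_mono (Measure.restrict_mono subset_closure le_rfl) h2)

theorem integrable_mul_of_memLp {ω : Set Plane} {f g : Plane → ℝ}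
    (hf : MemLp f 2 (volume.restrict ω)) (hg : MemLp g 2 (volume.restrict ω)) :
    IntegrableOn (fun x => f x * g x) ω :=
  hf.integrable_mul hg

theorem integrable_sq_of_memLp {ω : Set Plane} {f : Plane → ℝ}
    (hf : MemLp f 2 (volume.restrict ω)) : IntegrableOn (fun x => f x ^ 2) ω :=
  hf.integrable_sq

/-- Polynomials of bounded degree are determined by their moments, which can be prescribed. -/
theorem exists_poly_moments (k : ℕ) {ω : Set Plane} (hω : Bornology.IsBounded ω)
    {z : Plane} {r : ℝ} (hr : 0 < r) (hball : ball z r ⊆ ω)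
    (y : Plane) {d : ℝ} (hd : 0 < d) (b : ℕ × ℕ → ℝ) : ∃! p : Poly, p.totalDegree ≤ k ∧
      ∀ β ∈ multiIdx k, ∫ x in ω, peval p x * scaledMono y d β x = b β := by
  classical
  have hm : ∀ β, MemLp (scaledMono y d β) 2 (volume.restrict ω) := fun β =>
    memLp_two_of_continuous hω (continuous_scaledMono y d β)
  have hmm : ∀ γ β, IntegrableOn (fun x => scaledMono y d γ x * scaledMono y d β x) ω :=
    fun γ β => integrable_mul_of_memLp (hm γ) (hm β)
  let g : ℕ × ℕ → ℕ × ℕ → ℝ := fun γ β => ∫ x in ω, scaledMono y d γ x * scaledMono y d β x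
  have hsum : ∀ (c : ℕ × ℕ → ℝ) (β : ℕ × ℕ), ∫ x in ω, monoSum k y d c x * scaledMono y d β x =
      ∑ γ ∈ multiIdx k, c γ * g γ β := fun c β => by
    simp only [monoSum, Finset.sum_mul, mul_assoc]
    rw [integral_finsetSum _ fun γ _ => (hmm γ β).const_mul _]
    simp only [integral_const_mul, g]
  have hzero : ∀ c : ℕ × ℕ → ℝ, (∀ β ∈ multiIdx k, ∑ γ ∈ multiIdx k, c γ * g γ β = 0) →
      ∀ x, monoSum k y d c x = 0 := by
    intro c hc
    have h1 : ∫ x in ω, monoSum k y d c x ^ 2 = 0 := by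
      have h2 : ∀ x, monoSum k y d c x ^ 2 =
          ∑ β ∈ multiIdx k, c β * (monoSum k y d c x * scaledMono y d β x) := fun x => by
        have e : monoSum k y d c x ^ 2 =
            (∑ β ∈ multiIdx k, c β * scaledMono y d β x) * monoSum k y d c x := sq _
        rw [e, Finset.sum_mul]
        refine Finset.sum_congr rfl fun β _ => ?_
        ring
      have h3 : ∀ β, IntegrableOn (fun x => monoSum k y d c x * scaledMono y d β x) ω :=
        fun β => integrable_mul_of_memLp
          (memLp_two_of_continuous hω (continuous_monoSum k y d c)) (hm β)
      simp only [h2]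
      rw [integral_finsetSum _ fun β _ => (h3 β).const_mul _]
      refine Finset.sum_eq_zero fun β hβ => ?_
      rw [integral_const_mul, hsum, hc β hβ, mul_zero]
    have hi : IntegrableOn (fun x => monoSum k y d c x ^ 2) ω :=
      integrable_sq_of_memLp (memLp_two_of_continuous hω (continuous_monoSum k y d c))
    have h2 : ∫ x in ball z r, monoSum k y d c x ^ 2 ≤ 0 := h1 ▸
      setIntegral_mono_set hi (ae_of_all _ fun x => sq_nonneg _) hball.eventuallyLE
    obtain ⟨p, hp, hpe⟩ := exists_poly_eq_monoSum k y d c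
    obtain ⟨c', hc'⟩ := exists_peval_eq_monoSum hp z hr.ne'
    obtain ⟨κ, hκ, hcoef⟩ := exists_coef_bound k
    have h3 := hcoef z r hr c'
    simp only [← hc', hpe] at h3
    have h4 : ∑ β ∈ multiIdx k, c' β ^ 2 ≤ 0 := by
      by_contra! hlt
      have : 0 < κ * r ^ 2 * ∑ β ∈ multiIdx k, c' β ^ 2 := by positivity
      linarith
    have h5 := (Finset.sum_eq_zero_iff_of_nonneg fun β _ => sq_nonneg (c' β)).1
      (le_antisymm h4 (Finset.sum_nonneg fun β _ => sq_nonneg _))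
    intro x
    rw [← hpe, hc', monoSum]
    refine Finset.sum_eq_zero fun β hβ => ?_
    rw [pow_eq_zero_iff two_ne_zero |>.1 (h5 β hβ), zero_mul]
  let Idx := {β // β ∈ multiIdx k}
  let ext : (Idx → ℝ) → ℕ × ℕ → ℝ := fun c β => if h : β ∈ multiIdx k then c ⟨β, h⟩ else 0
  have hext : ∀ c : Idx → ℝ, ∀ β, ∑ γ ∈ multiIdx k, ext c γ * g γ β =
      ∑ γ : Idx, c γ * g γ β := fun c β => by
    rw [← Finset.sum_coe_sort (multiIdx k)]
    refine Finset.sum_congr rfl fun γ _ => ?_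
    simp only [ext, γ.2, dif_pos]
  let L : (Idx → ℝ) →ₗ[ℝ] (Idx → ℝ) :=
    { toFun := fun c β => ∑ γ : Idx, c γ * g γ β
      map_add' := fun c c' => by
        funext β
        simp only [Pi.add_apply, add_mul, Finset.sum_add_distrib]
      map_smul' := fun s c => by
        funext β
        simp only [Pi.smul_apply, smul_eq_mul, RingHom.id_apply, Finset.mul_sum, mul_assoc] }
  have hpos : 0 < r := hr
  have hinj : Function.Injective L := by
    rw [injective_iff_map_eq_zero]
    intro c hc
    have h1 := hzero (ext c) fun β hβ => by
      rw [hext]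
      exact congrFun hc ⟨β, hβ⟩
    obtain ⟨κ, hκ, hcoef⟩ := exists_coef_bound k
    have h2 := hcoef y d hd (ext c)
    simp only [h1] at h2
    have h3 : ∑ β ∈ multiIdx k, ext c β ^ 2 ≤ 0 := by
      by_contra! hlt
      have : 0 < κ * d ^ 2 * ∑ β ∈ multiIdx k, ext c β ^ 2 := by positivity
      simp at h2
      linarith
    have h4 := (Finset.sum_eq_zero_iff_of_nonneg fun β _ => sq_nonneg (ext c β)).1
      (le_antisymm h3 (Finset.sum_nonneg fun β _ => sq_nonneg _))
    funext β
    have h5 := pow_eq_zero_iff two_ne_zero |>.1 (h4 β β.2)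
    simp only [ext, β.2, dif_pos] at h5
    exact h5
  obtain ⟨c, hc⟩ := (LinearMap.injective_iff_surjective.1 hinj) fun β => b β
  obtain ⟨p, hp, hpe⟩ := exists_poly_eq_monoSum k y d (ext c)
  refine ⟨p, ⟨hp, fun β hβ => ?_⟩, fun p' hp' => ?_⟩
  · simp only [hpe, hsum, hext]
    exact congrFun hc ⟨β, hβ⟩
  · obtain ⟨c', hc'⟩ := exists_peval_eq_monoSum hp'.1 y hd.ne'
    refine peval_injective fun x => ?_
    have h1 := hzero (fun β => c' β - ext c β) fun β hβ => by
      have h2 := hp'.2 β hβ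
      simp only [hc', hsum] at h2
      simp only [sub_mul, Finset.sum_sub_distrib, h2, hext]
      exact sub_eq_zero.2 (congrFun hc ⟨β, hβ⟩).symm
    have h3 := h1 x
    simp only [monoSum, sub_mul, Finset.sum_sub_distrib] at h3
    rw [hc', hpe]
    exact sub_eq_zero.1 h3

theorem exists_isL2Proj (k : ℕ) {ω : Set Plane} (hω : Bornology.IsBounded ω)
    {z : Plane} {r : ℝ} (hr : 0 < r) (hball : ball z r ⊆ ω) {v : Plane → ℝ}
    (hv : MemLp v 2 (volume.restrict ω)) : IsL2Proj k ω v (l2Proj k ω v) := by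
  have hex : ∃ p, IsL2Proj k ω v p := by
    obtain ⟨p, ⟨hp, hpm⟩, -⟩ := exists_poly_moments k hω hr hball 0 one_pos
      fun β => ∫ x in ω, v x * scaledMono 0 1 β x
    refine ⟨p, hp, fun q hq => ?_⟩
    obtain ⟨c, hc⟩ := exists_peval_eq_monoSum hq 0 one_ne_zero
    have hvp : MemLp (fun x => v x - peval p x) 2 (volume.restrict ω) :=
      hv.sub (memLp_two_of_continuous hω (peval_continuous p))
    have hm : ∀ β, MemLp (scaledMono 0 1 β) 2 (volume.restrict ω) := fun β =>
      memLp_two_of_continuous hω (continuous_scaledMono 0 1 β)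
    have h1 : ∀ x, (v x - peval p x) * peval q x =
        ∑ β ∈ multiIdx k, c β * ((v x - peval p x) * scaledMono 0 1 β x) := fun x => by
      rw [hc, monoSum, Finset.mul_sum]
      exact Finset.sum_congr rfl fun β _ => by ring
    simp only [h1]
    rw [integral_finsetSum _ fun β _ => (integrable_mul_of_memLp hvp (hm β)).const_mul _]
    refine Finset.sum_eq_zero fun β hβ => ?_
    rw [integral_const_mul]
    simp only [sub_mul]
    rw [integral_sub (integrable_mul_of_memLp hv (hm β)) (integrable_mul_of_memLp
      (memLp_two_of_continuous hω (peval_continuous p)) (hm β)), hpm β hβ, sub_self, mul_zero]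
  rw [l2Proj, dif_pos hex]
  exact hex.choose_spec

/-- The `L²` projection is nonexpansive. -/
theorem IsL2Proj.integral_sq_sub_le {k : ℕ} {ω : Set Plane} (hω : Bornology.IsBounded ω)
    {v : Plane → ℝ} (hv : MemLp v 2 (volume.restrict ω)) {P p : Poly} (hP : IsL2Proj k ω v P)
    (hp : p.totalDegree ≤ k) :
    ∫ x in ω, peval (P - p) x ^ 2 ≤ ∫ x in ω, (v x - peval p x) ^ 2 := by
  have hc : ∀ q : Poly, MemLp (peval q) 2 (volume.restrict ω) := fun q =>
    memLp_two_of_continuous hω (peval_continuous q)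
  have h1 := hP.2 (P - p) (totalDegree_sub_le hP.1 hp)
  have hvP : MemLp (fun x => v x - peval P x) 2 (volume.restrict ω) := hv.sub (hc P)
  have h2 : ∀ x, (v x - peval p x) ^ 2 = (v x - peval P x) ^ 2 +
      2 * ((v x - peval P x) * peval (P - p) x) + peval (P - p) x ^ 2 := fun x => by
    rw [peval_sub]
    ring
  have i1 : IntegrableOn (fun x => (v x - peval P x) ^ 2 +
      2 * ((v x - peval P x) * peval (P - p) x)) ω :=
    (integrable_sq_of_memLp hvP).add ((integrable_mul_of_memLp hvP (hc _)).const_mul 2)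
  simp only [h2]
  rw [integral_add i1 (integrable_sq_of_memLp (hc _)),
    integral_add (integrable_sq_of_memLp hvP) ((integrable_mul_of_memLp hvP (hc _)).const_mul 2),
    integral_const_mul, h1, mul_zero, add_zero]
  exact le_add_of_nonneg_left (integral_nonneg fun _ => sq_nonneg _)

/-! ### Norms of vector fields -/

theorem le_rpow_sum_sq {ι : Type*} {s : Finset ι} {f : ι → ℝ≥0∞} {i : ι} (hi : i ∈ s) :
    f i ≤ (∑ j ∈ s, f j ^ 2) ^ (1 / 2 : ℝ) := by
  have h1 : f i ^ 2 ≤ ∑ j ∈ s, f j ^ 2 :=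
    Finset.single_le_sum (f := fun j => f j ^ 2) (fun _ _ => zero_le) hi
  calc f i = (f i ^ 2) ^ (1 / 2 : ℝ) := by
        rw [← ENNReal.rpow_natCast, ← ENNReal.rpow_mul]
        norm_num
    _ ≤ _ := ENNReal.rpow_le_rpow h1 (by norm_num)

theorem rpow_sum_sq_le {ι : Type*} {s : Finset ι} {f : ι → ℝ≥0∞} {b : ℝ≥0∞}
    (h : ∀ i ∈ s, f i ≤ b) : (∑ j ∈ s, f j ^ 2) ^ (1 / 2 : ℝ) ≤ s.card * b := by
  have h1 : ∑ j ∈ s, f j ^ 2 ≤ (s.card * b) ^ 2 := by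
    calc ∑ j ∈ s, f j ^ 2 ≤ ∑ _j ∈ s, b ^ 2 :=
          Finset.sum_le_sum fun i hi => pow_le_pow_left' (h i hi) 2
      _ = s.card * b ^ 2 := by rw [Finset.sum_const, nsmul_eq_mul]
      _ ≤ (s.card : ℝ≥0∞) ^ 2 * b ^ 2 := by
          gcongr
          have : s.card ≤ s.card ^ 2 := Nat.le_self_pow two_ne_zero _
          exact_mod_cast this
      _ = (s.card * b) ^ 2 := by rw [mul_pow]
  calc (∑ j ∈ s, f j ^ 2) ^ (1 / 2 : ℝ) ≤ ((s.card * b) ^ 2) ^ (1 / 2 : ℝ) :=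
        ENNReal.rpow_le_rpow h1 (by norm_num)
    _ = _ := by
        rw [← ENNReal.rpow_natCast, ← ENNReal.rpow_mul]
        norm_num

theorem l2Norm_le_vecL2Norm (ω : Set Plane) (G : Plane → Plane) (i : Fin 2) :
    l2Norm ω (fun x => G x i) ≤ vecL2Norm ω G :=
  le_rpow_sum_sq (f := fun i => l2Norm ω fun x => G x i) (Finset.mem_univ i)

theorem vecSeminorm_eq (r : ℕ) (ω : Set Plane) (G : Plane → Plane) : vecSeminorm r ω G =
    (∑ j ∈ (Finset.univ : Finset (Fin 2)) ×ˢ Finset.HasAntidiagonal.antidiagonal r,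
      l2Norm ω (weakDeriv ω j.2 (fun x => G x j.1)) ^ 2) ^ (1 / 2 : ℝ) := by
  rw [vecSeminorm, Finset.sum_product]

theorem l2Norm_le_vecSeminorm {r : ℕ} (ω : Set Plane) (G : Plane → Plane) (i : Fin 2) {β : ℕ × ℕ}
    (hβ : β.1 + β.2 = r) : l2Norm ω (weakDeriv ω β fun x => G x i) ≤ vecSeminorm r ω G := by
  rw [vecSeminorm_eq]
  exact le_rpow_sum_sq (f := fun j : Fin 2 × (ℕ × ℕ) => l2Norm ω (weakDeriv ω j.2 fun x => G x j.1))
    (i := (i, β)) (Finset.mem_product.2 ⟨Finset.mem_univ _, Finset.HasAntidiagonal.mem_antidiagonal.2 hβ⟩)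

theorem vecSeminorm_le {r : ℕ} {ω : Set Plane} {G : Plane → Plane} {b : ℝ≥0∞}
    (h : ∀ i, ∀ β : ℕ × ℕ, β.1 + β.2 = r → l2Norm ω (weakDeriv ω β fun x => G x i) ≤ b) :
    vecSeminorm r ω G ≤ (2 * (r + 1) : ℕ) * b := by
  rw [vecSeminorm_eq]
  refine (rpow_sum_sq_le (b := b) fun j hj => ?_).trans_eq ?_
  · exact h j.1 j.2 (Finset.HasAntidiagonal.mem_antidiagonal.1 (Finset.mem_product.1 hj).2)
  · rw [Finset.card_product, Finset.card_univ, Fintype.card_fin, Finset.Nat.card_antidiagonal]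

theorem l2Norm_le_of_ae_le {ω : Set Plane} {u : Plane → ℝ} {K v : ℝ} (hv : 0 ≤ v)
    (hω : volume ω ≤ ENNReal.ofReal (v ^ 2)) (h : ∀ᵐ x ∂volume.restrict ω, |u x| ≤ K) :
    l2Norm ω u ≤ ENNReal.ofReal (v * K) := by
  refine (eLpNorm_le_of_ae_bound h).trans ?_
  rw [ENNReal.ofReal_mul hv]
  gcongr
  rw [Measure.restrict_apply_univ, ENNReal.toReal_ofNat]
  calc volume ω ^ (2 : ℝ)⁻¹ ≤ ENNReal.ofReal (v ^ 2) ^ (2 : ℝ)⁻¹ :=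
        ENNReal.rpow_le_rpow hω (by norm_num)
    _ = ENNReal.ofReal v := by
        rw [ENNReal.ofReal_rpow_of_nonneg (by positivity) (by norm_num), ← Real.rpow_natCast,
          ← Real.rpow_mul hv]
        norm_num

theorem integral_abs_le_of_l2Norm_le {ω : Set Plane} {u : Plane → ℝ} {b v : ℝ} (hv : 0 ≤ v)
    (hb : 0 ≤ b) (hω : volume ω ≤ ENNReal.ofReal (v ^ 2))
    (hu : AEStronglyMeasurable u (volume.restrict ω)) (h : l2Norm ω u ≤ ENNReal.ofReal b) :
    MemLp u 2 (volume.restrict ω) ∧ IntegrableOn u ω ∧ ∫ x in ω, |u x| ≤ v * b := by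
  have hm : MemLp u 2 (volume.restrict ω) := ⟨hu, h.trans_lt ENNReal.ofReal_lt_top⟩
  have hfin : volume ω < ∞ := hω.trans_lt ENNReal.ofReal_lt_top
  have : IsFiniteMeasure (volume.restrict ω) := isFiniteMeasure_restrict.2 hfin.ne
  refine ⟨hm, hm.integrable one_le_two, ?_⟩
  have h1 := integral_abs_mul_le (memLp_const (1 : ℝ)) hm
  simp only [abs_one, one_mul, one_pow, integral_const, smul_eq_mul, mul_one] at h1
  refine h1.trans (mul_le_mul ?_ ?_ (Real.sqrt_nonneg _) hv)
  · rw [Real.sqrt_le_left hv, measureReal_restrict_apply_univ]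
    exact ENNReal.toReal_le_of_le_ofReal (by positivity) hω
  · rw [l2Norm_eq hm] at h
    exact (ENNReal.ofReal_le_ofReal_iff hb).1 h

theorem PolygonalElement.volume_le (E : PolygonalElement) :
    volume E.carrier ≤ ENNReal.ofReal ((2 * E.diam) ^ 2) := by
  have hd := E.diam_pos
  obtain ⟨x, hx⟩ := E.isConnected.nonempty
  have h1 : E.carrier ⊆ closedBall x E.diam := fun y hy => E.dist_le_diam hy hx
  refine (measure_mono h1).trans ?_
  rw [EuclideanSpace.volume_closedBall_fin_two, ← ENNReal.ofReal_pow hd.le,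
    ← ENNReal.ofReal_mul (by positivity)]
  refine ENNReal.ofReal_le_ofReal ?_
  nlinarith [Real.pi_le_four, sq_nonneg E.diam]

theorem eLpNorm_le_vecNormTop {r : ℕ} (ω : Set Plane) (G : Plane → Plane) (i : Fin 2) {β : ℕ × ℕ}
    (hβ : β.1 + β.2 ≤ r) :
    eLpNorm (weakDeriv ω β fun x => G x i) ∞ (volume.restrict ω) ≤ vecNormTop r ω G := by
  refine le_trans ?_ (Finset.le_sup (Finset.mem_univ i))
  refine le_trans ?_ (Finset.le_sup (Finset.mem_range.2 (Nat.lt_succ_of_le hβ)))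
  exact Finset.le_sup (f := fun β => eLpNorm (weakDeriv ω β fun x => G x i) ∞ (volume.restrict ω))
    (Finset.HasAntidiagonal.mem_antidiagonal.2 rfl)

theorem vecNormTop_le {r : ℕ} {ω : Set Plane} {G : Plane → Plane} {b : ℝ≥0∞}
    (h : ∀ i, ∀ β : ℕ × ℕ, β.1 + β.2 ≤ r →
      eLpNorm (weakDeriv ω β fun x => G x i) ∞ (volume.restrict ω) ≤ b) :
    vecNormTop r ω G ≤ b := by
  refine Finset.sup_le fun i _ => Finset.sup_le fun q hq => Finset.sup_le fun β hβ => ?_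
  rw [Finset.mem_range] at hq
  rw [Finset.HasAntidiagonal.mem_antidiagonal] at hβ
  exact h i β (by omega)

theorem vecNormTop_mono {r r' : ℕ} (h : r ≤ r') (ω : Set Plane) (G : Plane → Plane) :
    vecNormTop r ω G ≤ vecNormTop r' ω G :=
  vecNormTop_le fun i _ hβ => eLpNorm_le_vecNormTop ω G i (hβ.trans h)

theorem ae_abs_le_vecNormTop {r : ℕ} {ω : Set Plane} {G : Plane → Plane}
    (hfin : vecNormTop r ω G ≠ ∞) (i : Fin 2) {β : ℕ × ℕ} (hβ : β.1 + β.2 ≤ r) :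
    ∀ᵐ x ∂volume.restrict ω, |weakDeriv ω β (fun x => G x i) x| ≤ (vecNormTop r ω G).toReal := by
  have h1 := eLpNorm_le_vecNormTop ω G i hβ
  rw [eLpNorm_exponent_top] at h1
  filter_upwards [ae_le_eLpNormEssSup (f := weakDeriv ω β fun x => G x i)
    (μ := volume.restrict ω)] with x hx
  have h2 := ENNReal.toReal_mono hfin (hx.trans h1)
  simpa using h2

/-- The restriction of a reference map to an element. -/
theorem IsRefMap.fieldBounds {l m : ℕ} (hlm : l ≤ m) {j₀ : ℝ} {Ω U : Set Plane}
    {F : Plane → Plane} (hF : IsRefMap m j₀ Ω F) (hΩ : IsOpen Ω) (hΩb : Bornology.IsBounded Ω)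
    (hU : IsOpen U) (hUΩ : U ⊆ Ω) :
    vecNormTop (l + 1) U F ≤ vecNormTop (l + 1) Ω F ∧ vecNormTop (l + 1) Ω F ≠ ∞ ∧
      FieldBounds l U F j₀ (vecNormTop 1 U F).toReal (vecNormTop (l + 1) U F).toReal := by
  have hw : ∀ i, ∀ β : ℕ × ℕ, β.1 + β.2 ≤ l + 1 →
      HasWeakDeriv Ω β (fun x => F x i) (weakDeriv Ω β fun x => F x i) ∧
      MemLp (weakDeriv Ω β fun x => F x i) ∞ (volume.restrict Ω) := fun i β hβ => by
    obtain ⟨w, hw, hwm⟩ := (hF.2.1 i).2 β (by omega)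
    exact ⟨hasWeakDeriv_weakDeriv hw, (memLp_congr_ae (weakDeriv_ae_eq hΩ hw)).2 hwm⟩
  have hwU : ∀ i, ∀ β : ℕ × ℕ, β.1 + β.2 ≤ l + 1 →
      HasWeakDeriv U β (fun x => F x i) (weakDeriv U β fun x => F x i) := fun i β hβ =>
    hasWeakDeriv_weakDeriv ((hw i β hβ).1.mono hUΩ)
  have hae : ∀ i, ∀ β : ℕ × ℕ, β.1 + β.2 ≤ l + 1 →
      weakDeriv U β (fun x => F x i) =ᵐ[volume.restrict U] weakDeriv Ω β fun x => F x i :=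
    fun i β hβ => weakDeriv_ae_eq hU ((hw i β hβ).1.mono hUΩ)
  have hle : vecNormTop (l + 1) U F ≤ vecNormTop (l + 1) Ω F := vecNormTop_le fun i β hβ => by
    rw [eLpNorm_congr_ae (hae i β hβ)]
    exact (eLpNorm_mono_measure _ (Measure.restrict_mono hUΩ le_rfl)).trans
      (eLpNorm_le_vecNormTop Ω F i hβ)
  have hfin : vecNormTop (l + 1) Ω F ≠ ∞ := by
    refine ne_of_lt ?_
    refine (Finset.sup_lt_iff (by simp)).2 fun i _ => (Finset.sup_lt_iff (by simp)).2 fun q hq =>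
      (Finset.sup_lt_iff (by simp)).2 fun β hβ => ?_
    rw [Finset.mem_range] at hq
    rw [Finset.HasAntidiagonal.mem_antidiagonal] at hβ
    exact (hw i β (by omega)).2.2
  have hfinU : vecNormTop (l + 1) U F ≠ ∞ := (hle.trans_lt hfin.lt_top).ne
  have h1l : vecNormTop 1 U F ≤ vecNormTop (l + 1) U F := vecNormTop_mono (by omega) U F
  have hfin1 : vecNormTop 1 U F ≠ ∞ := (h1l.trans_lt hfinU.lt_top).ne
  refine ⟨hle, hfin, ⟨fun i => ?_, hwU, fun i β hβ => ae_abs_le_vecNormTop hfinU i hβ,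
    fun i β hβ => ae_abs_le_vecNormTop hfin1 i hβ.le, ENNReal.toReal_nonneg,
    ENNReal.toReal_mono hfinU h1l, ?_⟩⟩
  · have : IsFiniteMeasure (volume.restrict Ω) :=
      isFiniteMeasure_restrict.2 hΩb.measure_lt_top.ne
    exact IntegrableOn.mono_set ((hF.2.1 i).1.integrable le_top) hUΩ
  · have h1 := ae_mono (Measure.restrict_mono hUΩ le_rfl) hF.2.2
    filter_upwards [h1, hae 0 (1, 0) (by simp), hae 0 (0, 1) (by simp), hae 1 (1, 0) (by simp),
      hae 1 (0, 1) (by simp)] with x hx h00 h01 h10 h11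
    have h2 : jacobianDet U F x = jacobianDet Ω F x := by
      rw [jacobianDet, jacobianDet, Matrix.det_fin_two, Matrix.det_fin_two]
      simp only [Matrix.of_apply, if_true, one_ne_zero, if_false, h00, h01, h10, h11]
    rwa [h2]

/-! ### Virtual element fields close to a polynomial field -/

theorem IsTest.laplacian {ω : Set Plane} {φ : Plane → ℝ} (h : IsTest ω φ) :
    IsTest ω (IsoVEM.laplacian φ) := by
  have h1 := h.multiD (2, 0)
  have h2 := h.multiD (0, 2)
  exact ⟨contDiff_laplacian h.1, h1.2.1.add h2.2.1,
    (tsupport_add _ _).trans (union_subset h1.2.2 h2.2.2)⟩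

theorem hasWeakLaplacian_of_smooth (ω : Set Plane) {f : Plane → ℝ} (hf : ContDiff ℝ (⊤ : ℕ∞) f) :
    HasWeakLaplacian ω f (laplacian f) := fun φ hφ => by
  have h1 := hasWeakDeriv_of_smooth ω hf (2, 0)
  have h2 := hasWeakDeriv_of_smooth ω hf (0, 2)
  have e1 := h1.2.2 φ hφ
  have e2 := h2.2.2 φ hφ
  norm_num at e1 e2
  simp only [laplacian, mul_add, add_mul]
  rw [integral_add (integrable_mul_isTest (hφ.multiD _) h1.1).integrableOn
      (integrable_mul_isTest (hφ.multiD _) h1.1).integrableOn,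
    integral_add (integrable_mul_isTest hφ h1.2.1).integrableOn
      (integrable_mul_isTest hφ h2.2.1).integrableOn, e1, e2]

theorem HasWeakLaplacian.sub {ω : Set Plane} {u u' f f' : Plane → ℝ} (h : HasWeakLaplacian ω u f)
    (h' : HasWeakLaplacian ω u' f') (hu : LocallyIntegrableOn u ω) (hu' : LocallyIntegrableOn u' ω)
    (hf : LocallyIntegrableOn f ω) (hf' : LocallyIntegrableOn f' ω) :
    HasWeakLaplacian ω (fun x => u x - u' x) fun x => f x - f' x := fun φ hφ => by
  simp only [sub_mul]
  rw [integral_sub (integrable_mul_isTest hφ.laplacian hu).integrableOn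
      (integrable_mul_isTest hφ.laplacian hu').integrableOn,
    integral_sub (integrable_mul_isTest hφ hf).integrableOn
      (integrable_mul_isTest hφ hf').integrableOn, h φ hφ, h' φ hφ]

theorem l2Norm_sub_le {ω : Set Plane} {u v : Plane → ℝ} {b c : ℝ} (hb : 0 ≤ b) (hc : 0 ≤ c)
    (hu : AEStronglyMeasurable u (volume.restrict ω))
    (hv : AEStronglyMeasurable v (volume.restrict ω)) (h : l2Norm ω u ≤ ENNReal.ofReal b)
    (h' : l2Norm ω v ≤ ENNReal.ofReal c) :
    l2Norm ω (fun x => u x - v x) ≤ ENNReal.ofReal (b + c) := by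
  rw [ENNReal.ofReal_add hb hc]
  exact (eLpNorm_sub_le hu hv one_le_two).trans (add_le_add h h')

/-- Consequences of the optimal accuracy of the discrete field for its error. -/
theorem exists_accuracy_bound (l : ℕ) (cF : ℝ≥0) : ∃ C ≥ 0, ∀ (E : PolygonalElement)
    (F Fh : Plane → Plane) (j₀ M K : ℝ), FieldBounds l E.carrier F j₀ M K →
    IsAccurateOn l cF E F Fh →
    (∀ i, l2Norm E.carrier (fun x => F x i - Fh x i) ≤ ENNReal.ofReal (C * K * E.diam ^ (l + 2))) ∧
    ∀ i, ∀ β : ℕ × ℕ, β.1 + β.2 = 1 →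
      l2Norm E.carrier (weakDeriv E.carrier β fun x => F x i - Fh x i) ≤
        ENNReal.ofReal (C * K * E.diam ^ (l + 1)) := by
  refine ⟨cF * (2 * (l + 2)) * 2, by positivity, fun E F Fh j₀ M K hF hacc => ?_⟩
  have hd := E.diam_pos
  have hK0 : 0 ≤ K := hF.nonneg.trans hF.le
  have hS : vecSeminorm (l + 1) E.carrier F ≤ ENNReal.ofReal (2 * (l + 2) * (2 * E.diam * K)) := by
    refine (vecSeminorm_le (b := ENNReal.ofReal (2 * E.diam * K)) fun i β hβ =>
      l2Norm_le_of_ae_le (by positivity) E.volume_le (hF.abs_le i β hβ.le)).trans_eq ?_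
    rw [← ENNReal.ofReal_natCast, ← ENNReal.ofReal_mul (by positivity)]
    congr 2
    push_cast
    ring
  have h1 := hacc l le_rfl
  have h2 : (cF : ℝ≥0∞) * ENNReal.ofReal (E.diam ^ (l + 1)) * vecSeminorm (l + 1) E.carrier F ≤
      ENNReal.ofReal (cF * (2 * (l + 2)) * 2 * K * E.diam ^ (l + 2)) := by
    calc _ ≤ (cF : ℝ≥0∞) * ENNReal.ofReal (E.diam ^ (l + 1)) *
          ENNReal.ofReal (2 * (l + 2) * (2 * E.diam * K)) := by gcongr
      _ = _ := by
          rw [← ENNReal.ofReal_coe_nnreal, ← ENNReal.ofReal_mul (by positivity),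
            ← ENNReal.ofReal_mul (by positivity)]
          congr 1
          ring
  have h3 := h1.trans h2
  refine ⟨fun i => (l2Norm_le_vecL2Norm E.carrier (F - Fh) i).trans (le_self_add.trans h3),
    fun i β hβ => ?_⟩
  have h4 := le_add_self.trans h3
  have h5 : ENNReal.ofReal (cF * (2 * (l + 2)) * 2 * K * E.diam ^ (l + 2)) =
      ENNReal.ofReal E.diam * ENNReal.ofReal (cF * (2 * (l + 2)) * 2 * K * E.diam ^ (l + 1)) := by
    rw [← ENNReal.ofReal_mul hd.le]
    congr 1
    ring
  rw [h5, ENNReal.mul_le_mul_iff_right (ENNReal.ofReal_pos.2 hd).ne' ENNReal.ofReal_ne_top] at h4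
  exact (l2Norm_le_vecSeminorm E.carrier (F - Fh) i hβ).trans h4

/-- The virtual element field and its projection are close to a nearly affine polynomial field. -/
theorem exists_discrete_field_bound (l : ℕ) (hl : 1 ≤ l) {a j₀ : ℝ} (ha : 0 < a) (hj₀ : 0 < j₀)
    (cF : ℝ≥0) : ∃ C > 0, ∃ ε > 0, ∀ E : PolygonalElement, E.ShapeRegular a → E.diam ≤ 1 →
    ∀ x₀ ∈ E.carrier, ∀ (F : Plane → Plane) (M K : ℝ), FieldBounds l E.carrier F j₀ M K →
    (1 + K) ^ 2 * E.diam ≤ ε → ∀ Fh : Plane → Plane, (∀ i, E.toCurved.MemW l fun x => Fh x i) →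
    IsAccurateOn l cF E F Fh → ∃ (p : Fin 2 → Poly) (A : Plane ≃L[ℝ] Plane),
      NearAffine (polyField p) A (8 * (1 + M) / j₀) (closedBall x₀ (2 * E.diam)) ∧
      (∀ x ∈ closedBall x₀ (2 * E.diam), ‖fderiv ℝ (polyField p) x‖ ≤ 4 * (1 + M)) ∧
      ∀ i, (∀ x ∈ closure E.carrier, |Fh x i - peval (p i) x| ≤ C * K * E.diam ^ (l + 1)) ∧
        ∀ x ∈ E.carrier, |vecL2Proj l E.carrier Fh x i - peval (p i) x| ≤
          C * K * E.diam ^ (l + 1) := by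
  obtain ⟨C₀, hC₀, ε, hε, hT⟩ := exists_taylor_field l hl ha hj₀
  obtain ⟨C₁, hC₁, hacc⟩ := exists_accuracy_bound l cF
  obtain ⟨C₃, hC₃, hsup⟩ := exists_sup_bound l ha
  obtain ⟨C₄, hC₄, hpsup⟩ := exists_peval_sup_bound l (max 1 (2 / a)) (le_max_left _ _)
  obtain ⟨N, hN, hpieces⟩ := exists_starPieces ha
  set C₂ := 2 * C₀ + C₁ with hC₂
  have hC₂0 : 0 < C₂ := by positivity
  refine ⟨6 * C₃ * C₂ + 2 / a * C₄ * C₂, by positivity, ε, hε, ?_⟩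
  intro E hE hd1 x₀ hx₀ F M K hF hsmall Fh hFh hFa
  have hd := E.diam_pos
  have hK0 : 0 ≤ K := hF.nonneg.trans hF.le
  have hU := E.isOpen
  obtain ⟨hacc0, hacc1⟩ := hacc E F Fh j₀ M K hF hFa
  obtain ⟨p, A, hp, hlap, hnear, hder, happ⟩ := hT E hE hd1 x₀ hx₀ F M K hF hsmall
  refine ⟨p, A, hnear, hder, fun i => ?_⟩
  obtain ⟨h0, h10, h01⟩ := happ i
  have hFhm : MemLp (fun x => Fh x i) 2 (volume.restrict E.carrier) := (hFh i).1.1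
  have hFhl : LocallyIntegrableOn (fun x => Fh x i) E.carrier := by
    have : IsFiniteMeasure (volume.restrict E.carrier) :=
      isFiniteMeasure_restrict.2 E.isBounded.measure_lt_top.ne
    exact IntegrableOn.locallyIntegrableOn (hFhm.integrable one_le_two)
  have hTs : ContDiff ℝ (⊤ : ℕ∞) (peval (p i)) := peval_contDiff (p i)
  have hTm : AEStronglyMeasurable (peval (p i)) (volume.restrict E.carrier) :=
    (peval_continuous (p i)).aestronglyMeasurable
  have hFm := (hF.integrable i).aestronglyMeasurable
  -- the `L²` bound of the error
  have e0 : l2Norm E.carrier (fun x => Fh x i - peval (p i) x) ≤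
      ENNReal.ofReal (C₂ * K * E.diam ^ (l + 2)) := by
    have h1 := l2Norm_le_of_ae_le (by positivity) E.volume_le h0
    have h2 := l2Norm_sub_le (by positivity) (by positivity) (hFm.sub hTm)
      (hFm.sub hFhm.aestronglyMeasurable) h1 (hacc0 i)
    simp only [Pi.sub_apply, sub_sub_sub_cancel_left] at h2
    refine h2.trans_eq ?_
    congr 1
    rw [hC₂]
    ring
  -- the `L²` bound of the gradient of the error
  have egrad : ∀ (β : ℕ × ℕ) (D : Plane → ℝ), β.1 + β.2 = 1 → D = multiD β (peval (p i)) →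
      (∀ᵐ x ∂volume.restrict E.carrier,
        |weakDeriv E.carrier β (fun x => F x i) x - D x| ≤ C₀ * K * E.diam ^ l) →
      ∃ g, HasWeakDeriv E.carrier β (fun x => Fh x i - peval (p i) x) g ∧
        IntegrableOn g E.carrier ∧
        ∫ x in E.carrier, |g x| ≤ 2 * E.diam * (C₂ * K * E.diam ^ (l + 1)) := by
    intro β D hβ hD hae
    obtain ⟨w, hw, -⟩ := (hFh i).1.2 β hβ.le
    have hwF := hF.weak i β (by omega)
    have hTd : HasWeakDeriv E.carrier β (peval (p i)) D := by
      rw [hD]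
      exact hasWeakDeriv_of_smooth _ hTs β
    have hdiff := weakDeriv_ae_eq hU (hwF.sub hw)
    have hDm : AEStronglyMeasurable D (volume.restrict E.carrier) :=
      hTd.2.1.aestronglyMeasurable
    have h1 := l2Norm_le_of_ae_le (by positivity) E.volume_le hae
    have h2 := hacc1 i β hβ
    rw [l2Norm, eLpNorm_congr_ae hdiff] at h2
    have h3 := l2Norm_sub_le (by positivity) (by positivity)
      (hwF.2.1.aestronglyMeasurable.sub hDm)
      (hwF.2.1.aestronglyMeasurable.sub hw.2.1.aestronglyMeasurable) h1 h2
    simp only [Pi.sub_apply, sub_sub_sub_cancel_left] at h3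
    have h4 := integral_abs_le_of_l2Norm_le (b := C₂ * K * E.diam ^ (l + 1)) (v := 2 * E.diam)
      (by positivity) (by positivity) E.volume_le (hw.2.1.aestronglyMeasurable.sub hDm) (by
        refine h3.trans_eq ?_
        congr 1
        rw [hC₂]
        ring)
    exact ⟨fun x => w x - D x, hw.sub hTd, h4.2.1, h4.2.2⟩
  obtain ⟨g₀, hg₀, hg₀i, hg₀b⟩ := egrad (1, 0) (partialD 0 (peval (p i))) rfl rfl h10
  obtain ⟨g₁, hg₁, hg₁i, hg₁b⟩ := egrad (0, 1) (partialD 1 (peval (p i))) rfl rfl h01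
  have hwm := integral_abs_le_of_l2Norm_le (u := fun x => Fh x i - peval (p i) x) (b := C₂ * K * E.diam ^ (l + 2)) (v := 2 * E.diam)
    (by positivity) (by positivity) E.volume_le (hFhm.aestronglyMeasurable.sub hTm) e0
  obtain ⟨q, hq, hqe⟩ := hlap i
  obtain ⟨pL, hpL, hpLe⟩ := (hFh i).2.2.1
  have hcont : ContinuousOn (fun x => Fh x i - peval (p i) x) (closure E.carrier) :=
    (hFh i).2.1.sub (peval_continuous (p i)).continuousOn
  have hwlap : HasWeakLaplacian E.carrier (fun x => Fh x i - peval (p i) x) (peval (pL - q)) := by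
    have hl1 : HasWeakLaplacian E.carrier (fun x => Fh x i) (peval pL) := hpLe
    have hl2 : HasWeakLaplacian E.carrier (peval (p i)) (peval q) := by
      rw [show peval q = laplacian (peval (p i)) from funext fun x => (hqe x).symm]
      exact hasWeakLaplacian_of_smooth _ hTs
    have hpc : ∀ r : Poly, LocallyIntegrableOn (peval r) E.carrier := fun r =>
      (peval_continuous r).locallyIntegrable.locallyIntegrableOn _
    have := hl1.sub hl2 hFhl (hpc _) (hpc _) (hpc _)
    simpa only [← peval_sub] using this
  refine ⟨fun x hx => ?_, fun x hx => ?_⟩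
  · have h1 := hsup E hE (fun x => Fh x i - peval (p i) x) g₀ g₁ (pL - q) hcont hwm.2.1 hg₀ hg₀i
      hg₁ hg₁i (fun j => by
        obtain ⟨q₁, hq₁, hq₁e⟩ := E.exists_edge_polynomial (hFh i) j
        obtain ⟨q₂, hq₂, hq₂e⟩ := exists_polynomial_eq_peval_line (hp i) (E.poly j)
          (E.poly (finRotate _ j) - E.poly j)
        refine ⟨q₁ - q₂, (Polynomial.natDegree_sub_le _ _).trans (max_le hq₁ hq₂),
          fun t ht => ?_⟩
        rw [Polynomial.eval_sub, hq₂e, hq₁e t ht, E.edgePath_eq])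
      (totalDegree_sub_le hpL hq) hwlap x hx
    have h2 : |Fh x i - peval (p i) x| * E.diam ^ 2 ≤
        6 * C₃ * C₂ * K * E.diam ^ (l + 1) * E.diam ^ 2 := by
      refine h1.trans ?_
      calc _ ≤ C₃ * (2 * E.diam * (C₂ * K * E.diam ^ (l + 2)) + E.diam *
            (2 * E.diam * (C₂ * K * E.diam ^ (l + 1)) +
              2 * E.diam * (C₂ * K * E.diam ^ (l + 1)))) := by
            gcongr
            exact hwm.2.2
        _ = _ := by ring
    have h3 := le_of_mul_le_mul_right h2 (by positivity)
    refine h3.trans ?_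
    gcongr
    exact le_add_of_nonneg_right (by positivity)
  · obtain ⟨S, c, hcov, hS⟩ := hpieces E hE
    set ρ := a * E.diam / 2 with hρ
    have hρ0 : 0 < ρ := by positivity
    have hball : ball (c ⟨0, hN⟩) ρ ⊆ E.carrier :=
      (hS ⟨0, hN⟩).ball_subset.trans (by rw [hcov]; exact subset_iUnion S _)
    have hP := exists_isL2Proj l E.isBounded hρ0 hball hFhm
    set P := l2Proj l E.carrier fun x => Fh x i with hPdef
    have h1 := hP.integral_sq_sub_le E.isBounded hFhm (hp i)
    have h2 : √(∫ x in E.carrier, (Fh x i - peval (p i) x) ^ 2) ≤ C₂ * K * E.diam ^ (l + 2) := by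
      have := e0
      rw [l2Norm_eq hwm.1] at this
      exact (ENNReal.ofReal_le_ofReal_iff (by positivity)).1 this
    have h3 : ∫ x in ball (c ⟨0, hN⟩) ρ, peval (P - p i) x ^ 2 ≤
        ∫ x in E.carrier, peval (P - p i) x ^ 2 :=
      setIntegral_mono_set (integrable_sq_of_memLp
        (memLp_two_of_continuous E.isBounded (peval_continuous _)))
        (ae_of_all _ fun _ => sq_nonneg _) hball.eventuallyLE
    have h4 := hpsup (P - p i) (totalDegree_sub_le hP.1 (hp i)) (c ⟨0, hN⟩) ρ hρ0 x (by
      refine (E.dist_le_diam hx (hball (mem_ball_self hρ0))).trans ?_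
      calc E.diam = 2 / a * ρ := by rw [hρ]; field_simp
        _ ≤ _ := by gcongr; exact le_max_right _ _)
    have h5 : |peval (P - p i) x| * ρ ≤ C₄ * (C₂ * K * E.diam ^ (l + 2)) := by
      refine h4.trans ?_
      gcongr
      exact (Real.sqrt_le_sqrt (h3.trans h1)).trans h2
    have h6 : vecL2Proj l E.carrier Fh x i - peval (p i) x = peval (P - p i) x := by
      rw [peval_sub]
      rfl
    rw [h6]
    have h7 : |peval (P - p i) x| * ρ ≤ 2 / a * C₄ * C₂ * K * E.diam ^ (l + 1) * ρ := by
      refine h5.trans_eq ?_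
      rw [hρ]
      field_simp
      ring
    have h8 := le_of_mul_le_mul_right h7 hρ0
    refine h8.trans ?_
    gcongr
    exact le_add_of_nonneg_left (by positivity)

/-! ### Geometry of the physical and of the projected element -/

theorem measurableSet_image_of_continuousOn {U : Set Plane} (hU : IsOpen U)
    (hUb : Bornology.IsBounded U) {f : Plane → Plane} (hf : ContinuousOn f U) :
    MeasurableSet (f '' U) := by
  obtain ⟨S, hS, hSU, hcov, -⟩ := hU.exists_iUnion_isClosed
  rw [← hcov, image_iUnion]
  refine MeasurableSet.iUnion fun n => ?_
  have hc : IsCompact (S n) :=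
    hUb.isCompact_closure.of_isClosed_subset (hS n) ((hSU n).trans subset_closure)
  exact (hc.image_of_continuousOn (hf.mono (hSU n))).measurableSet

/-- Comparison of the images of an element under two fields close to a nearly affine polynomial
field. -/
theorem exists_image_geometry {a j₀ C₀ : ℝ} (ha : 0 < a) (hj₀ : 0 < j₀) (hC₀ : 0 < C₀) {l : ℕ}
    (hl : 1 ≤ l) : ∃ C ≥ 1, ∃ ε > 0, ∀ E : PolygonalElement, E.ShapeRegular a → E.diam ≤ 1 →
    ∃ x₀ ∈ E.carrier, ∀ (M K : ℝ), 0 ≤ M → M ≤ K → (1 + K) ^ 2 * E.diam ≤ ε →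
    ∀ (p : Fin 2 → Poly) (A : Plane ≃L[ℝ] Plane),
    NearAffine (polyField p) A (8 * (1 + M) / j₀) (closedBall x₀ (2 * E.diam)) →
    (∀ x ∈ closedBall x₀ (2 * E.diam), ‖fderiv ℝ (polyField p) x‖ ≤ 4 * (1 + M)) →
    ∃ y : Plane, ∀ f : Plane → Plane, ContinuousOn f E.carrier →
      (∀ i, ∀ x ∈ E.carrier, |f x i - peval (p i) x| ≤ C₀ * K * E.diam ^ (l + 1)) →
      ball y (E.diam / (C * (1 + M))) ⊆ f '' E.carrier ∧
      f '' E.carrier ⊆ closedBall y (C * (1 + M) * E.diam) ∧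
      ∀ g : Plane → Plane, ContinuousOn g E.carrier →
        (∀ i, ∀ x ∈ E.carrier, |g x i - peval (p i) x| ≤ C₀ * K * E.diam ^ (l + 1)) →
        volume (f '' E.carrier \ g '' E.carrier) ≤
          ENNReal.ofReal (C * (1 + M) ^ 3 * (1 + K) * E.diam ^ l * E.diam ^ 2) := by
  obtain ⟨N, hN, hpieces⟩ := exists_starPieces ha
  obtain ⟨C₅, hC₅, hvol⟩ := exists_volume_nbhd_frontier_le ha
  set C := 1 + 128 / (a * j₀) + (j₀ + 4) + 512 * C₅ * C₀ / j₀ with hC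
  have hC1 : 1 ≤ C := by
    have : 0 ≤ 128 / (a * j₀) + (j₀ + 4) + 512 * C₅ * C₀ / j₀ := by positivity
    linarith
  refine ⟨C, hC1, min (a * j₀ / (256 * C₀)) (j₀ / (32 * C₀)), by positivity, ?_⟩
  intro E hE hd1
  obtain ⟨S, c, hcov, hS⟩ := hpieces E hE
  have hd := E.diam_pos
  set x₀ := c ⟨0, hN⟩ with hx₀def
  have hball : ball x₀ (a * E.diam / 2) ⊆ E.carrier :=
    (hS ⟨0, hN⟩).ball_subset.trans (by rw [hcov]; exact subset_iUnion S _)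
  have hx₀ : x₀ ∈ E.carrier := hball (mem_ball_self (by positivity))
  refine ⟨x₀, hx₀, ?_⟩
  intro M K hM hMK hε p A hT hder
  have hK : 0 ≤ K := hM.trans hMK
  have hUd : E.carrier ⊆ closedBall x₀ E.diam := fun x hx => E.dist_le_diam hx hx₀
  set δ := 2 * (C₀ * (1 + K) * E.diam ^ (l + 1)) with hδ
  set r := 2 * (8 * (1 + M) / j₀) * δ with hr
  have hδ0 : 0 < δ := by positivity
  have hr0 : 0 < r := by positivity
  have hrle : r ≤ 32 * C₀ / j₀ * ((1 + K) ^ 2 * E.diam) * E.diam := by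
    have h1 : E.diam ^ (l + 1) ≤ E.diam ^ 2 := pow_le_pow_of_le_one hd.le hd1 (by omega)
    calc r = 32 * C₀ / j₀ * ((1 + M) * (1 + K)) * E.diam ^ (l + 1) := by rw [hr, hδ]; ring
      _ ≤ 32 * C₀ / j₀ * ((1 + K) * (1 + K)) * E.diam ^ 2 := by gcongr
      _ = _ := by ring
  have hra : 8 * r ≤ a * E.diam := by
    have h1 := hε.trans (min_le_left _ _)
    calc 8 * r ≤ 8 * (32 * C₀ / j₀ * (a * j₀ / (256 * C₀)) * E.diam) := by
          refine mul_le_mul_of_nonneg_left (hrle.trans ?_) (by norm_num)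
          gcongr
      _ = a * E.diam := by field_simp; norm_num
  have hrd : r ≤ E.diam := by
    have h1 := hε.trans (min_le_right _ _)
    calc r ≤ 32 * C₀ / j₀ * (j₀ / (32 * C₀)) * E.diam := by
          refine hrle.trans ?_
          gcongr
      _ = E.diam := by field_simp
  have hδd : δ ≤ j₀ * E.diam := by
    have h1 : δ * (16 / j₀) ≤ r := by
      rw [hr]
      have h2 : 0 ≤ M * δ / j₀ := by positivity
      calc δ * (16 / j₀) ≤ δ * (16 / j₀) + 16 * (M * δ / j₀) := by linarith
        _ = _ := by ring
    have h3 : δ * (16 / j₀) ≤ E.diam := h1.trans hrd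
    have h4 : δ * (16 / j₀) * (j₀ / 16) ≤ E.diam * (j₀ / 16) := by gcongr
    have h5 : δ * (16 / j₀) * (j₀ / 16) = δ := by field_simp
    have h6 : 0 < E.diam * j₀ := by positivity
    linarith
  have hdist : ∀ f : Plane → Plane,
      (∀ i, ∀ x ∈ E.carrier, |f x i - peval (p i) x| ≤ C₀ * K * E.diam ^ (l + 1)) →
      ∀ x ∈ E.carrier, dist (f x) (polyField p x) ≤ δ := fun f hf x hx => by
    refine (dist_le_of_abs_le fun i => hf i x hx).trans ?_
    rw [hδ]
    gcongr
    linarith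
  have hUB : E.carrier ⊆ closedBall x₀ (2 * E.diam) :=
    hUd.trans (closedBall_subset_closedBall (by linarith))
  have hUBr : ∀ x ∈ E.carrier, closedBall x r ⊆ closedBall x₀ (2 * E.diam) := fun x hx =>
    closedBall_subset_closedBall' (by linarith [E.dist_le_diam hx hx₀])
  refine ⟨polyField p x₀, fun f hf hfp => ⟨?_, ?_, fun g hg hgp => ?_⟩⟩
  · have h1 := hT.ball_subset_image (U := E.carrier) (c := x₀) (r := r) (ρ := a * E.diam / 4)
      hr0 le_rfl (by linarith) hUB hf (hdist f hfp)
      ((closedBall_subset_ball (by linarith [mul_pos ha hd])).trans hball)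
    refine (ball_subset_ball ?_).trans h1
    rw [div_le_div_iff₀ (by positivity) (by positivity)]
    have h2 : 128 / (a * j₀) ≤ C := by
      have : 0 ≤ (j₀ + 4) + 512 * C₅ * C₀ / j₀ := by positivity
      linarith
    rw [div_le_iff₀ (by positivity)] at h2
    calc E.diam * (4 * (8 * (1 + M) / j₀)) = E.diam * (1 + M) / (4 * j₀) * 128 := by
          field_simp
          norm_num
      _ ≤ E.diam * (1 + M) / (4 * j₀) * (C * (a * j₀)) := by gcongr
      _ = _ := by field_simp
  · rintro _ ⟨x, hx, rfl⟩
    rw [mem_closedBall]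
    have h1 := (convex_closedBall x₀ (2 * E.diam)).norm_image_sub_le_of_norm_fderiv_le
      (f := polyField p) (fun x _ => (hasFDerivAt_polyField p x).differentiableAt) hder
      (hUB hx₀) (hUB hx)
    rw [← dist_eq_norm, ← dist_eq_norm] at h1
    have h2 := dist_triangle (f x) (polyField p x) (polyField p x₀)
    have h3 := hdist f hfp x hx
    have h4 := E.dist_le_diam hx hx₀
    calc dist (f x) (polyField p x₀) ≤ j₀ * E.diam + 4 * (1 + M) * E.diam := by
          have : 4 * (1 + M) * dist x x₀ ≤ 4 * (1 + M) * E.diam := by gcongr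
          linarith
      _ ≤ (j₀ + 4) * (1 + M) * E.diam := by
          have : 0 ≤ j₀ * M * E.diam := by positivity
          linarith
      _ ≤ _ := by
          gcongr
          have : 0 ≤ 128 / (a * j₀) + 512 * C₅ * C₀ / j₀ := by positivity
          linarith
  · have h1 := hT.image_diff_subset E.isOpen hr0 le_rfl hUBr hg (hdist f hfp) (hdist g hgp)
    have hfc : IsCompact (frontier E.carrier) :=
      E.isBounded.isCompact_closure.of_isClosed_subset isClosed_frontier frontier_subset_closure
    have hm : MeasurableSet (nbhd r (frontier E.carrier) ∩ closedBall x₀ (2 * E.diam)) :=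
      (isCompact_nbhd hfc hr0.le).measurableSet.inter measurableSet_closedBall
    refine (measure_mono h1).trans ((volume_image_le (M := 4 * (1 + M))
      (fun x => (hasFDerivAt_polyField p x).differentiableAt) hm fun x hx => hder x hx.2).trans ?_)
    calc _ ≤ ENNReal.ofReal ((4 * (1 + M)) ^ 2) * ENNReal.ofReal (C₅ * r * E.diam) := by
          gcongr
          exact (measure_mono inter_subset_left).trans (hvol E hE r hr0 hra)
      _ = ENNReal.ofReal (512 * C₅ * C₀ / j₀ * ((1 + M) ^ 3 * (1 + K) * E.diam ^ l *
            E.diam ^ 2)) := by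
          rw [← ENNReal.ofReal_mul (by positivity)]
          congr 1
          rw [hr, hδ]
          ring
      _ ≤ _ := by
          refine ENNReal.ofReal_le_ofReal ?_
          calc _ ≤ C * ((1 + M) ^ 3 * (1 + K) * E.diam ^ l * E.diam ^ 2) := by
                gcongr
                have : 0 ≤ 128 / (a * j₀) + (j₀ + 4) := by positivity
                linarith
            _ = _ := by ring

/-! ### Comparison of the exact and of the approximate projection -/

theorem abs_setIntegral_sub_le {E E' B : Set Plane} (hE : MeasurableSet E)
    (hE' : MeasurableSet E') (hEB : E ⊆ B) (hE'B : E' ⊆ B) (hB : Bornology.IsBounded B)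
    {f : Plane → ℝ} (hf : Continuous f) {b : ℝ} (hb : ∀ x ∈ B, |f x| ≤ b) :
    |(∫ x in E', f x) - ∫ x in E, f x| ≤
      b * (volume.real (E \ E') + volume.real (E' \ E)) := by
  have hi : ∀ S ⊆ B, IntegrableOn f S := fun S hS =>
    (hf.continuousOn.integrableOn_compact hB.isCompact_closure).mono_set
      (hS.trans subset_closure)
  have h1 := integral_inter_add_sdiff hE (hi E' hE'B)
  have h2 := integral_inter_add_sdiff hE' (hi E hEB)
  rw [inter_comm] at h1
  have h3 : (∫ x in E', f x) - ∫ x in E, f x = (∫ x in E' \ E, f x) - ∫ x in E \ E', f x := by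
    linarith
  have key : ∀ S ⊆ B, |∫ x in S, f x| ≤ b * volume.real S := fun S hS => by
    rw [← Real.norm_eq_abs]
    exact norm_setIntegral_le_of_norm_le_const (hB.subset hS).measure_lt_top fun x hx => hb x (hS hx)
  rw [h3]
  refine (abs_sub _ _).trans ?_
  have k1 := key (E' \ E) (sdiff_subset.trans hE'B)
  have k2 := key (E \ E') (sdiff_subset.trans hEB)
  linarith

theorem abs_volume_sub_le {E E' B : Set Plane} (hE : MeasurableSet E)
    (hE' : MeasurableSet E') (hEB : E ⊆ B) (hE'B : E' ⊆ B) (hB : Bornology.IsBounded B) :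
    |volume.real E' - volume.real E| ≤ volume.real (E \ E') + volume.real (E' \ E) := by
  have h := abs_setIntegral_sub_le hE hE' hEB hE'B hB (f := fun _ => (1 : ℝ)) continuous_const
    (b := 1) (fun _ _ => by simp)
  simpa using h

/-- A polynomial is controlled by its moments. -/
theorem exists_poly_le_moments (k : ℕ) {c₁ c₂ : ℝ} (hc₁ : 0 < c₁) (hc : c₁ ≤ c₂) : ∃ C > 0,
    ∀ (z y : Plane) (h d : ℝ), 0 < h → c₁ * h ≤ d → d ≤ 2 * c₂ * h → dist y z ≤ c₂ * h →
    ∀ E' : Set Plane, Bornology.IsBounded E' → ball z (c₁ * h) ⊆ E' →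
    ∀ q : Poly, q.totalDegree ≤ k → ∀ J : ℝ,
    (∀ β ∈ multiIdx k, |∫ x in E', peval q x * scaledMono y d β x| ≤ J) →
    ∀ x ∈ closedBall z (c₂ * h), |peval q x| * h ^ 2 ≤ C * J := by
  obtain ⟨C₁, hC₁, hsup⟩ := exists_peval_sup_bound k (3 * c₂ / c₁) (by
    rw [one_le_div hc₁]; linarith)
  obtain ⟨κ, hκ, hcoef⟩ := exists_coef_bound k
  set n : ℝ := ((multiIdx k).card : ℝ) with hn
  have hc₂ : 0 < c₂ := hc₁.trans_le hc
  set P := n * (4 * C₁ ^ 2 / (κ * c₁ ^ 2)) with hP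
  refine ⟨C₁ * √P / c₁ + 1, by positivity, ?_⟩
  intro z y h d hh hd1 hd2 hyz E' hE'b hball q hq J hJ x hx
  have hch : 0 < c₁ * h := by positivity
  have hd : 0 < d := hch.trans_le hd1
  obtain ⟨c, hc'⟩ := exists_peval_eq_monoSum hq y hd.ne'
  set Q := ∫ x in ball z (c₁ * h), peval q x ^ 2 with hQ
  have hQ0 : 0 ≤ Q := integral_nonneg fun _ => sq_nonneg _
  have hJ0 : 0 ≤ J := (abs_nonneg _).trans (hJ (0, 0) (by simp))
  have hqm : MemLp (peval q) 2 (volume.restrict E') :=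
    memLp_two_of_continuous hE'b (peval_continuous q)
  have hsup' : ∀ x, dist x z ≤ 3 * c₂ * h → |peval q x| * (c₁ * h) ≤ C₁ * √Q := fun x hx =>
    hsup q hq z (c₁ * h) hch x (hx.trans_eq (by field_simp))
  set S := ∑ β ∈ multiIdx k, |c β| with hS
  have hS0 : 0 ≤ S := Finset.sum_nonneg fun _ _ => abs_nonneg _
  have h1 : Q ≤ S * J := by
    have h2 : Q ≤ ∫ x in E', peval q x ^ 2 := setIntegral_mono_set (integrable_sq_of_memLp hqm)
      (ae_of_all _ fun _ => sq_nonneg _) hball.eventuallyLE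
    have h3 : ∀ x, peval q x ^ 2 =
        ∑ β ∈ multiIdx k, c β * (peval q x * scaledMono y d β x) := fun x => by
      have e : peval q x ^ 2 = (∑ β ∈ multiIdx k, c β * scaledMono y d β x) * peval q x := by
        rw [sq]
        congr 1
        exact hc' x
      rw [e, Finset.sum_mul]
      exact Finset.sum_congr rfl fun β _ => by ring
    refine h2.trans ?_
    simp only [h3]
    rw [integral_finsetSum _ fun β _ => (integrable_mul_of_memLp hqm
      (memLp_two_of_continuous hE'b (continuous_scaledMono y d β))).const_mul _, hS,
      Finset.sum_mul]
    refine Finset.sum_le_sum fun β hβ => ?_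
    rw [integral_const_mul]
    refine (le_abs_self _).trans ?_
    rw [abs_mul]
    exact mul_le_mul_of_nonneg_left (hJ β hβ) (abs_nonneg _)
  have h2 : κ * c₁ ^ 2 * h ^ 2 * ∑ β ∈ multiIdx k, c β ^ 2 ≤ 4 * C₁ ^ 2 * Q := by
    have h3 := hcoef y d hd c
    have h4 : ∫ x in ball y d, monoSum k y d c x ^ 2 ≤
        C₁ ^ 2 * Q / (c₁ * h) ^ 2 * volume.real (ball y d) := by
      refine (Real.le_norm_self _).trans (norm_setIntegral_le_of_norm_le_const
        isBounded_ball.measure_lt_top fun x hx => ?_)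
      rw [← hc', Real.norm_of_nonneg (sq_nonneg _), le_div_iff₀ (by positivity)]
      have h5 := hsup' x (by
        have := mem_ball.1 hx
        linarith [dist_triangle x y z])
      have h6 := pow_le_pow_left₀ (by positivity) h5 2
      rwa [mul_pow, mul_pow C₁, sq_abs, Real.sq_sqrt hQ0] at h6
    have h5 : volume.real (ball y d) ≤ 4 * d ^ 2 := by
      rw [measureReal_def, EuclideanSpace.volume_ball_fin_two, ← ENNReal.ofReal_pow hd.le,
        ENNReal.toReal_mul, ENNReal.toReal_ofReal (by positivity)]
      have : (ENNReal.ofReal Real.pi).toReal = Real.pi := ENNReal.toReal_ofReal Real.pi_pos.le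
      rw [this]
      nlinarith [Real.pi_le_four, sq_nonneg d]
    have h6 : κ * d ^ 2 * ∑ β ∈ multiIdx k, c β ^ 2 ≤
        C₁ ^ 2 * Q / (c₁ * h) ^ 2 * (4 * d ^ 2) := by
      refine h3.trans (h4.trans ?_)
      gcongr
    have h7 := mul_le_mul_of_nonneg_right h6 (show 0 ≤ (c₁ * h) ^ 2 / d ^ 2 by positivity)
    have e1 : κ * d ^ 2 * (∑ β ∈ multiIdx k, c β ^ 2) * ((c₁ * h) ^ 2 / d ^ 2) =
        κ * c₁ ^ 2 * h ^ 2 * ∑ β ∈ multiIdx k, c β ^ 2 := by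
      field_simp
    have e2 : C₁ ^ 2 * Q / (c₁ * h) ^ 2 * (4 * d ^ 2) * ((c₁ * h) ^ 2 / d ^ 2) =
        4 * C₁ ^ 2 * Q := by
      field_simp
    rwa [e1, e2] at h7
  have h3 : S ^ 2 ≤ n * ∑ β ∈ multiIdx k, c β ^ 2 := by
    have := sq_sum_le_card_mul_sum_sq (s := multiIdx k) (f := fun β => |c β|)
    simpa only [sq_abs] using this
  have h4 : Q * h ^ 2 ≤ P * J ^ 2 := by
    rcases hQ0.eq_or_lt with h0 | h0
    · rw [← h0, zero_mul]; positivity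
    · have h5 : Q ^ 2 ≤ (S * J) ^ 2 := pow_le_pow_left₀ hQ0 h1 2
      have h6 : κ * c₁ ^ 2 * h ^ 2 * Q ^ 2 ≤ n * (4 * C₁ ^ 2 * Q) * J ^ 2 := by
        calc κ * c₁ ^ 2 * h ^ 2 * Q ^ 2 ≤ κ * c₁ ^ 2 * h ^ 2 * (S ^ 2 * J ^ 2) := by
              rw [← mul_pow]; gcongr
          _ ≤ κ * c₁ ^ 2 * h ^ 2 * ((n * ∑ β ∈ multiIdx k, c β ^ 2) * J ^ 2) := by gcongr
          _ = n * (κ * c₁ ^ 2 * h ^ 2 * ∑ β ∈ multiIdx k, c β ^ 2) * J ^ 2 := by ring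
          _ ≤ _ := by gcongr
      have h7 : Q * (κ * c₁ ^ 2 * (Q * h ^ 2)) ≤ Q * (n * (4 * C₁ ^ 2) * J ^ 2) := by linarith
      have h8 := le_of_mul_le_mul_left h7 h0
      rw [hP]
      have e : n * (4 * C₁ ^ 2 / (κ * c₁ ^ 2)) * J ^ 2 =
          n * (4 * C₁ ^ 2) * J ^ 2 / (κ * c₁ ^ 2) := by ring
      rw [e, le_div_iff₀ (by positivity)]
      linarith
  have h5 : √Q * h ≤ √P * J := by
    have hP0 : 0 ≤ P := by positivity
    have h6 := Real.sqrt_le_sqrt h4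
    rwa [Real.sqrt_mul hQ0, Real.sqrt_mul hP0, Real.sqrt_sq hh.le, Real.sqrt_sq hJ0] at h6
  have h6 := hsup' x ((mem_closedBall.1 hx).trans (by nlinarith))
  have h7 : |peval q x| * h ^ 2 * c₁ ≤ C₁ * (√P * J) := by
    calc |peval q x| * h ^ 2 * c₁ = |peval q x| * (c₁ * h) * h := by ring
      _ ≤ C₁ * √Q * h := by gcongr
      _ = C₁ * (√Q * h) := by ring
      _ ≤ _ := by gcongr
  calc |peval q x| * h ^ 2 ≤ C₁ * (√P * J) / c₁ := by rwa [le_div_iff₀ hc₁]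
    _ = C₁ * √P / c₁ * J := by ring
    _ ≤ _ := by gcongr; linarith

/-- The perturbation estimate for projections on two nearby domains. -/
theorem exists_projection_diff_bound (k : ℕ) {c₁ c₂ : ℝ} (hc₁ : 0 < c₁) (hc : c₁ ≤ c₂) (cP : ℝ≥0) :
    ∃ C > 0, ∀ (z y : Plane) (h d : ℝ), 0 < h → c₁ * h ≤ d → d ≤ 2 * c₂ * h → dist y z ≤ c₂ * h →
    ∀ E E' : Set Plane, MeasurableSet E → MeasurableSet E' → ball z (c₁ * h) ⊆ E →
    ball z (c₁ * h) ⊆ E' → E ⊆ closedBall z (c₂ * h) → E' ⊆ closedBall z (c₂ * h) →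
    ∀ V : ℝ, volume (E \ E') ≤ ENNReal.ofReal V → volume (E' \ E) ≤ ENNReal.ofReal V → 0 ≤ V →
    ∀ (v : Plane → ℝ) (π Pv p : Poly), MemLp v 2 (volume.restrict E) → IsL2Proj k E v π →
    Pv.totalDegree ≤ k → √(∫ x in E, peval Pv x ^ 2) ≤ cP * √(∫ x in E, v x ^ 2) →
    p.totalDegree ≤ k →
    (∀ α : ℕ × ℕ, α.1 + α.2 + 2 ≤ k → ∫ x in E', peval p x * scaledMono y d α x =
      volume.real E' * ((volume.real E)⁻¹ * ∫ x in E, v x * scaledMono y d α x)) →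
    (∀ α : ℕ × ℕ, α.1 + α.2 ≤ k → k < α.1 + α.2 + 2 →
      ∫ x in E, (peval Pv x - v x) * scaledMono y d α x = 0) →
    (∀ α : ℕ × ℕ, α.1 + α.2 ≤ k → k < α.1 + α.2 + 2 →
      ∫ x in E', peval p x * scaledMono y d α x = ∫ x in E', peval Pv x * scaledMono y d α x) →
    √(∫ x in E, (peval π x - peval p x) ^ 2) * h ^ 2 ≤ C * V * √(∫ x in E, v x ^ 2) := by
  obtain ⟨C₁, hC₁, hsup⟩ := exists_peval_sup_bound k (c₂ / c₁) (by rwa [one_le_div hc₁])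
  obtain ⟨C₂, hC₂, hmom⟩ := exists_poly_le_moments k hc₁ hc
  have hc₂ : 0 < c₂ := hc₁.trans_le hc
  set r := max 1 (2 * c₂ / c₁) with hr
  have hr1 : 1 ≤ r := le_max_left _ _
  refine ⟨2 * c₂ * (C₂ * (4 * (C₁ / c₁ * (1 + cP) * r ^ k))), by positivity, ?_⟩
  intro z y h d hh hd1 hd2 hyz E E' hEm hE'm hbE hbE' hEB hE'B V hV hV' hV0 v π Pv p hv hπ hPv hPvs
    hp hlow hhigh hhigh'
  have hch : 0 < c₁ * h := by positivity
  have hd : 0 < d := hch.trans_le hd1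
  have hBb : Bornology.IsBounded (closedBall z (c₂ * h)) := isBounded_closedBall
  have hEb := hBb.subset hEB
  have hE'b := hBb.subset hE'B
  set ν := √(∫ x in E, v x ^ 2) with hν
  have hν0 : 0 ≤ ν := Real.sqrt_nonneg _
  have hVr : volume.real (E \ E') + volume.real (E' \ E) ≤ 2 * V := by
    have h1 := ENNReal.toReal_le_of_le_ofReal hV0 hV
    have h2 := ENNReal.toReal_le_of_le_ofReal hV0 hV'
    simp only [measureReal_def]
    linarith
  have hmono : ∀ x ∈ closedBall z (c₂ * h), ∀ α : ℕ × ℕ, α.1 + α.2 ≤ k →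
      |scaledMono y d α x| ≤ r ^ k := fun x hx α hα => by
    refine abs_scaledMono_le hd hr1 ?_ hα
    have h1 := mem_closedBall.1 hx
    have h2 := dist_triangle_right x y z
    calc dist x y ≤ 2 * c₂ * h := by linarith
      _ = 2 * c₂ / c₁ * (c₁ * h) := by field_simp
      _ ≤ r * d := by gcongr; exact le_max_right _ _
  have hpoly : ∀ g : Poly, g.totalDegree ≤ k → ∀ b : ℝ, √(∫ x in E, peval g x ^ 2) ≤ b →
      ∀ x ∈ closedBall z (c₂ * h), |peval g x| ≤ C₁ / c₁ * b / h := fun g hg b hb x hx => by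
    have h1 := hsup g hg z (c₁ * h) hch x ((mem_closedBall.1 hx).trans_eq (by field_simp))
    have h2 : ∫ x in ball z (c₁ * h), peval g x ^ 2 ≤ ∫ x in E, peval g x ^ 2 :=
      setIntegral_mono_set (integrable_sq_of_memLp
        (memLp_two_of_continuous hEb (peval_continuous g))) (ae_of_all _ fun _ => sq_nonneg _)
        hbE.eventuallyLE
    have h3 := (Real.sqrt_le_sqrt h2).trans hb
    rw [le_div_iff₀ hh, div_mul_eq_mul_div, le_div_iff₀ hc₁]
    calc |peval g x| * h * c₁ = |peval g x| * (c₁ * h) := by ring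
      _ ≤ C₁ * √(∫ x in ball z (c₁ * h), peval g x ^ 2) := h1
      _ ≤ _ := by gcongr
  have hm : ∀ (α : ℕ × ℕ), MemLp (scaledMono y d α) 2 (volume.restrict E) := fun α =>
    memLp_two_of_continuous hEb (continuous_scaledMono y d α)
  have hpm : ∀ g : Poly, MemLp (peval g) 2 (volume.restrict E) := fun g =>
    memLp_two_of_continuous hEb (peval_continuous g)
  have hπν : √(∫ x in E, peval π x ^ 2) ≤ ν := by
    have h1 := hπ.integral_sq_sub_le hEb hv (p := 0) (by simp)
    have h2 : ∀ x, peval 0 x = 0 := fun x => by simp [peval]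
    simp only [h2, sub_zero] at h1
    exact Real.sqrt_le_sqrt h1
  have hπsup := hpoly π hπ.1 ν hπν
  have hPsup := hpoly Pv hPv (cP * ν) hPvs
  -- the moments of the projection
  have hπv : ∀ α : ℕ × ℕ, α.1 + α.2 ≤ k → ∫ x in E, v x * scaledMono y d α x =
      ∫ x in E, peval π x * scaledMono y d α x := fun α hα => by
    obtain ⟨q, hq, hqe⟩ := exists_poly_eq_monoSum k y d fun β => if β = α then 1 else 0
    have h1 : ∀ x, peval q x = scaledMono y d α x := fun x => by
      rw [hqe, monoSum, Finset.sum_eq_single α]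
      · simp
      · intro β _ hβ
        simp [hβ]
      · intro hn
        exact absurd (mem_multiIdx.2 hα) hn
    have h2 := hπ.2 q hq
    simp only [h1, sub_mul] at h2
    rw [integral_sub (integrable_mul_of_memLp hv (hm α))
      (integrable_mul_of_memLp (hpm π) (hm α))] at h2
    linarith
  set b := C₁ / c₁ * (1 + cP) * r ^ k * ν / h with hb
  have hb0 : 0 ≤ b := by positivity
  have hJ : ∀ α ∈ multiIdx k, |∫ x in E', peval (π - p) x * scaledMono y d α x| ≤
      4 * b * V := by
    intro α hα
    rw [mem_multiIdx] at hα
    have hm' : MemLp (scaledMono y d α) 2 (volume.restrict E') :=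
      memLp_two_of_continuous hE'b (continuous_scaledMono y d α)
    have hpm' : ∀ g : Poly, MemLp (peval g) 2 (volume.restrict E') := fun g =>
      memLp_two_of_continuous hE'b (peval_continuous g)
    have hsplit : ∫ x in E', peval (π - p) x * scaledMono y d α x =
        (∫ x in E', peval π x * scaledMono y d α x) -
          ∫ x in E', peval p x * scaledMono y d α x := by
      simp only [peval_sub, sub_mul]
      exact integral_sub (integrable_mul_of_memLp (hpm' π) hm')
        (integrable_mul_of_memLp (hpm' p) hm')
    by_cases hlo : α.1 + α.2 + 2 ≤ k
    · have hbd : ∀ x ∈ closedBall z (c₂ * h), |peval π x * scaledMono y d α x| ≤ b :=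
        fun x hx => by
        rw [abs_mul]
        calc _ ≤ C₁ / c₁ * ν / h * r ^ k := by
              gcongr
              exacts [hπsup x hx, hmono x hx α hα]
          _ = C₁ / c₁ * 1 * r ^ k * ν / h := by ring
          _ ≤ _ := by
              rw [hb]
              gcongr
              exact le_add_of_nonneg_right cP.2
      have h1 := abs_setIntegral_sub_le (f := fun x => peval π x * scaledMono y d α x)
        hEm hE'm hEB hE'B hBb ((peval_continuous π).mul (continuous_scaledMono y d α)) hbd
      have h2 := abs_volume_sub_le hEm hE'm hEB hE'B hBb
      set I := ∫ x in E, peval π x * scaledMono y d α x with hI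
      have hI' : |I| ≤ b * volume.real E := by
        rw [← Real.norm_eq_abs]
        exact norm_setIntegral_le_of_norm_le_const hEb.measure_lt_top fun x hx => hbd x (hEB hx)
      have hvE : 0 < volume.real E := by
        have hfin : volume E ≠ ∞ := hEb.measure_lt_top.ne
        exact ENNReal.toReal_pos
          ((measure_ball_pos volume z hch).trans_le (measure_mono hbE)).ne' hfin
      rw [hsplit, hlow α hlo, hπv α hα]
      have e : (∫ x in E', peval π x * scaledMono y d α x) -
          volume.real E' * ((volume.real E)⁻¹ * I) =
          ((∫ x in E', peval π x * scaledMono y d α x) - I) -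
            (volume.real E' - volume.real E) * ((volume.real E)⁻¹ * I) := by
        field_simp
        ring
      rw [e]
      refine (abs_sub _ _).trans ?_
      rw [abs_mul, abs_mul, abs_inv, abs_of_pos hvE]
      have h3 : (volume.real E)⁻¹ * |I| ≤ b := by
        rw [inv_mul_le_iff₀ hvE]
        linarith
      have h4 : |volume.real E' - volume.real E| * ((volume.real E)⁻¹ * |I|) ≤ 2 * V * b :=
        mul_le_mul (h2.trans hVr) h3 (by positivity) (by positivity)
      have h5 := h1.trans (mul_le_mul_of_nonneg_left hVr hb0)
      linarith
    · have hhi : k < α.1 + α.2 + 2 := by omega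
      have hbd : ∀ x ∈ closedBall z (c₂ * h), |peval (π - Pv) x * scaledMono y d α x| ≤ b :=
        fun x hx => by
        rw [abs_mul, peval_sub]
        have h1 : |peval π x - peval Pv x| ≤ C₁ / c₁ * (1 + cP) * ν / h := by
          refine (abs_sub _ _).trans ((add_le_add (hπsup x hx) (hPsup x hx)).trans_eq ?_)
          ring
        calc _ ≤ C₁ / c₁ * (1 + cP) * ν / h * r ^ k := by
              gcongr
              exact hmono x hx α hα
          _ = _ := by rw [hb]; ring
      have h1 := abs_setIntegral_sub_le (f := fun x => peval (π - Pv) x * scaledMono y d α x)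
        hEm hE'm hEB hE'B hBb ((peval_continuous (π - Pv)).mul (continuous_scaledMono y d α)) hbd
      have h2 : ∫ x in E, peval (π - Pv) x * scaledMono y d α x = 0 := by
        have h3 := hhigh α hα hhi
        simp only [peval_sub, sub_mul] at h3 ⊢
        rw [integral_sub (integrable_mul_of_memLp (hpm Pv) (hm α))
          (integrable_mul_of_memLp hv (hm α)), hπv α hα] at h3
        rw [integral_sub (integrable_mul_of_memLp (hpm π) (hm α))
          (integrable_mul_of_memLp (hpm Pv) (hm α))]
        linarith
      have h4 : ∫ x in E', peval (π - p) x * scaledMono y d α x =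
          ∫ x in E', peval (π - Pv) x * scaledMono y d α x := by
        rw [hsplit, hhigh' α hα hhi]
        simp only [peval_sub, sub_mul]
        exact (integral_sub (integrable_mul_of_memLp (hpm' π) hm')
          (integrable_mul_of_memLp (hpm' Pv) hm')).symm
      rw [h2, sub_zero] at h1
      rw [h4]
      have h5 := h1.trans (mul_le_mul_of_nonneg_left hVr hb0)
      have : 0 ≤ b * V := by positivity
      linarith
  have hq := hmom z y h d hh hd1 hd2 hyz E' hE'b hbE' (π - p) (totalDegree_sub_le hπ.1 hp)
    (4 * b * V) hJ
  set s := C₂ * (4 * b * V) / h ^ 2 with hs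
  have hs0 : 0 ≤ s := by positivity
  have hqs : ∀ x ∈ E, |peval (π - p) x| ≤ s := fun x hx => by
    rw [hs, le_div_iff₀ (by positivity)]
    exact hq x (hEB hx)
  have hfin : √(∫ x in E, (peval π x - peval p x) ^ 2) ≤ 2 * c₂ * h * s := by
    rw [Real.sqrt_le_left (by positivity)]
    have h1 : ∫ x in E, (peval π x - peval p x) ^ 2 ≤ s ^ 2 * volume.real E := by
      refine (Real.le_norm_self _).trans (norm_setIntegral_le_of_norm_le_const
        hEb.measure_lt_top fun x hx => ?_)
      rw [← peval_sub, Real.norm_of_nonneg (sq_nonneg _), ← sq_abs]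
      exact pow_le_pow_left₀ (abs_nonneg _) (hqs x hx) 2
    have h2 : volume.real E ≤ (2 * c₂ * h) ^ 2 := by
      have h3 : volume.real E ≤ volume.real (closedBall z (c₂ * h)) :=
        measureReal_mono hEB hBb.measure_lt_top.ne
      refine h3.trans ?_
      have hch2 : 0 ≤ c₂ * h := by positivity
      rw [measureReal_def, EuclideanSpace.volume_closedBall_fin_two, ← ENNReal.ofReal_pow hch2,
        ENNReal.toReal_mul, ENNReal.toReal_ofReal (by positivity)]
      have : (ENNReal.ofReal Real.pi).toReal = Real.pi := ENNReal.toReal_ofReal Real.pi_pos.le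
      rw [this]
      nlinarith [Real.pi_le_four, sq_nonneg (c₂ * h)]
    calc _ ≤ s ^ 2 * (2 * c₂ * h) ^ 2 := h1.trans (by gcongr)
      _ = _ := by ring
  calc _ ≤ 2 * c₂ * h * s * h ^ 2 := by gcongr
    _ = _ := by
        rw [hs, hb]
        field_simp

/-! ### The physical and the projected element -/

namespace CurvedPolygon

variable {D : CurvedPolygon}

theorem le_diam {z : Plane} {r s : ℝ} (hr : 0 ≤ r) (h : ball z r ⊆ D.domain)
    (h' : D.domain ⊆ closedBall z s) : r ≤ D.diam := by
  have h1 := diam_mono h (isBounded_closedBall.subset h')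
  rw [diam_ball_eq z hr] at h1
  change r ≤ Metric.diam D.domain
  linarith

theorem diam_le {z : Plane} {s : ℝ} (hs : 0 ≤ s) (h' : D.domain ⊆ closedBall z s) :
    D.diam ≤ 2 * s :=
  (diam_mono h' isBounded_closedBall).trans (diam_closedBall hs)

theorem centroid_mem_closedBall {z : Plane} {r s : ℝ} (hr : 0 < r) (h : ball z r ⊆ D.domain)
    (hD : MeasurableSet D.domain) (h' : D.domain ⊆ closedBall z s) :
    D.centroid ∈ closedBall z s := by
  have hb : Bornology.IsBounded D.domain := isBounded_closedBall.subset h'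
  refine (convex_closedBall z s).set_average_mem isClosed_closedBall
    (((measure_ball_pos volume z hr).trans_le (measure_mono h)).ne') hb.measure_lt_top.ne ?_ ?_
  · filter_upwards [ae_restrict_mem hD] with x hx using h' hx
  · exact (continuous_id.continuousOn.integrableOn_compact hb.isCompact_closure).mono_set
      subset_closure

theorem existsUnique_isApproxProj (k : ℕ) {Epi : Set Plane} (hEpi : Bornology.IsBounded Epi)
    {z : Plane} {r : ℝ} (hr : 0 < r) (hball : ball z r ⊆ Epi) (hD : 0 < D.diam)
    (P : (Plane → ℝ) → Poly) (v : Plane → ℝ) : ∃! p, D.IsApproxProj k Epi P v p := by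
  obtain ⟨p, ⟨hp, hpm⟩, huniq⟩ := exists_poly_moments k hEpi hr hball D.centroid hD fun α =>
    if α.1 + α.2 + 2 ≤ k then volume.real Epi * D.internalDof α v
    else ∫ x in Epi, peval (P v) x * D.monomial α x
  refine ⟨p, ⟨hp, fun α hα => ?_, fun α hα hα' => ?_⟩, fun q hq => huniq q ⟨hq.1, fun α hα => ?_⟩⟩
  · have h := hpm α (mem_multiIdx.2 (by omega))
    rwa [if_pos hα] at h
  · have h := hpm α (mem_multiIdx.2 hα)
    rwa [if_neg (by omega)] at h
  · split_ifs with h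
    · exact hq.2.1 α h
    · exact hq.2.2 α (mem_multiIdx.1 hα) (by omega)

theorem exists_isApproxProj_bound (k : ℕ) {c₁ c₂ : ℝ} (hc₁ : 0 < c₁) (hc : c₁ ≤ c₂) (cP : ℝ≥0) :
    ∃ C > 0, ∀ (D : CurvedPolygon) (Epi : Set Plane) (z : Plane) (h : ℝ), 0 < h →
    MeasurableSet D.domain → MeasurableSet Epi →
    ball z (c₁ * h) ⊆ D.domain → ball z (c₁ * h) ⊆ Epi →
    D.domain ⊆ closedBall z (c₂ * h) → Epi ⊆ closedBall z (c₂ * h) →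
    ∀ V : ℝ, 0 ≤ V → volume (D.domain \ Epi) ≤ ENNReal.ofReal (V * h ^ 2) →
    volume (Epi \ D.domain) ≤ ENNReal.ofReal (V * h ^ 2) →
    ∀ (P : (Plane → ℝ) → Poly), D.IsAuxProj k cP P → ∀ v, D.MemV k P v → ∀ p : Poly,
    D.IsApproxProj k Epi P v p →
    l2Norm D.domain (fun x => peval (l2Proj k D.domain v) x - peval p x) ≤
      ENNReal.ofReal (C * V) * l2Norm D.domain v ∧
    l2Norm D.domain (peval p) ≤ ENNReal.ofReal (1 + C * V) * l2Norm D.domain v := by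
  obtain ⟨C, hC, H⟩ := exists_projection_diff_bound k hc₁ hc cP
  refine ⟨C, hC, fun D Epi z h hh hDm hEm hb hb' hcb hcb' V hV hV1 hV2 P hP v hv p hp => ?_⟩
  have hch : 0 < c₁ * h := by positivity
  have hDb : Bornology.IsBounded D.domain := isBounded_closedBall.subset hcb
  have hv2 : MemLp v 2 (volume.restrict D.domain) := hv.1.1.1
  have hπ := exists_isL2Proj k hDb hch hb hv2
  set π := l2Proj k D.domain v
  have hpm : ∀ g : Poly, MemLp (peval g) 2 (volume.restrict D.domain) := fun g =>
    memLp_two_of_continuous hDb (peval_continuous g)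
  have hst : √(∫ x in D.domain, peval (P v) x ^ 2) ≤ cP * √(∫ x in D.domain, v x ^ 2) := by
    have h1 := hP.stable v hv.1
    rwa [l2Norm_eq (hpm _), l2Norm_eq hv2, ← ENNReal.ofReal_coe_nnreal,
      ← ENNReal.ofReal_mul cP.coe_nonneg, ENNReal.ofReal_le_ofReal_iff (by positivity)] at h1
  have h1 := H z D.centroid h D.diam hh (le_diam hch.le hb hcb)
    ((diam_le (by nlinarith) hcb).trans_eq (mul_assoc _ _ _).symm)
    (centroid_mem_closedBall hch hb hDm hcb) D.domain Epi hDm hEm hb hb' hcb hcb' (V * h ^ 2)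
    hV1 hV2 (by positivity) v π (P v) p hv2 hπ (hP.degree_le v hv.1) hst hp.1 hp.2.1 hv.2 hp.2.2
  have h2 : √(∫ x in D.domain, (peval π x - peval p x) ^ 2) ≤
      C * V * √(∫ x in D.domain, v x ^ 2) := by
    refine le_of_mul_le_mul_right (h1.trans_eq ?_) (by positivity : 0 < h ^ 2)
    ring
  have h3 : l2Norm D.domain (fun x => peval π x - peval p x) ≤
      ENNReal.ofReal (C * V) * l2Norm D.domain v := by
    rw [l2Norm_eq (u := fun x => peval π x - peval p x) ((hpm π).sub (hpm p)), l2Norm_eq hv2,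
       ← ENNReal.ofReal_mul (by positivity)]
    exact ENNReal.ofReal_le_ofReal h2
  refine ⟨h3, ?_⟩
  have h4 : l2Norm D.domain (peval π) ≤ l2Norm D.domain v := by
    have h5 := hπ.integral_sq_sub_le hDb hv2 (p := 0) (by simp)
    have h6 : ∀ x, peval 0 x = 0 := fun x => by simp [peval]
    simp only [h6, sub_zero] at h5
    rw [l2Norm_eq (hpm π), l2Norm_eq hv2]
    exact ENNReal.ofReal_le_ofReal (Real.sqrt_le_sqrt h5)
  have h5 : peval p = peval π - fun x => peval π x - peval p x := by
    funext x
    simp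
  calc l2Norm D.domain (peval p)
      = eLpNorm (peval π - fun x => peval π x - peval p x) 2 (volume.restrict D.domain) := by
        rw [← h5, l2Norm]
    _ ≤ l2Norm D.domain (peval π) + l2Norm D.domain fun x => peval π x - peval p x :=
        eLpNorm_sub_le (hpm π).1 ((hpm π).sub (hpm p)).1 (by norm_num)
    _ ≤ l2Norm D.domain v + ENNReal.ofReal (C * V) * l2Norm D.domain v := add_le_add h4 h3
    _ = _ := by
        rw [ENNReal.ofReal_add zero_le_one (by positivity), add_mul, ENNReal.ofReal_one, one_mul]

end CurvedPolygon

theorem exists_physElement_geometry (l : ℕ) (hl : 1 ≤ l) {a j₀ : ℝ} (ha : 0 < a) (hj₀ : 0 < j₀)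
    (cF : ℝ≥0) : ∃ C ≥ 1, ∃ ε > 0, ∀ E : PolygonalElement, E.ShapeRegular a → E.diam ≤ 1 →
    ∀ (F : Plane → Plane) (M K : ℝ), FieldBounds l E.carrier F j₀ M K →
    (1 + K) ^ 2 * E.diam ≤ ε → ∀ Fh : Plane → Plane, (∀ i, E.toCurved.MemW l fun x => Fh x i) →
    IsAccurateOn l cF E F Fh → ∃ z : Plane,
      MeasurableSet (physElement Fh E).domain ∧ MeasurableSet (projElement l Fh E) ∧
      ball z (E.diam / (C * (1 + M))) ⊆ (physElement Fh E).domain ∧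
      ball z (E.diam / (C * (1 + M))) ⊆ projElement l Fh E ∧
      (physElement Fh E).domain ⊆ closedBall z (C * (1 + M) * E.diam) ∧
      projElement l Fh E ⊆ closedBall z (C * (1 + M) * E.diam) ∧
      volume ((physElement Fh E).domain \ projElement l Fh E) ≤
        ENNReal.ofReal (C * (1 + M) ^ 3 * (1 + K) * E.diam ^ l * E.diam ^ 2) ∧
      volume (projElement l Fh E \ (physElement Fh E).domain) ≤
        ENNReal.ofReal (C * (1 + M) ^ 3 * (1 + K) * E.diam ^ l * E.diam ^ 2) := by
  obtain ⟨C₀, hC₀, ε₀, hε₀, H₀⟩ := exists_discrete_field_bound l hl ha hj₀ cF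
  obtain ⟨C, hC, ε, hε, H⟩ := exists_image_geometry ha hj₀ hC₀ hl
  refine ⟨C, hC, min ε₀ ε, lt_min hε₀ hε, fun E hE hd F M K hFB hK Fh hW hacc => ?_⟩
  obtain ⟨x₀, hx₀, H⟩ := H E hE hd
  obtain ⟨p, A, hA, hp, hFp⟩ := H₀ E hE hd x₀ hx₀ F M K hFB (hK.trans (min_le_left _ _)) Fh hW hacc
  obtain ⟨z, hz⟩ := H M K hFB.nonneg hFB.le (hK.trans (min_le_right _ _)) p A hA hp
  have hc : ContinuousOn Fh E.carrier := by
    have h1 : ContinuousOn (fun x => WithLp.toLp 2 fun i => Fh x i) E.carrier :=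
      (PiLp.continuous_toLp 2 _).comp_continuousOn
        (continuousOn_pi.2 fun i => (hW i).2.1.mono subset_closure)
    exact h1
  have hc' : ContinuousOn (vecL2Proj l E.carrier Fh) E.carrier :=
    (continuous_polyField fun i => l2Proj l E.carrier fun y => Fh y i).continuousOn
  have hb : ∀ i, ∀ x ∈ E.carrier, |Fh x i - peval (p i) x| ≤ C₀ * K * E.diam ^ (l + 1) :=
    fun i x hx => (hFp i).1 x (subset_closure hx)
  have hb' : ∀ i, ∀ x ∈ E.carrier, |vecL2Proj l E.carrier Fh x i - peval (p i) x| ≤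
    C₀ * K * E.diam ^ (l + 1) := fun i => (hFp i).2
  obtain ⟨h1, h2, h3⟩ := hz Fh hc hb
  obtain ⟨h1', h2', h3'⟩ := hz _ hc' hb'
  exact ⟨z, measurableSet_image_of_continuousOn E.isOpen E.isBounded hc,
    measurableSet_image_of_continuousOn E.isOpen E.isBounded hc', h1, h1', h2, h2',
    h3 _ hc' hb', h3' _ hc hb⟩

theorem exists_approxProj_bound (k l : ℕ) (hl : 1 ≤ l) {a j₀ : ℝ} (ha : 0 < a) (hj₀ : 0 < j₀)
    (cF cP : ℝ≥0) : ∃ C : ℝ≥0 → ℝ≥0, ∃ ε > 0, ∀ E : PolygonalElement, E.ShapeRegular a →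
    ∀ (F : Plane → Plane) (M K : ℝ), FieldBounds l E.carrier F j₀ M K →
    (1 + K) ^ 2 * E.diam ≤ ε → ∀ Fh : Plane → Plane, (∀ i, E.toCurved.MemW l fun x => Fh x i) →
    IsAccurateOn l cF E F Fh → ∀ P : (Plane → ℝ) → Poly, (physElement Fh E).IsAuxProj k cP P →
    ∀ v, (physElement Fh E).MemV k P v →
      IsL2Proj k (physElement Fh E).domain v (l2Proj k (physElement Fh E).domain v) ∧
      (∃! p, (physElement Fh E).IsApproxProj k (projElement l Fh E) P v p) ∧
      ∀ p, (physElement Fh E).IsApproxProj k (projElement l Fh E) P v p →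
        ∀ s ≤ l, ∀ R : ℝ≥0, M ≤ R → (s = l → K ≤ R) →
          l2Norm (physElement Fh E).domain
              (fun x => peval (l2Proj k (physElement Fh E).domain v) x - peval p x) ≤
            C R * ENNReal.ofReal (E.diam ^ s) * l2Norm (physElement Fh E).domain v ∧
          l2Norm (physElement Fh E).domain (peval p) ≤
            C R * l2Norm (physElement Fh E).domain v := by
  obtain ⟨Cg, hCg, ε, hε, H⟩ := exists_physElement_geometry l hl ha hj₀ cF
  have hc₁ : ∀ R : ℝ≥0, 0 < 1 / (Cg * (1 + (R : ℝ))) := fun R => by positivity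
  have hc : ∀ R : ℝ≥0, 1 / (Cg * (1 + (R : ℝ))) ≤ Cg * (1 + (R : ℝ)) := fun R => by
    have h1 : 1 ≤ Cg * (1 + (R : ℝ)) :=
      one_le_mul_of_one_le_of_one_le hCg (le_add_of_nonneg_right R.coe_nonneg)
    exact (div_le_one₀ (by positivity)).2 h1 |>.trans h1
  choose CP hCP HP using fun R : ℝ≥0 =>
    CurvedPolygon.exists_isApproxProj_bound k (hc₁ R) (hc R) cP
  refine ⟨fun R => (1 + CP R * (Cg * (1 + (R : ℝ)) ^ 4)).toNNReal, min 1 ε, lt_min one_pos hε,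
    fun E hE F M K hFB hKd Fh hW hacc P hP v hv => ?_⟩
  have hM0 : 0 ≤ M := hFB.nonneg
  have hK0 : 0 ≤ K := hM0.trans hFB.le
  have hd := E.diam_pos
  have hKd1 : (1 + K) ^ 2 * E.diam ≤ 1 := hKd.trans (min_le_left _ _)
  have hKd' : (1 + K) * E.diam ≤ 1 := by nlinarith [mul_nonneg hK0 hd.le]
  have hd1 : E.diam ≤ 1 := by nlinarith [mul_nonneg hK0 hd.le]
  obtain ⟨z, hm₁, hm₂, hb₁, hb₂, hB₁, hB₂, hV₁, hV₂⟩ := H E hE hd1 F M K hFB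
    (hKd.trans (min_le_right _ _)) Fh hW hacc
  have hr : 0 < E.diam / (Cg * (1 + M)) := by positivity
  refine ⟨exists_isL2Proj k (Metric.isBounded_closedBall.subset hB₁) hr hb₁ hv.1.1.1,
    CurvedPolygon.existsUnique_isApproxProj k (Metric.isBounded_closedBall.subset hB₂) hr
      hb₂ (hr.trans_le (CurvedPolygon.le_diam hr.le hb₁ hB₁)) P v,
    fun p hp s hs R hMR hKR => ?_⟩
  set d := E.diam with hd'
  set V := Cg * (1 + (R : ℝ)) ^ 4 * d ^ s with hV
  have hV0 : 0 ≤ V := by positivity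
  have hVle : Cg * (1 + M) ^ 3 * (1 + K) * d ^ l ≤ V := by
    have h1 : (1 + K) * d ^ l ≤ (1 + R) * d ^ s := by
      rcases hs.eq_or_lt with rfl | hs
      · have hKR := hKR rfl
        gcongr
      · obtain ⟨n, rfl⟩ := Nat.exists_eq_add_of_lt hs
        have h2 : d ^ (s + n) ≤ d ^ s := pow_le_pow_of_le_one hd.le hd1 (by omega)
        have h3 : 0 ≤ (R : ℝ) * d ^ s := by positivity
        calc (1 + K) * d ^ (s + n + 1) = (1 + K) * d * d ^ (s + n) := by ring
          _ ≤ 1 * d ^ s := by gcongr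
          _ ≤ _ := by linarith
    calc Cg * (1 + M) ^ 3 * (1 + K) * d ^ l = Cg * (1 + M) ^ 3 * ((1 + K) * d ^ l) := by ring
      _ ≤ Cg * (1 + R) ^ 3 * ((1 + R) * d ^ s) := by gcongr
      _ = V := by ring
  have hball : Metric.ball z (1 / (Cg * (1 + (R : ℝ))) * d) ⊆
      Metric.ball z (d / (Cg * (1 + M))) := Metric.ball_subset_ball <| by
    rw [one_div_mul_eq_div]
    gcongr
  have hcball : Metric.closedBall z (Cg * (1 + M) * d) ⊆
      Metric.closedBall z (Cg * (1 + (R : ℝ)) * d) := Metric.closedBall_subset_closedBall <| by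
    gcongr
  have hVd : ENNReal.ofReal (Cg * (1 + M) ^ 3 * (1 + K) * d ^ l * d ^ 2) ≤
      ENNReal.ofReal (V * d ^ 2) := ENNReal.ofReal_le_ofReal (by gcongr)
  obtain ⟨h1, h2⟩ := HP R _ _ z d hd hm₁ hm₂ (hball.trans hb₁) (hball.trans hb₂)
    (hB₁.trans hcball) (hB₂.trans hcball) V hV0 (hV₁.trans hVd) (hV₂.trans hVd) P hP v hv p hp
  have hCR := hCP R
  have hCVs : CP R * V = CP R * (Cg * (1 + (R : ℝ)) ^ 4) * d ^ s := by rw [hV]; ring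
  refine ⟨h1.trans (mul_le_mul_left ?_ _), h2.trans (mul_le_mul_left ?_ _)⟩
  · change _ ≤ ENNReal.ofReal _ * _
    rw [← ENNReal.ofReal_mul (by positivity), hCVs]
    refine ENNReal.ofReal_le_ofReal (mul_le_mul_of_nonneg_right ?_ (by positivity))
    linarith
  · refine ENNReal.ofReal_le_ofReal (add_le_add_right ?_ _)
    rw [hCVs]
    exact mul_le_of_le_one_right (by positivity) (pow_le_one₀ hd.le hd1)

end IsoVEM

theorem mainTheorem5 (k l : ℕ) (hk : 1 ≤ k) (hl : 1 ≤ l) (a j₀ : ℝ) (ha : 0 < a) (hj₀ : 0 < j₀)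
    (cF cP : ℝ≥0) :
    ∃ C : ℕ → ℝ≥0 → ℝ≥0,
      ∀ (m : ℕ) (Ω : Set IsoVEM.Plane) (F : IsoVEM.Plane → IsoVEM.Plane),
        l ≤ m → IsoVEM.IsPolygonalDomain Ω → IsoVEM.IsRefMap m j₀ Ω F →
        ∃ h₀ : ℝ, 0 < h₀ ∧
          ∀ (N : ℕ) (T : Fin N → IsoVEM.PolygonalElement)
            (Q : Fin N → (IsoVEM.Plane → ℝ) → IsoVEM.Poly) (Fh : IsoVEM.Plane → IsoVEM.Plane),
            IsoVEM.IsMesh Ω T → (∀ e, (T e).ShapeRegular a) → IsoVEM.meshSize T ≤ h₀ →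
            (∀ e, (T e).toCurved.IsAuxProj l cP (Q e)) →
            (∀ i, IsoVEM.MemGlobalV l Ω T Q (fun x => Fh x i)) →
            (∀ e, IsoVEM.IsAccurateOn l cF (T e) F Fh) →
            ∀ (e : Fin N) (P : (IsoVEM.Plane → ℝ) → IsoVEM.Poly),
              (IsoVEM.physElement Fh (T e)).IsAuxProj k cP P →
              ∀ v : IsoVEM.Plane → ℝ, (IsoVEM.physElement Fh (T e)).MemV k P v →
                IsoVEM.IsL2Proj k (IsoVEM.physElement Fh (T e)).domain v
                  (IsoVEM.l2Proj k (IsoVEM.physElement Fh (T e)).domain v) ∧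
                (∃! p : IsoVEM.Poly, (IsoVEM.physElement Fh (T e)).IsApproxProj k
                  (IsoVEM.projElement l Fh (T e)) P v p) ∧
                ∀ p : IsoVEM.Poly, (IsoVEM.physElement Fh (T e)).IsApproxProj k
                    (IsoVEM.projElement l Fh (T e)) P v p →
                  ∀ s ≤ l, ∀ R : ℝ≥0, IsoVEM.vecNormTop (s + 1) (T e).carrier F ≤ R →
                    IsoVEM.l2Norm (IsoVEM.physElement Fh (T e)).domain
                        (fun x => IsoVEM.peval
                          (IsoVEM.l2Proj k (IsoVEM.physElement Fh (T e)).domain v) x -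
                            IsoVEM.peval p x) ≤
                      C s R * ENNReal.ofReal ((T e).diam ^ s) *
                        IsoVEM.l2Norm (IsoVEM.physElement Fh (T e)).domain v ∧
                    IsoVEM.l2Norm (IsoVEM.physElement Fh (T e)).domain (IsoVEM.peval p) ≤
                      C s R * IsoVEM.l2Norm (IsoVEM.physElement Fh (T e)).domain v := by
  obtain ⟨C, ε, hε, H⟩ := IsoVEM.exists_approxProj_bound k l hl ha hj₀ cF cP
  refine ⟨fun _ R => C R, fun m Ω F hlm hΩ hF =>
    ⟨ε / (1 + (IsoVEM.vecNormTop (l + 1) Ω F).toReal) ^ 2, by positivity,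
      fun N T Q Fh hT hTa hmesh hQ hFh hacc e P hP v hv => ?_⟩⟩
  obtain ⟨hle, hfin, hFB⟩ := hF.fieldBounds hlm hΩ.1 hΩ.2.2.1 (T e).isOpen (hT.1 e)
  have hd : (T e).diam ≤ ε / (1 + (IsoVEM.vecNormTop (l + 1) Ω F).toReal) ^ 2 :=
    (le_ciSup (Set.finite_range fun e => (T e).diam).bddAbove e).trans hmesh
  have hK : (1 + (IsoVEM.vecNormTop (l + 1) (T e).carrier F).toReal) ^ 2 * (T e).diam ≤ ε := by
    have h1 := ENNReal.toReal_mono hfin hle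
    rw [le_div_iff₀ (by positivity), mul_comm] at hd
    exact (mul_le_mul_of_nonneg_right (pow_le_pow_left₀ (by positivity) (by linarith) 2)
      (T e).diam_pos.le).trans hd
  obtain ⟨h1, h2, h3⟩ := H (T e) (hTa e) F _ _ hFB hK Fh (fun i => ((hFh i).2 e).1) (hacc e)
    P hP v hv
  refine ⟨h1, h2, fun p hp s hs R hR => h3 p hp s hs R ?_ ?_⟩
  · exact ENNReal.toReal_le_coe_of_le_coe ((IsoVEM.vecNormTop_mono (by omega) _ _).trans hR)
  · rintro rfl
    exact ENNReal.toReal_le_coe_of_le_coe hR
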